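/- Let $\mathcal H$ be a complex Hilbert space, let $(T_1,T_2)$ be a commuting pair of contractions on $\mathcal H$, and put $T=T_1T_2=T_2T_1$, $D_S=(I-S^*S)^{1/2}$, $\mathcal D_S=\overline{\operatorname{Ran}}\,D_S$. **Lifts.** An *Andô lift* of $(T_1,T_2)$ is a triple $(\Pi,V_1,V_2)$ where $\Pi:\mathcal H\to\mathcal K$ is an isometry into a Hilbert space and $V_1,V_2$ are commuting isometries on $\mathcal K$ with $V_j^*\Pi=\Pi T_j^*$ ($j=1,2$). It is *minimal* if $\mathcal K$ is the smallest closed subspace that contains $\operatorname{Ran}\Pi$ and is invariant under $V_1$ and $V_2$. Two lifts $(\Pi,V_1,V_2)$ and $(\Pi',V_1',V_2')$ are *unitarily equivalent* if there is a unitary $\tau:\mathcal K\to\mathcal K'$ with $\tau\Pi=\Pi'$ and $\tau V_j=V_j'\tau$ ($j=1,2$). **Tuples.** A *Type I Andô tuple* for $(T_1^*,T_2^*)$ is $(\mathcal F,\Lambda,P,U)$ with $\mathcal F$ a Hilbert space, $\Lambda:\mathcal D_{T^*}\to\mathcal F$ an isometry, $P$ an orthogonal projection and $U$ a unitary on $\mathcal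 F$, such that $$P^\perp U\Lambda D_{T^*}+PU\Lambda D_{T^*}T^*=\Lambda D_{T^*}T_1^*,\qquad U^*P\Lambda D_{T^*}+U^*P^\perp\Lambda D_{T^*}T^*=\Lambda D_{T^*}T_2^* .$$ It is *minimal* if $H^2(\mathcal F)$ is the smallest closed subspace that contains $H^2(\operatorname{Ran}\Lambda)$ and is invariant under $M_{U^*(P^\perp+zP)}$ and $M_{(P+zP^\perp)U}$. Two tuples $(\mathcal F,\Lambda,P,U)$, $(\mathcal F',\Lambda',P',U')$ *coincide* if there is a unitary $\omega:\mathcal F\to\mathcal F'$ with $\omega\Lambda=\Lambda'$, $\omega P=P'\omega$, $\omega U=U'\omega$. **Douglas model.** Let $Q_{T^*}=\big(\text{SOT-}\lim_n T^nT^{*n}\big)^{1/2}$, let $X^*$ be the isometry on $\overline{\operatorname{Ran}}\,Q_{T^*}$ with $X^*Q_{T^*}=Q_{T^*}T^*$, and let $W_D^*$ on $\mathcal Q_{T^*}\supseteq\overline{\operatorname{Ran}}\,Q_{T^*}$ be its minimal unitary extension. For $j=1,2$ let $W_{\flat j}$ be the unitary on $\mathcal Q_{T^*}$ determined by $W_{\flat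 j}^*W_D^nQ_{T^*}=W_D^nQ_{T^*}T_j^*$ ($n\ge0$). The Douglas model of a Type I tuple is the triple on $H^2(\mathcal F)\oplus\mathcal Q_{T^*}$ given by $$\Pi_Dh=\Big(\sum_{n\ge0}z^n\Lambda D_{T^*}T^{*n}h,\;Q_{T^*}h\Big),\quad V_{D,1}=M_{U^*(P^\perp+zP)}\oplus W_{\flat1},\quad V_{D,2}=M_{(P+zP^\perp)U}\oplus W_{\flat2}.$$ **Sz.-Nagy–Foias model.** Suppose that $T$ is completely non-unitary (no nonzero reducing subspace on which $T$ is unitary). Let $\Theta_T(z)=(-T+zD_{T^*}(I-zT^*)^{-1}D_T)|_{\mathcal D_T}:\mathcal D_T\to\mathcal D_{T^*}$ be the characteristic function and let $\Delta_{\Theta_T}=(I-M_{\Theta_T}^*M_{\Theta_T})^{1/2}$ on $L^2(\mathcal D_T)$ be the operator of multiplication by $(I-\Theta_T(\zeta)^*\Theta_T(\zeta))^{1/2}$. Let $\omega:\mathcal Q_{T^*}\to\overline{\Delta_{\Theta_T}L^2(\mathcal D_T)}$ be the canonical unitary, determined by $$\omega\Big(\sum_nW_D^n(W_DQ_{T^*}-Q_{T^*}T)h_n\Big)=\Delta_{\Theta_T}\sum_n\zeta^nD_Th_n\qquad(\text{finite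 sums over } n\in\mathbb Z,\ h_n\in\mathcal H),$$ and put $W_{\sharp j}=\omega W_{\flat j}\omega^*$. The Sz.-Nagy–Foias model of a Type I tuple is the triple on $H^2(\mathcal F)\oplus\overline{\Delta_{\Theta_T}L^2(\mathcal D_T)}$ given by $$\Pi_{NF}h=\Big(\sum_{n\ge0}z^n\Lambda D_{T^*}T^{*n}h,\;\omega Q_{T^*}h\Big),\quad V_{NF,1}=M_{U^*(P^\perp+zP)}\oplus W_{\sharp1},\quad V_{NF,2}=M_{(P+zP^\perp)U}\oplus W_{\sharp2}.$$ **Theorem.** 1. The Douglas model of every Type I Andô tuple for $(T_1^*,T_2^*)$ is an Andô lift of $(T_1,T_2)$. The Douglas models of two (not necessarily minimal) Type I Andô tuples for $(T_1^*,T_2^*)$ are unitarily equivalent as lifts if and only if the tuples coincide. 2. If $T$ is completely non-unitary, then the Sz.-Nagy–Foias model of every Type I Andô tuple for $(T_1^*,T_2^*)$ is an Andô lift of $(T_1,T_2)$ and is unitarily equivalent, as a lift, to the Douglas model of the same tuple. The Sz.-Nagy–Foias models of two Type I Andô tuples are unitarily equivalent as lifts if and only if the tuples coincide. 3. The map that sends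 a tuple to its Douglas model (or, if $T$ is completely non-unitary, to its Sz.-Nagy–Foias model) induces a bijection from the set of coincidence classes of minimal Type I Andô tuples for $(T_1^*,T_2^*)$ onto the set of unitary-equivalence classes of minimal Andô lifts of $(T_1,T_2)$; a minimal Andô lift belongs to the class assigned to a tuple exactly when it is unitarily equivalent to the model of that tuple. -/

import Mathlib

open ContinuousLinearMap
open scoped ENNReal Topology

noncomputable section

namespace Ando

universe u

/-! ### General Hilbert space operators -/

section General

variable {H : Type*} [NormedAddCommGroup H] [InnerProductSpace ℂ H] [CompleteSpace H]
variable {E F : Type*} [NormedAddCommGroup E] [InnerProductSpace ℂ E]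
  [NormedAddCommGroup F] [InnerProductSpace ℂ F]

/-- The limit of a sequence of bounded operators in the strong operator topology
(with the value `0` if there is no limit). -/
def sotLim (A : ℕ → H →L[ℂ] H) : H →L[ℂ] H :=
  open Classical in
  if h : ∃ L : H →L[ℂ] H, ∀ x, Filter.Tendsto (fun n => A n x) Filter.atTop (𝓝 (L x)) then
    h.choose
  else 0

/-- The block diagonal operator `A ⊕ B` on a Hilbert space direct sum. -/
def blockDiag {E' F' : Type*} [NormedAddCommGroup E'] [InnerProductSpace ℂ E']
    [NormedAddCommGroup F'] [InnerProductSpace ℂ F'] (A : E →L[ℂ] E') (B : F →L[ℂ] F') :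
    WithLp 2 (E × F) →L[ℂ] WithLp 2 (E' × F') :=
  (WithLp.prodContinuousLinearEquiv 2 ℂ E' F').symm.toContinuousLinearMap ∘L
    (A.prodMap B) ∘L (WithLp.prodContinuousLinearEquiv 2 ℂ E F).toContinuousLinearMap

/-- The block column operator `h ↦ (A h, B h)` into a Hilbert space direct sum. -/
def blockCol (A : H →L[ℂ] E) (B : H →L[ℂ] F) : H →L[ℂ] WithLp 2 (E × F) :=
  (WithLp.prodContinuousLinearEquiv 2 ℂ E F).symm.toContinuousLinearMap ∘L (A.prod B)

/-- The integer powers `W ^ n` of a unitary operator `W`. -/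
def unitaryZPow (W : H →L[ℂ] H) : ℤ → H →L[ℂ] H
  | Int.ofNat n => W ^ n
  | Int.negSucc n => (adjoint W) ^ (n + 1)

end General

/-! ### The Hardy space -/

section Hardy

/-- The vector-valued Hardy space `H²(F)`; the function `f(z) = ∑ zⁿ fₙ` is represented by its
square-summable sequence `(fₙ)` of Taylor coefficients. -/
abbrev H2 (F : Type*) [NormedAddCommGroup F] : Type _ := lp (fun _ : ℕ => F) 2

section Norm

variable {F : Type*} [NormedAddCommGroup F]

theorem memH2_iff (f : ℕ → F) : Memℓp f 2 ↔ Summable fun n => ‖f n‖ ^ 2 := by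
  rw [memℓp_gen_iff (by simp)]
  simp

theorem H2_norm_sq (f : H2 F) : ‖f‖ ^ 2 = ∑' n, ‖f n‖ ^ 2 := by
  have h := lp.norm_rpow_eq_tsum (p := 2) (by simp) f
  simpa using h

theorem H2_summable (f : H2 F) : Summable fun n => ‖f n‖ ^ 2 :=
  (memH2_iff _).1 (lp.memℓp f)

theorem H2_norm_le (f : H2 F) {C : ℝ} (hC : 0 ≤ C) (h : ∑' n, ‖f n‖ ^ 2 ≤ C ^ 2) : ‖f‖ ≤ C := by
  rw [← H2_norm_sq] at h
  exact (sq_le_sq₀ (norm_nonneg _) hC).1 h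

/-- The sequence `(0, f₀, f₁, …)`. -/
def shiftSeq (f : ℕ → F) : ℕ → F
  | 0 => 0
  | n + 1 => f n

theorem H2_summable_shiftSeq (f : H2 F) : Summable fun n => ‖shiftSeq f n‖ ^ 2 := by
  rw [← summable_nat_add_iff 1]
  exact H2_summable f

end Norm

variable {F G : Type*} [NormedAddCommGroup F] [InnerProductSpace ℂ F]
  [NormedAddCommGroup G] [InnerProductSpace ℂ G]

theorem H2_summable_map (A : F →L[ℂ] G) (f : H2 F) : Summable fun n => ‖A (f n)‖ ^ 2 :=
  ((H2_summable f).mul_left (‖A‖ ^ 2)).of_nonneg_of_le (fun _ => by positivity) (fun n => by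
    rw [← mul_pow]; gcongr; exact A.le_opNorm _)

/-- The operator `I_{H²} ⊗ A : H²(F) → H²(G)`, which applies `A` to each coefficient. -/
def H2.map (A : F →L[ℂ] G) : H2 F →L[ℂ] H2 G :=
  LinearMap.mkContinuous
    { toFun := fun f => ⟨fun n => A (f n), (memH2_iff _).2 (H2_summable_map A f)⟩
      map_add' := fun f g => lp.ext (funext fun n => A.map_add (f n) (g n))
      map_smul' := fun c f => lp.ext (funext fun n => A.map_smul c (f n)) } ‖A‖ (fun f => by
    refine H2_norm_le _ (by positivity) ?_
    rw [mul_pow, H2_norm_sq, ← tsum_mul_left]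
    refine Summable.tsum_le_tsum (fun n => ?_) (H2_summable_map A f) ((H2_summable f).mul_left _)
    rw [← mul_pow]; gcongr; exact A.le_opNorm _)

@[simp] theorem H2.map_apply (A : F →L[ℂ] G) (f : H2 F) (n : ℕ) : H2.map A f n = A (f n) := rfl

/-- The shift `M_z` on `H²(F)`: `(f₀, f₁, …) ↦ (0, f₀, f₁, …)`. -/
def H2.shift : H2 F →L[ℂ] H2 F :=
  LinearMap.mkContinuous
    { toFun := fun f => ⟨shiftSeq f, (memH2_iff _).2 (H2_summable_shiftSeq f)⟩
      map_add' := fun f g => lp.ext (funext fun n =>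
        match n with
        | 0 => (add_zero (0 : F)).symm
        | _ + 1 => rfl)
      map_smul' := fun c f => lp.ext (funext fun n =>
        match n with
        | 0 => (smul_zero c).symm
        | _ + 1 => rfl) } 1 (fun f => by
    refine H2_norm_le _ (by positivity) ?_
    rw [one_mul, H2_norm_sq]
    refine ((H2_summable_shiftSeq f).tsum_eq_zero_add.trans ?_).le
    simp [shiftSeq])

@[simp] theorem H2.shift_zero (f : H2 F) : H2.shift f 0 = 0 := rfl

@[simp] theorem H2.shift_succ (f : H2 F) (n : ℕ) : H2.shift f (n + 1) = f n := rfl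

/-- The backward shift on `H²(F)`: `(f₀, f₁, …) ↦ (f₁, f₂, …)`. -/
def H2.backShift : H2 F →L[ℂ] H2 F :=
  LinearMap.mkContinuous
    { toFun := fun f => ⟨fun n => f (n + 1),
        (memH2_iff _).2 ((summable_nat_add_iff 1).2 (H2_summable f))⟩
      map_add' := fun f g => rfl
      map_smul' := fun c f => rfl } 1 (fun f => by
    refine H2_norm_le _ (by positivity) ?_
    rw [one_mul, H2_norm_sq, (H2_summable f).tsum_eq_zero_add]
    exact le_add_of_nonneg_left (by positivity))

@[simp] theorem H2.backShift_apply (f : H2 F) (n : ℕ) : H2.backShift f n = f (n + 1) := rfl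

/-- Evaluation at zero `f ↦ f(0) = f₀` on `H²(F)`. -/
def H2.eval0 : H2 F →L[ℂ] F :=
  LinearMap.mkContinuous
    { toFun := fun f => f 0
      map_add' := fun f g => by simp
      map_smul' := fun c f => by simp } 1 (fun f => by
    rw [one_mul]; exact lp.norm_apply_le_norm (by simp) f 0)

@[simp] theorem H2.eval0_apply (f : H2 F) : H2.eval0 f = f 0 := rfl

/-- The multiplication operator `M_{A + zB} = I ⊗ A + M_z ⊗ B` on `H²(F)`. -/
def H2.mulLinear (A B : F →L[ℂ] F) : H2 F →L[ℂ] H2 F :=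
  H2.map A + H2.shift ∘L H2.map B

end Hardy

/-! ### Defect operators and the observability operator -/

section Defect

variable {H : Type u} [NormedAddCommGroup H] [InnerProductSpace ℂ H] [CompleteSpace H]

/-- The defect operator `D_S = (I - S* S)^{1/2}`. -/
def defectOp {H : Type*} [NormedAddCommGroup H] [InnerProductSpace ℂ H] [CompleteSpace H]
    {G : Type*} [NormedAddCommGroup G] [InnerProductSpace ℂ G] [CompleteSpace G]
    (S : H →L[ℂ] G) : H →L[ℂ] H := CFC.sqrt (1 - adjoint S ∘L S)

/-- The defect space `𝒟_S`, the closure of the range of `D_S`. -/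
def defectSpace (S : H →L[ℂ] H) : Submodule ℂ H :=
  (LinearMap.range (defectOp S).toLinearMap).topologicalClosure

instance (S : H →L[ℂ] H) : CompleteSpace (defectSpace S) :=
  inferInstanceAs (CompleteSpace (Submodule.topologicalClosure _))

/-- The defect operator as an operator from `H` into the defect space. -/
def defectMap (S : H →L[ℂ] H) : H →L[ℂ] defectSpace S :=
  (defectOp S).codRestrict _ fun h => Submodule.le_topologicalClosure _ ⟨h, rfl⟩

theorem norm_defectMap_sq (S : H →L[ℂ] H) (hS : ‖S‖ ≤ 1) (h : H) :
    ‖defectMap S h‖ ^ 2 = ‖h‖ ^ 2 - ‖S h‖ ^ 2 := by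
  have hpos : (0 : H →L[ℂ] H) ≤ 1 - adjoint S * S := by
    rw [sub_nonneg]
    have : star S * S ≤ 1 := by
      rw [← CStarAlgebra.norm_le_one_iff_of_nonneg _ (star_mul_self_nonneg S),
        CStarRing.norm_star_mul_self]
      exact mul_le_one₀ hS (norm_nonneg _) hS
    exact this
  have hsq : defectOp S * defectOp S = 1 - adjoint S * S := CFC.sqrt_mul_sqrt_self _ hpos
  have hsa : adjoint (defectOp S) = defectOp S :=
    (IsSelfAdjoint.of_nonneg (CFC.sqrt_nonneg (1 - adjoint S * S))).star_eq
  have h1 : ‖defectMap S h‖ = ‖defectOp S h‖ := rfl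
  rw [h1, apply_norm_sq_eq_inner_adjoint_left (𝕜 := ℂ), apply_norm_sq_eq_inner_adjoint_left (𝕜 := ℂ) S,
    hsa]
  change RCLike.re (inner ℂ ((defectOp S * defectOp S) h) h) = _
  rw [hsq, ← inner_self_eq_norm_sq (𝕜 := ℂ) h, sub_apply, inner_sub_left, map_sub]
  rfl

theorem sum_norm_defectMap_sq_le (S : H →L[ℂ] H) (hS : ‖S‖ ≤ 1) (h : H) (n : ℕ) :
    ∑ k ∈ Finset.range n, ‖defectMap S ((S ^ k) h)‖ ^ 2 ≤ ‖h‖ ^ 2 := by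
  have key : ∑ k ∈ Finset.range n, ‖defectMap S ((S ^ k) h)‖ ^ 2
      = ‖h‖ ^ 2 - ‖(S ^ n) h‖ ^ 2 := by
    induction n with
    | zero => simp
    | succ n ih =>
      rw [Finset.sum_range_succ, ih, norm_defectMap_sq S hS, pow_succ' S n]
      simp
  rw [key]
  exact sub_le_self _ (by positivity)

theorem summable_norm_defectMap_sq (S : H →L[ℂ] H) (hS : ‖S‖ ≤ 1) (h : H) :
    Summable fun n => ‖defectMap S ((S ^ n) h)‖ ^ 2 :=
  summable_of_sum_range_le (fun _ => by positivity) (sum_norm_defectMap_sq_le S hS h)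

/-- The observability operator `𝒪_{D_S,S} : H → H²(𝒟_S)`,
`h ↦ ∑ (D_S Sⁿ h) zⁿ = D_S (I - z S)⁻¹ h`, of a contraction `S`. -/
def obsOp (S : H →L[ℂ] H) (hS : ‖S‖ ≤ 1) : H →L[ℂ] H2 (defectSpace S) :=
  LinearMap.mkContinuous
    { toFun := fun h => ⟨fun n => defectMap S ((S ^ n) h),
        (memH2_iff _).2 (summable_norm_defectMap_sq S hS h)⟩
      map_add' := fun f g => lp.ext (funext fun n =>
        (defectMap S ∘L S ^ n).map_add f g)
      map_smul' := fun c f => lp.ext (funext fun n =>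
        (defectMap S ∘L S ^ n).map_smul c f) } 1 (fun h => by
    refine H2_norm_le _ (by positivity) ?_
    rw [one_mul]
    exact (summable_norm_defectMap_sq S hS h).tsum_le_of_sum_range_le
      (sum_norm_defectMap_sq_le S hS h))

@[simp] theorem obsOp_apply (S : H →L[ℂ] H) (hS : ‖S‖ ≤ 1) (h : H) (n : ℕ) :
    obsOp S hS h n = defectMap S ((S ^ n) h) := rfl

end Defect

/-! ### The Douglas space and the canonical commuting unitaries -/

section Douglas

variable {H : Type u} [NormedAddCommGroup H] [InnerProductSpace ℂ H] [CompleteSpace H]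

/-- `Q_{T*}`, the positive square root of the strong limit of `Tⁿ T*ⁿ`. -/
def asympOp (T : H →L[ℂ] H) : H →L[ℂ] H :=
  CFC.sqrt (sotLim fun n => T ^ n * adjoint T ^ n)

/-- The closure of the range of `Q_{T*}`. -/
def asympRange (T : H →L[ℂ] H) : Submodule ℂ H :=
  (LinearMap.range (asympOp T).toLinearMap).topologicalClosure

instance (T : H →L[ℂ] H) : CompleteSpace (asympRange T) :=
  inferInstanceAs (CompleteSpace (Submodule.topologicalClosure _))

/-- `Q_{T*}` as an operator into the closure of its range. -/
def asympMap (T : H →L[ℂ] H) : H →L[ℂ] asympRange T :=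
  (asympOp T).codRestrict _ fun h => Submodule.le_topologicalClosure _ ⟨h, rfl⟩

/-- The isometry `X*` on the closure of the range of `Q_{T*}`, the extension by continuity of
`Q_{T*} h ↦ Q_{T*} T* h`. -/
def asympIsom (T : H →L[ℂ] H) : asympRange T →L[ℂ] asympRange T :=
  (asympMap T ∘L adjoint T).toLinearMap.extendOfNorm (asympMap T).toLinearMap

/-- The defect `ker X = (Ran X*)ᗮ` of the isometry `X*`. -/
def asympKer (T : H →L[ℂ] H) : Submodule ℂ (asympRange T) :=
  LinearMap.ker (adjoint (asympIsom T)).toLinearMap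

instance (T : H →L[ℂ] H) : CompleteSpace (asympKer T) :=
  inferInstanceAs (CompleteSpace (LinearMap.ker (adjoint (asympIsom T)).toLinearMap))

/-- The space `𝒬_{T*}` of the minimal unitary extension `W_D*` of the isometry `X*`, realized
concretely as the direct sum of the closure of `Ran Q_{T*}` and of `ℓ²(ℕ, ker X)`. -/
def ResSpace (T : H →L[ℂ] H) : Type u := WithLp 2 (asympRange T × H2 (asympKer T))

instance (T : H →L[ℂ] H) : NormedAddCommGroup (ResSpace T) :=
  inferInstanceAs (NormedAddCommGroup (WithLp 2 (asympRange T × H2 (asympKer T))))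

instance (T : H →L[ℂ] H) : InnerProductSpace ℂ (ResSpace T) :=
  inferInstanceAs (InnerProductSpace ℂ (WithLp 2 (asympRange T × H2 (asympKer T))))

instance (T : H →L[ℂ] H) : CompleteSpace (ResSpace T) :=
  inferInstanceAs (CompleteSpace (WithLp 2 (asympRange T × H2 (asympKer T))))

/-- `𝒬_{T*}` as a direct sum. -/
def resEquiv (T : H →L[ℂ] H) : ResSpace T ≃L[ℂ] asympRange T × H2 (asympKer T) :=
  WithLp.prodContinuousLinearEquiv 2 ℂ (asympRange T) (H2 (asympKer T))

/-- `Q_{T*}` as an operator from `H` into `𝒬_{T*}`. -/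
def resMap (T : H →L[ℂ] H) : H →L[ℂ] ResSpace T :=
  (resEquiv T).symm.toContinuousLinearMap ∘L
    ContinuousLinearMap.inl ℂ (asympRange T) (H2 (asympKer T)) ∘L asympMap T

/-- The minimal unitary extension `W_D*` of `X*`:
`(r, (e₀, e₁, …)) ↦ (X* r + e₀, (e₁, e₂, …))`. -/
def resUnitaryAdj (T : H →L[ℂ] H) : ResSpace T →L[ℂ] ResSpace T :=
  (resEquiv T).symm.toContinuousLinearMap ∘L
    (((asympIsom T).coprod ((asympKer T).subtypeL ∘L H2.eval0 (F := asympKer T))).prod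
      (H2.backShift (F := asympKer T) ∘L
        ContinuousLinearMap.snd ℂ (asympRange T) (H2 (asympKer T)))) ∘L
    (resEquiv T).toContinuousLinearMap

/-- The unitary operator `W_D` on `𝒬_{T*}`. -/
def resUnitary (T : H →L[ℂ] H) : ResSpace T →L[ℂ] ResSpace T := adjoint (resUnitaryAdj T)

/-- The map `(hₙ) ↦ ∑ W_Dⁿ Q_{T*} S hₙ` on finitely supported sequences. -/
def resGen (T S : H →L[ℂ] H) : (ℕ →₀ H) →ₗ[ℂ] ResSpace T :=
  Finsupp.lsum ℂ fun n => ((resUnitary T ^ n) ∘L resMap T ∘L S).toLinearMap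

/-- For `T = T₁ T₂` and `j = 1, 2`, `canonicalUnitary T T_j` is the member `W_{♭j}` of the
canonical pair of commuting unitaries on `𝒬_{T*}`; its adjoint is the extension by continuity of
`W_Dⁿ Q_{T*} h ↦ W_Dⁿ Q_{T*} T_j* h`. -/
def canonicalUnitary (T Tj : H →L[ℂ] H) : ResSpace T →L[ℂ] ResSpace T :=
  adjoint ((resGen T (adjoint Tj)).extendOfNorm (resGen T 1))

end Douglas

/-! ### Andô lifts -/

section Lifts

variable {H : Type u} [NormedAddCommGroup H] [InnerProductSpace ℂ H] [CompleteSpace H]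

/-- A triple `(Π, V₁, V₂)` consisting of an operator `Π : H → K` into a Hilbert space `K` and
operators `V₁, V₂` on `K`. -/
structure LiftTriple (H : Type u) [NormedAddCommGroup H] [InnerProductSpace ℂ H] where
  K : Type u
  [normed : NormedAddCommGroup K]
  [inner : InnerProductSpace ℂ K]
  [complete : CompleteSpace K]
  emb : H →L[ℂ] K
  V₁ : K →L[ℂ] K
  V₂ : K →L[ℂ] K

attribute [instance] LiftTriple.normed LiftTriple.inner LiftTriple.complete

/-- `(Π, V₁, V₂)` is an Andô isometric lift of `(T₁, T₂)`. -/
structure IsAndoLift (T₁ T₂ : H →L[ℂ] H) (L : LiftTriple H) : Prop where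
  isometry_emb : Isometry L.emb
  isometry_V₁ : Isometry L.V₁
  isometry_V₂ : Isometry L.V₂
  comm : L.V₁ * L.V₂ = L.V₂ * L.V₁
  intertwine₁ : adjoint L.V₁ ∘L L.emb = L.emb ∘L adjoint T₁
  intertwine₂ : adjoint L.V₂ ∘L L.emb = L.emb ∘L adjoint T₂

/-- The lift is minimal: the smallest closed subspace invariant for `V₁` and `V₂` and containing
`Ran Π` is the whole space. -/
def LiftTriple.IsMinimal (L : LiftTriple H) : Prop :=
  ∀ N : Submodule ℂ L.K, IsClosed (N : Set L.K) → (∀ h, L.emb h ∈ N) →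
    (∀ k ∈ N, L.V₁ k ∈ N) → (∀ k ∈ N, L.V₂ k ∈ N) → N = ⊤

/-- Unitary equivalence of lifts: a unitary `τ` with `τ Π = Π'`, `τ V₁ = V₁' τ`, `τ V₂ = V₂' τ`. -/
def UnitarilyEquivalent (L L' : LiftTriple H) : Prop :=
  ∃ τ : L.K ≃ₗᵢ[ℂ] L'.K, (∀ h, τ (L.emb h) = L'.emb h) ∧
    (∀ k, τ (L.V₁ k) = L'.V₁ (τ k)) ∧ (∀ k, τ (L.V₂ k) = L'.V₂ (τ k))

theorem UnitarilyEquivalent.equivalence : Equivalence (UnitarilyEquivalent (H := H)) where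
  refl L := ⟨LinearIsometryEquiv.refl ℂ L.K, fun _ => rfl, fun _ => rfl, fun _ => rfl⟩
  symm := by
    rintro L L' ⟨τ, h0, h1, h2⟩
    refine ⟨τ.symm, fun h => ?_, fun k => ?_, fun k => ?_⟩
    · rw [← h0, τ.symm_apply_apply]
    · apply τ.injective; rw [h1]; simp
    · apply τ.injective; rw [h2]; simp
  trans := by
    rintro L L' L'' ⟨τ, h0, h1, h2⟩ ⟨σ, g0, g1, g2⟩
    exact ⟨τ.trans σ, fun h => by simp [h0, g0], fun k => by simp [h1, g1],
      fun k => by simp [h2, g2]⟩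

/-- The minimal Andô lifts of `(T₁, T₂)`. -/
abbrev MinimalAndoLift (T₁ T₂ : H →L[ℂ] H) : Type (u + 1) :=
  {L : LiftTriple H // IsAndoLift T₁ T₂ L ∧ L.IsMinimal}

/-- Unitary equivalence of minimal Andô lifts. -/
instance liftSetoid (T₁ T₂ : H →L[ℂ] H) : Setoid (MinimalAndoLift T₁ T₂) where
  r L L' := UnitarilyEquivalent L.1 L'.1
  iseqv := ⟨fun L => UnitarilyEquivalent.equivalence.refl L.1,
    UnitarilyEquivalent.equivalence.symm, UnitarilyEquivalent.equivalence.trans⟩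

end Lifts

/-! ### Andô tuples -/

section Tuples

variable {H : Type u} [NormedAddCommGroup H] [InnerProductSpace ℂ H] [CompleteSpace H]

/-- A pre-Andô tuple `(ℱ, Λ, P, U)` for a commuting contractive pair with product `S`: a Hilbert
space `ℱ`, an isometry `Λ : 𝒟_S → ℱ`, an orthogonal projection `P` and a unitary `U` on `ℱ`. -/
structure PreAndoTuple (S : H →L[ℂ] H) where
  F : Type u
  [normed : NormedAddCommGroup F]
  [inner : InnerProductSpace ℂ F]
  [complete : CompleteSpace F]
  Lam : defectSpace S →ₗᵢ[ℂ] F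
  P : F →L[ℂ] F
  U : F →L[ℂ] F
  isProj : IsStarProjection P
  isUnitary : U ∈ unitary (F →L[ℂ] F)

attribute [instance] PreAndoTuple.normed PreAndoTuple.inner PreAndoTuple.complete

namespace PreAndoTuple

variable {S : H →L[ℂ] H}

/-- The operator `M_{U*(Pᗮ + zP)}` on `H²(ℱ)`. -/
def M₁ (t : PreAndoTuple S) : H2 t.F →L[ℂ] H2 t.F :=
  H2.mulLinear (adjoint t.U * (1 - t.P)) (adjoint t.U * t.P)

/-- The operator `M_{(P + zPᗮ)U}` on `H²(ℱ)`. -/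
def M₂ (t : PreAndoTuple S) : H2 t.F →L[ℂ] H2 t.F :=
  H2.mulLinear (t.P * t.U) ((1 - t.P) * t.U)

/-- Coincidence of tuples: a unitary `ω` with `ω Λ = Λ'`, `ω P = P' ω`, `ω U = U' ω`. -/
def Coincide (t t' : PreAndoTuple S) : Prop :=
  ∃ ω : t.F ≃ₗᵢ[ℂ] t'.F, (∀ x, ω (t.Lam x) = t'.Lam x) ∧
    (∀ x, ω (t.P x) = t'.P (ω x)) ∧ (∀ x, ω (t.U x) = t'.U (ω x))

theorem Coincide.equivalence : Equivalence (Coincide (S := S)) where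
  refl t := ⟨LinearIsometryEquiv.refl ℂ t.F, fun _ => rfl, fun _ => rfl, fun _ => rfl⟩
  symm := by
    rintro L L' ⟨τ, h0, h1, h2⟩
    refine ⟨τ.symm, fun h => ?_, fun k => ?_, fun k => ?_⟩
    · rw [← h0, τ.symm_apply_apply]
    · apply τ.injective; rw [h1]; simp
    · apply τ.injective; rw [h2]; simp
  trans := by
    rintro L L' L'' ⟨τ, h0, h1, h2⟩ ⟨σ, g0, g1, g2⟩
    exact ⟨τ.trans σ, fun h => by simp [h0, g0], fun k => by simp [h1, g1],
      fun k => by simp [h2, g2]⟩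

/-- The tuple is (Douglas) minimal: the smallest closed subspace of `H²(ℱ)` which is invariant for
`M_{U*(Pᗮ + zP)}` and `M_{(P + zPᗮ)U}` and contains `H²(Ran Λ)` is `H²(ℱ)`. -/
def IsMinimal (t : PreAndoTuple S) : Prop :=
  ∀ N : Submodule ℂ (H2 t.F), IsClosed (N : Set (H2 t.F)) →
    (∀ f : H2 t.F, (∀ n, f n ∈ Set.range t.Lam) → f ∈ N) →
    (∀ f ∈ N, t.M₁ f ∈ N) → (∀ f ∈ N, t.M₂ f ∈ N) → N = ⊤

/-- A pre-Andô tuple for `(T₁*, T₂*)`, where `T = T₁ T₂`, is an Andô tuple of Type I if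
`Pᗮ U Λ D_{T*} + P U Λ D_{T*} T* = Λ D_{T*} T₁*` and
`U* P Λ D_{T*} + U* Pᗮ Λ D_{T*} T* = Λ D_{T*} T₂*`. -/
def IsTypeI (T₁ T₂ : H →L[ℂ] H) (t : PreAndoTuple (adjoint (T₁ * T₂))) : Prop :=
  let T := T₁ * T₂
  let LD : H →L[ℂ] t.F := t.Lam.toContinuousLinearMap ∘L defectMap (adjoint T)
  (1 - t.P) ∘L t.U ∘L LD + t.P ∘L t.U ∘L LD ∘L adjoint T = LD ∘L adjoint T₁ ∧
  adjoint t.U ∘L t.P ∘L LD + adjoint t.U ∘L (1 - t.P) ∘L LD ∘L adjoint T = LD ∘L adjoint T₂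

end PreAndoTuple

/-- The minimal Andô tuples of Type I for `(T₁*, T₂*)`. -/
abbrev MinimalTypeITuple (T₁ T₂ : H →L[ℂ] H) : Type (u + 1) :=
  {t : PreAndoTuple (adjoint (T₁ * T₂)) // t.IsTypeI T₁ T₂ ∧ t.IsMinimal}

/-- Coincidence of minimal Andô tuples of Type I. -/
instance tupleSetoid (T₁ T₂ : H →L[ℂ] H) : Setoid (MinimalTypeITuple T₁ T₂) where
  r t t' := t.1.Coincide t'.1
  iseqv := ⟨fun t => PreAndoTuple.Coincide.equivalence.refl t.1,
    PreAndoTuple.Coincide.equivalence.symm, PreAndoTuple.Coincide.equivalence.trans⟩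

theorem norm_adjoint_mul_le_one {T₁ T₂ : H →L[ℂ] H} (h₁ : ‖T₁‖ ≤ 1) (h₂ : ‖T₂‖ ≤ 1) :
    ‖adjoint (T₁ * T₂)‖ ≤ 1 := by
  rw [LinearIsometryEquiv.norm_map]
  exact (norm_mul_le _ _).trans (mul_le_one₀ h₁ (norm_nonneg _) h₂)

/-- The Douglas model of the lift of `(T₁, T₂)` associated with a tuple `(ℱ, Λ, P, U)` for
`(T₁*, T₂*)`. With `T = T₁ T₂` it acts on `H²(ℱ) ⊕ 𝒬_{T*}` and
`Π_D = ((I ⊗ Λ) 𝒪_{D_{T*},T*}, Q_{T*})`,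
`V_{D,1} = M_{U*(Pᗮ + zP)} ⊕ W_{♭1}`, `V_{D,2} = M_{(P + zPᗮ)U} ⊕ W_{♭2}`. -/
def douglasLift (T₁ T₂ : H →L[ℂ] H) (h₁ : ‖T₁‖ ≤ 1) (h₂ : ‖T₂‖ ≤ 1)
    (t : PreAndoTuple (adjoint (T₁ * T₂))) : LiftTriple H where
  K := WithLp 2 (H2 t.F × ResSpace (T₁ * T₂))
  emb := blockCol
    (H2.map t.Lam.toContinuousLinearMap ∘L
      obsOp (adjoint (T₁ * T₂)) (norm_adjoint_mul_le_one h₁ h₂))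
    (resMap (T₁ * T₂))
  V₁ := blockDiag t.M₁ (canonicalUnitary (T₁ * T₂) T₁)
  V₂ := blockDiag t.M₂ (canonicalUnitary (T₁ * T₂) T₂)

end Tuples

/-! ### The Sz.-Nagy–Foias model -/

section NagyFoias

open MeasureTheory AddCircle

section L2

/-- The space `L²(E)` of square-integrable `E`-valued functions on the unit circle `ℝ/ℤ` with
normalized arc length measure; the coordinate function is `ζ = exp (2πit)`, i.e. `fourier 1`. -/
abbrev L2 (E : Type*) [NormedAddCommGroup E] : Type _ :=
  Lp E 2 (haarAddCircle : Measure UnitAddCircle)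

variable {E : Type*} [NormedAddCommGroup E] [InnerProductSpace ℂ E]

/-- The continuous function `ζᵏ x` on the circle. -/
def monoFun (k : ℤ) (x : E) : C(UnitAddCircle, E) :=
  ⟨fun t => fourier k t • x, by fun_prop⟩

theorem inner_monoFun (k l : ℤ) (x y : E) :
    inner ℂ (ContinuousMap.toLp (E := E) 2 haarAddCircle ℂ (monoFun k x) : L2 E)
      (ContinuousMap.toLp (E := E) 2 haarAddCircle ℂ (monoFun l y) : L2 E) =
    inner ℂ (fourierLp (T := 1) 2 k) (fourierLp (T := 1) 2 l) * inner ℂ x y := by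
  rw [L2.inner_def, L2.inner_def, ← integral_mul_const]
  refine integral_congr_ae ?_
  filter_upwards [ContinuousMap.coeFn_toLp (E := E) (p := 2) (𝕜 := ℂ) haarAddCircle (monoFun k x),
    ContinuousMap.coeFn_toLp (E := E) (p := 2) (𝕜 := ℂ) haarAddCircle (monoFun l y),
    coeFn_fourierLp (T := 1) 2 k, coeFn_fourierLp (T := 1) 2 l] with t h1 h2 h3 h4
  rw [h1, h2, h3, h4]
  simp only [monoFun, ContinuousMap.coe_mk, inner_smul_left, inner_smul_right, RCLike.inner_apply]
  ring

/-- The operator `x ↦ ζᵏ x` from `E` into `L²(E)`. -/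
def mono (k : ℤ) : E →ₗᵢ[ℂ] L2 E where
  toFun x := ContinuousMap.toLp (E := E) 2 haarAddCircle ℂ (monoFun k x)
  map_add' x y := by
    rw [← map_add]; congr 1; ext t; exact smul_add _ _ _
  map_smul' c x := by
    rw [RingHom.id_apply, ← map_smul]; congr 1; ext t; exact smul_comm _ _ _
  norm_map' x := by
    refine (sq_eq_sq₀ (norm_nonneg _) (norm_nonneg _)).1 ?_
    refine (inner_self_eq_norm_sq (𝕜 := ℂ) _).symm.trans ?_
    refine (congrArg RCLike.re (inner_monoFun k k x x)).trans ?_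
    rw [orthonormal_iff_ite.1 orthonormal_fourier, if_pos rfl, one_mul,
      inner_self_eq_norm_sq (𝕜 := ℂ)]

theorem mono_orthogonal : OrthogonalFamily ℂ (fun _ : ℤ => E) (fun k => mono (E := E) k) := by
  intro i j hij x y
  refine (inner_monoFun i j x y).trans ?_
  rw [orthonormal_iff_ite.1 orthonormal_fourier, if_neg hij, zero_mul]

/-- The isometry `f ↦ ζᵏ f` from `H²(E)` into `L²(E)`, where `f = (fₙ)` in `H²(E)` is identified
with its boundary function `∑ ζⁿ fₙ`. -/
def shiftedBoundary [CompleteSpace E] (k : ℤ) : H2 E →ₗᵢ[ℂ] L2 E :=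
  ((mono_orthogonal (E := E)).comp (f := fun n : ℕ => k + (n : ℤ))
    (fun a b h => by simpa using h)).linearIsometry

end L2

variable {H : Type u} [NormedAddCommGroup H] [InnerProductSpace ℂ H] [CompleteSpace H]

/-- The characteristic function
`Θ_T(z) = (-T + z D_{T*} (I - z T*)⁻¹ D_T)|_{𝒟_T} : 𝒟_T → 𝒟_{T*}` of a contraction `T`.
(The operator in parentheses maps `𝒟_T` into `𝒟_{T*}`, so that the projection only adjusts the
codomain.) -/
def charFun (T : H →L[ℂ] H) (z : ℂ) : defectSpace T →L[ℂ] defectSpace (adjoint T) :=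
  (defectSpace (adjoint T)).orthogonalProjectionOnto ∘L
    (-T + z • (defectOp (adjoint T) * Ring.inverse (1 - z • adjoint T) * defectOp T)) ∘L
    (defectSpace T).subtypeL

/-- The operator `𝒟_T → H²(𝒟_{T*})`, `x ↦ Θ_T(·) x`. In terms of Taylor coefficients
`Θ_T(z) x = -T x + ∑ zⁿ⁺¹ D_{T*} T*ⁿ D_T x`, see `hasSum_charFun`. -/
def charSeries (T : H →L[ℂ] H) (hT : ‖adjoint T‖ ≤ 1) :
    defectSpace T →L[ℂ] H2 (defectSpace (adjoint T)) :=
  (lp.singleContinuousLinearMap ℂ (fun _ : ℕ => defectSpace (adjoint T)) 2 0 ∘L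
      (defectSpace (adjoint T)).orthogonalProjectionOnto ∘L (-T) +
    H2.shift (F := defectSpace (adjoint T)) ∘L obsOp (adjoint T) hT ∘L defectOp T) ∘L
  (defectSpace T).subtypeL

theorem hasSum_charFun (T : H →L[ℂ] H) (hT : ‖adjoint T‖ ≤ 1) (x : defectSpace T) (z : ℂ)
    (hz : ‖z‖ < 1) : HasSum (fun n => z ^ n • charSeries T hT x n) (charFun T z x) := by
  have hlt : ‖z • adjoint T‖ < 1 := by
    rw [norm_smul]
    exact (mul_le_of_le_one_right (norm_nonneg _) hT).trans_lt hz
  have hgeom : HasSum (fun n => (z • adjoint T) ^ n) (Ring.inverse (1 - z • adjoint T)) :=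
    hasSum_geom_series_inverse _ hlt
  let P : H →L[ℂ] defectSpace (adjoint T) := (defectSpace (adjoint T)).orthogonalProjectionOnto
  let ev : (H →L[ℂ] H) →L[ℂ] defectSpace (adjoint T) :=
    P ∘L ContinuousLinearMap.apply ℂ H (defectOp T (x : H)) ∘L
      ContinuousLinearMap.mul ℂ (H →L[ℂ] H) (z • defectOp (adjoint T))
  have h2 := ev.hasSum hgeom
  have hPD : ∀ y, P (defectOp (adjoint T) y) = defectMap (adjoint T) y := fun y =>
    Submodule.orthogonalProjectionOnto_mem_subspace_eq_self (defectMap (adjoint T) y)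
  have hsucc : ∀ n, z ^ (n + 1) • charSeries T hT x (n + 1) = ev ((z • adjoint T) ^ n) :=
    fun n => by
    have h3 : charSeries T hT x (n + 1) =
        defectMap (adjoint T) ((adjoint T ^ n) (defectOp T x)) := by
      simp [charSeries]
    have h4 : ev ((z • adjoint T) ^ n) =
        P ((z • defectOp (adjoint T) * (z • adjoint T) ^ n) (defectOp T x)) := rfl
    rw [h3, h4, ← hPD, smul_pow, smul_mul_smul_comm, ← pow_succ', smul_apply, map_smul]
    rfl
  have hzero : charSeries T hT x 0 = P (-T x) := by
    simp [charSeries, P]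
  have h5 : charFun T z x = P (-T x) + ev (Ring.inverse (1 - z • adjoint T)) := by
    have h6 : ev (Ring.inverse (1 - z • adjoint T)) = P ((z • defectOp (adjoint T) *
        Ring.inverse (1 - z • adjoint T)) (defectOp T x)) := rfl
    rw [h6, ← map_add]
    simp [charFun, P]
  refine (hasSum_nat_add_iff' 1).1 ?_
  rw [Finset.sum_range_one, pow_zero, one_smul, hzero, h5, add_sub_cancel_left]
  simpa only [hsucc] using h2

/-- The operator `M_{Θ_T} : L²(𝒟_T) → L²(𝒟_{T*})` of multiplication by (the boundary values of)
the characteristic function, the extension by continuity of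
`∑ ζᵏ xₖ ↦ ∑ ζᵏ Θ_T(ζ) xₖ` (finite sums over `k ∈ ℤ`). -/
def mulCharFun (T : H →L[ℂ] H) (hT : ‖adjoint T‖ ≤ 1) :
    L2 (defectSpace T) →L[ℂ] L2 (defectSpace (adjoint T)) :=
  (Finsupp.lsum ℂ fun k : ℤ => ((shiftedBoundary (E := defectSpace (adjoint T))
      k).toContinuousLinearMap ∘L charSeries T hT).toLinearMap).extendOfNorm
    (Finsupp.lsum ℂ fun k : ℤ => (mono (E := defectSpace T) k).toLinearMap)

/-- Multiplication by `Δ_{Θ_T}(ζ) = (I - Θ_T(ζ)* Θ_T(ζ))^{1/2}` on `L²(𝒟_T)`, i.e. the positive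
square root of `I - M_{Θ_T}* M_{Θ_T}`, the defect operator of `M_{Θ_T}`. -/
def mulDelta (T : H →L[ℂ] H) (hT : ‖adjoint T‖ ≤ 1) :
    L2 (defectSpace T) →L[ℂ] L2 (defectSpace T) :=
  defectOp (mulCharFun T hT)

/-- The closure of `Δ_{Θ_T} L²(𝒟_T)`. -/
def deltaSpace (T : H →L[ℂ] H) (hT : ‖adjoint T‖ ≤ 1) : Submodule ℂ (L2 (defectSpace T)) :=
  (LinearMap.range (mulDelta T hT).toLinearMap).topologicalClosure

instance (T : H →L[ℂ] H) (hT : ‖adjoint T‖ ≤ 1) : CompleteSpace (deltaSpace T hT) :=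
  inferInstanceAs (CompleteSpace (Submodule.topologicalClosure _))

/-- `f ↦ Δ_{Θ_T} f` as an operator into the closure of its range. -/
def deltaMap (T : H →L[ℂ] H) (hT : ‖adjoint T‖ ≤ 1) :
    L2 (defectSpace T) →L[ℂ] deltaSpace T hT :=
  (mulDelta T hT).codRestrict _ fun h => Submodule.le_topologicalClosure _ ⟨h, rfl⟩

/-- The identification `ω_{NF,D}` of `𝒬_{T*}` with the closure of `Δ_{Θ_T} L²(𝒟_T)`, for a
completely non-unitary contraction `T`. In the minimal isometric lift of `T` on
`H²(𝒟_{T*}) ⊕ 𝒬_{T*}` with residual space `𝒬_{T*}`, the residual component of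
`∑ 𝒰ⁿ (V - T) hₙ` is `∑ W_Dⁿ (W_D Q_{T*} - Q_{T*} T) hₙ` (finite sums over `n ∈ ℤ`), and
`ω_{NF,D}` is the extension by continuity of the map which sends this vector to
`Δ_{Θ_T} ∑ ζⁿ D_T hₙ`. -/
def omegaNFD (T : H →L[ℂ] H) (hT : ‖adjoint T‖ ≤ 1) : ResSpace T →L[ℂ] deltaSpace T hT :=
  (Finsupp.lsum ℂ fun n : ℤ => (deltaMap T hT ∘L
      (mono (E := defectSpace T) n).toContinuousLinearMap ∘L
      defectMap T).toLinearMap).extendOfNorm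
    (Finsupp.lsum ℂ fun n : ℤ => (unitaryZPow (resUnitary T) n ∘L
      (resUnitary T ∘L resMap T - resMap T ∘L T)).toLinearMap)

/-- The Sz.-Nagy–Foias model of the lift of `(T₁, T₂)` associated with a tuple `(ℱ, Λ, P, U)` for
`(T₁*, T₂*)`. With `T = T₁ T₂` it acts on the direct sum of `H²(ℱ)` and the closure of
`Δ_{Θ_T} L²(𝒟_T)`, and `Π_NF = ((I ⊗ Λ) 𝒪_{D_{T*},T*}, ω_{NF,D} Q_{T*})`,
`V_{NF,1} = M_{U*(Pᗮ + zP)} ⊕ W_{♯1}`, `V_{NF,2} = M_{(P + zPᗮ)U} ⊕ W_{♯2}`, where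
`W_{♯j} = ω_{NF,D} W_{♭j} ω_{NF,D}*`. -/
def nagyFoiasLift (T₁ T₂ : H →L[ℂ] H) (h₁ : ‖T₁‖ ≤ 1) (h₂ : ‖T₂‖ ≤ 1)
    (t : PreAndoTuple (adjoint (T₁ * T₂))) : LiftTriple H :=
  let T := T₁ * T₂
  let hT : ‖adjoint T‖ ≤ 1 := norm_adjoint_mul_le_one h₁ h₂
  { K := WithLp 2 (H2 t.F × deltaSpace T hT)
    emb := blockCol (H2.map t.Lam.toContinuousLinearMap ∘L obsOp (adjoint T) hT)
      (omegaNFD T hT ∘L resMap T)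
    V₁ := blockDiag t.M₁
      (omegaNFD T hT ∘L canonicalUnitary T T₁ ∘L adjoint (omegaNFD T hT))
    V₂ := blockDiag t.M₂
      (omegaNFD T hT ∘L canonicalUnitary T T₂ ∘L adjoint (omegaNFD T hT)) }

/-- `T` is completely non-unitary: the only closed subspace reducing `T` on which `T` is unitary
is `{0}`. -/
def IsCNU (T : H →L[ℂ] H) : Prop :=
  ∀ N : Submodule ℂ H, IsClosed (N : Set H) → (∀ x ∈ N, T x ∈ N) → (∀ x ∈ N, adjoint T x ∈ N) →
    (∀ x ∈ N, adjoint T (T x) = x ∧ T (adjoint T x) = x) → N = ⊥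

end NagyFoias

end Ando

end

namespace Ando

universe u

set_option linter.unusedSectionVars false

/-! ### Isometries, extensions and square roots -/

section General

variable {H : Type*} [NormedAddCommGroup H] [InnerProductSpace ℂ H] [CompleteSpace H]
variable {K : Type*} [NormedAddCommGroup K] [InnerProductSpace ℂ K] [CompleteSpace K]

/-! Write `V = V₁V₂`. Everything rests on the notion of a model of a tuple without fixed
coordinates, `ModelData`: an orthogonal decomposition `K = H²(ℱ) ⊕ 𝒬_{T*}` in which `Π`, `V₁`, `V₂`
take the Douglas form. In any such model `M₁M₂ = M_z` and `W_{♭1}W_{♭2} = W_D`, so `V = M_z ⊕ W_D`.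

Uniqueness. Since `W_D` is onto, the constants `ℱ` are exactly `(Ran V)ᗮ`, which the lift alone
determines. The tuple can be read off there: `V₁x = U*Pᗮx + V U*Px` for `x` in `ℱ` has unique
coefficients, and `Πh - VΠT*h = ΛD_{T*}h`. So a unitary equivalence `τ` restricts to a unitary `ω`
of the spaces `ℱ` which is a coincidence (`ModelData.coincide_of_unitarilyEquivalent`). Conversely,
a coincidence `ω` gives `(I ⊗ ω) ⊕ I` (`ModelData.unitarilyEquivalent_of_coincide`). Minimality of a
lift and of its tuple imply each other (`isMinimal_tuple`, `isMinimal_triple`).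

Existence. For a lift put `ℱ = ker V*`, `P = V₂V₂*`, `U = V₁* + V₂ - V₁V₂V₁*`, and define `Λ` by the
formula above; this is a Type I tuple (`IsAndoLift.isTypeI_tuple`). The Wold decomposition of `V`
embeds `H²(ℱ)`. The residual part `Π_u` of `Π` satisfies `VΠ_uT* = Π_u` and `‖Π_u h‖ = ‖Q_{T*}h‖`,
because `‖h‖² = ‖∑ zⁿΛD_{T*}T*ⁿh‖² + lim ‖T*ⁿh‖²`. Therefore `W_DⁿQ_{T*}h ↦ VⁿΠ_u h` embeds `𝒬_{T*}`
isometrically, and for a minimal lift the two pieces fill `K` (`PureData.modelData`).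

Sz.-Nagy–Foias model. Only the unitarity of `ω : 𝒬_{T*} → closure of Ran Δ` has to be shown; then
this is another model of the same tuple. The vectors `VΠh - ΠTh` form a copy of `𝒟_T` wandering for
`V`, with first component `Θ_T` and second component `W_DQ_{T*}h - Q_{T*}Th`. Orthonormality of its
translates gives `‖f‖² = ‖Θ_T f‖² + ‖residual part‖²`, so the residual part has the norm of `Δf`
(`norm_deltaMap_lsum`). If `T` is completely non-unitary, these residual vectors span a dense
subspace (`IsCNU.eq_zero_of_inner_eq_zero`). -/

theorem adjoint_apply_apply_of_norm {V : H →L[ℂ] K} (hV : ∀ x, ‖V x‖ = ‖x‖) (x : H) :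
    adjoint V (V x) = x :=
  congrArg (fun A : H →L[ℂ] H => A x) ((norm_map_iff_adjoint_comp_self V).1 hV)

theorem inner_map_map_of_norm {V : H →L[ℂ] K} (hV : ∀ x, ‖V x‖ = ‖x‖) (x y : H) :
    inner ℂ (V x) (V y) = inner ℂ x y := by
  rw [← adjoint_inner_right, adjoint_apply_apply_of_norm hV]

theorem norm_pow_apply {V : H →L[ℂ] H} (hV : ∀ x, ‖V x‖ = ‖x‖) (n : ℕ) (x : H) :
    ‖(V ^ n) x‖ = ‖x‖ := by
  induction n with
  | zero => rfl
  | succ n ih => rw [pow_succ', mul_apply_eq_comp, hV, ih]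

theorem isometry_of_norm {V : H →L[ℂ] K} (hV : ∀ x, ‖V x‖ = ‖x‖) : Isometry V :=
  AddMonoidHomClass.isometry_of_norm V hV

theorem norm_of_isometry {V : H →L[ℂ] K} (hV : Isometry V) (x : H) : ‖V x‖ = ‖x‖ :=
  hV.norm_map_of_map_zero (map_zero V) x

/-- A surjective norm-preserving operator is inverted on the right by its adjoint. -/
theorem apply_adjoint_apply_of_surjective {V : H →L[ℂ] K} (hV : ∀ x, ‖V x‖ = ‖x‖)
    (hs : Function.Surjective V) (y : K) : V (adjoint V y) = y := by
  obtain ⟨x, rfl⟩ := hs y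
  rw [adjoint_apply_apply_of_norm hV]

theorem norm_adjoint_apply_of_surjective {V : H →L[ℂ] K} (hV : ∀ x, ‖V x‖ = ‖x‖)
    (hs : Function.Surjective V) (y : K) : ‖adjoint V y‖ = ‖y‖ := by
  rw [← hV, apply_adjoint_apply_of_surjective hV hs]

theorem norm_sq_add_of_inner_eq_zero {x y : H} (h : inner ℂ x y = 0) :
    ‖x + y‖ ^ 2 = ‖x‖ ^ 2 + ‖y‖ ^ 2 := by
  simpa only [sq] using norm_add_sq_eq_norm_sq_add_norm_sq_of_inner_eq_zero x y h

/-- For an isometry, `V V*` is the orthogonal projection onto the range, so this is Pythagoras. -/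
theorem norm_sub_map_sq {V : H →L[ℂ] H} (hV : ∀ x, ‖V x‖ = ‖x‖) (x : H) :
    ‖x - V (adjoint V x)‖ ^ 2 = ‖x‖ ^ 2 - ‖adjoint V x‖ ^ 2 := by
  have h : inner ℂ (x - V (adjoint V x)) (V (adjoint V x)) = 0 := by
    rw [← adjoint_inner_left, map_sub, adjoint_apply_apply_of_norm hV, sub_self, inner_zero_left]
  have h2 := norm_sq_add_of_inner_eq_zero h
  rw [sub_add_cancel, hV] at h2
  linarith

section Extend

variable {X E F : Type*} [AddCommGroup X] [Module ℂ X] [NormedAddCommGroup E] [NormedSpace ℂ E]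
  [CompleteSpace E] [NormedAddCommGroup F] [NormedSpace ℂ F] [CompleteSpace F] {f : X →ₗ[ℂ] F}
  {e : X →ₗ[ℂ] E}

/-- The equality of norms supplies the bound that extension by continuity needs. `X*`, `W_{♭j}*`,
`Λ` and `ω` all arise in this way. -/
theorem extendOfNorm_apply (he : DenseRange e) (h : ∀ x, ‖f x‖ = ‖e x‖) (x : X) :
    f.extendOfNorm e (e x) = f x :=
  LinearMap.extendOfNorm_eq he ⟨1, fun x => by rw [h, one_mul]⟩ x

theorem norm_extendOfNorm_apply (he : DenseRange e) (h : ∀ x, ‖f x‖ = ‖e x‖) (y : E) :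
    ‖f.extendOfNorm e y‖ = ‖y‖ := by
  refine he.induction (P := fun y => ‖f.extendOfNorm e y‖ = ‖y‖) ?_
    (isClosed_eq (by fun_prop) (by fun_prop)) y
  rintro _ ⟨x, rfl⟩
  rw [extendOfNorm_apply he h, h]

theorem surjective_of_norm_of_denseRange {V : E →L[ℂ] F} (hV : ∀ x, ‖V x‖ = ‖x‖)
    (hd : DenseRange V) : Function.Surjective V := by
  have hc : IsClosed (Set.range V) :=
    (AddMonoidHomClass.isometry_of_norm V hV).isClosedEmbedding.isClosed_range
  rw [← Set.range_eq_univ, ← hc.closure_eq, hd.closure_range]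

theorem surjective_extendOfNorm (he : DenseRange e) (hf : DenseRange f)
    (h : ∀ x, ‖f x‖ = ‖e x‖) : Function.Surjective (f.extendOfNorm e) :=
  surjective_of_norm_of_denseRange (norm_extendOfNorm_apply he h)
    (hf.mono (by rintro _ ⟨x, rfl⟩; exact ⟨e x, extendOfNorm_apply he h x⟩))

end Extend

/-- If `x` intertwines the squares of two positive elements of a C⋆-algebra, it intertwines the
elements themselves. -/
theorem mul_eq_mul_of_sq_mul_eq_mul_sq {a b x : H →L[ℂ] H} (ha : 0 ≤ a) (hb : 0 ≤ b)
    (h : a * a * x = x * (b * b)) : a * x = x * b := by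
  set y := a * x - x * b with hy
  have hsa : star a = a := (IsSelfAdjoint.of_nonneg ha).star_eq
  have hsb : star b = b := (IsSelfAdjoint.of_nonneg hb).star_eq
  -- `ay + yb = a²x - xb² = 0`; the cross terms cancel.
  have h1 : a * y = -(y * b) := by
    have : a * y + y * b = a * a * x - x * (b * b) := by rw [hy]; noncomm_ring
    rw [h, sub_self] at this
    exact eq_neg_of_add_eq_zero_left this
  have hp : 0 ≤ star y * a * y := star_left_conjugate_nonneg ha y
  have h2 : star y * a * y = -(star y * y * b) := by rw [mul_assoc, h1, mul_neg, mul_assoc]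
  have h3 : star y * y * b = -(star y * a * y) := by rw [h2, neg_neg]
  -- `y*yb = -y*ay` is self-adjoint, so `y*y` and `b` commute and their product is positive. It is
  -- also minus a positive element, hence zero.
  have hcomm : Commute (star y * y) b := by
    have h4 : star (star y * y * b) = star y * y * b := by
      rw [h3, star_neg, (IsSelfAdjoint.of_nonneg hp).star_eq]
    rw [star_mul, star_mul, star_star, hsb] at h4
    exact h4.symm
  have hq : 0 ≤ star y * y * b := hcomm.mul_nonneg (star_mul_self_nonneg y) hb
  have h5 : star y * a * y = 0 :=
    le_antisymm (by rw [h2]; exact neg_nonpos.2 hq) hp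
  have h6 : a * y = 0 := by
    have h7 : star (CFC.sqrt a * y) * (CFC.sqrt a * y) = 0 := by
      rw [star_mul, (IsSelfAdjoint.of_nonneg (CFC.sqrt_nonneg a)).star_eq, mul_assoc,
        ← mul_assoc (CFC.sqrt a), CFC.sqrt_mul_sqrt_self a ha, ← mul_assoc, h5]
    rw [CStarRing.star_mul_self_eq_zero_iff] at h7
    rw [← CFC.sqrt_mul_sqrt_self a ha, mul_assoc, h7, mul_zero]
  have h8 : y * b = 0 := by rw [← neg_eq_zero, ← h1, h6]
  have h9 : star y * a = 0 := by rw [← hsa, ← star_mul, h6, star_zero]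
  -- Expand only the middle factor `y = ax - xb`: both terms contain `y*a = 0` or `by* = 0`.
  have h10 : star y * y * star y = 0 := by
    have h11 : b * star y = 0 := by rw [← hsb, ← star_mul, h8, star_zero]
    calc star y * y * star y = star y * a * x * star y - star y * x * (b * star y) := by
          rw [hy]; noncomm_ring
      _ = 0 := by rw [h9, h11]; simp
  have h12 : star y * y = 0 := by
    have : star (star y * y) * (star y * y) = 0 := by
      rw [star_mul, star_star, ← mul_assoc, h10, zero_mul]
    exact (CStarRing.star_mul_self_eq_zero_iff _).1 this
  exact sub_eq_zero.1 ((CStarRing.star_mul_self_eq_zero_iff y).1 h12)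

theorem norm_sqrt_apply_sq {A : H →L[ℂ] H} (hA : 0 ≤ A) (x : H) :
    ‖CFC.sqrt A x‖ ^ 2 = RCLike.re (inner ℂ (A x) x) := by
  have hsa : adjoint (CFC.sqrt A) = CFC.sqrt A :=
    (IsSelfAdjoint.of_nonneg (CFC.sqrt_nonneg A)).star_eq
  rw [apply_norm_sq_eq_inner_adjoint_left (𝕜 := ℂ), hsa, ← mul_def,
    CFC.sqrt_mul_sqrt_self A hA]

theorem one_sub_adjoint_comp_self_nonneg (S : H →L[ℂ] K) (hS : ‖S‖ ≤ 1) :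
    (0 : H →L[ℂ] H) ≤ 1 - adjoint S ∘L S := by
  have h0 : 0 ≤ adjoint S ∘L S := (nonneg_iff_isPositive _).2 (isPositive_adjoint_comp_self S)
  rw [sub_nonneg, ← CStarAlgebra.norm_le_one_iff_of_nonneg _ h0, norm_adjoint_comp_self]
  exact mul_le_one₀ hS (norm_nonneg _) hS

theorem norm_defectOp_apply_sq (S : H →L[ℂ] K) (hS : ‖S‖ ≤ 1) (x : H) :
    ‖defectOp S x‖ ^ 2 = ‖x‖ ^ 2 - ‖S x‖ ^ 2 := by
  rw [defectOp, norm_sqrt_apply_sq (one_sub_adjoint_comp_self_nonneg S hS),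
    apply_norm_sq_eq_inner_adjoint_left (𝕜 := ℂ) S, ← inner_self_eq_norm_sq (𝕜 := ℂ) x, sub_apply,
    inner_sub_left, map_sub]
  rfl

theorem defectOp_defectOp_apply (S : H →L[ℂ] K) (hS : ‖S‖ ≤ 1) (x : H) :
    defectOp S (defectOp S x) = x - adjoint S (S x) := by
  have h := CFC.sqrt_mul_sqrt_self _ (one_sub_adjoint_comp_self_nonneg S hS)
  exact congrArg (fun A : H →L[ℂ] H => A x) h

theorem norm_defectOp_apply_le (S : H →L[ℂ] K) (hS : ‖S‖ ≤ 1) (x : H) :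
    ‖defectOp S x‖ ≤ ‖x‖ := by
  rw [← sq_le_sq₀ (norm_nonneg _) (norm_nonneg _), norm_defectOp_apply_sq S hS]
  exact sub_le_self _ (by positivity)

/-- The squares satisfy `(I - SS*)S = S(I - S*S)`, and the relation passes to positive square roots.
-/
theorem defectOp_adjoint_apply (S : H →L[ℂ] H) (hS : ‖S‖ ≤ 1) (x : H) :
    defectOp (adjoint S) (S x) = S (defectOp S x) := by
  have hS' : ‖adjoint S‖ ≤ 1 := by rwa [LinearIsometryEquiv.norm_map]
  have h := mul_eq_mul_of_sq_mul_eq_mul_sq (a := defectOp (adjoint S)) (b := defectOp S) (x := S)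
    (CFC.sqrt_nonneg _) (CFC.sqrt_nonneg _) (by
      ext y
      simp only [mul_apply_eq_comp, defectOp_defectOp_apply S hS,
        defectOp_defectOp_apply (adjoint S) hS', adjoint_adjoint, map_sub])
  exact congrArg (fun A : H →L[ℂ] H => A x) h

theorem denseRange_codRestrict_topologicalClosure {E F : Type*} [NormedAddCommGroup E]
    [NormedSpace ℂ E] [NormedAddCommGroup F] [NormedSpace ℂ F] (A : E →L[ℂ] F)
    (h : ∀ x, A x ∈ (LinearMap.range A.toLinearMap).topologicalClosure) :
    DenseRange (A.codRestrict (LinearMap.range A.toLinearMap).topologicalClosure h) := by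
  rw [DenseRange, dense_iff_closure_eq, Set.eq_univ_iff_forall]
  rintro ⟨y, hy⟩
  rw [closure_subtype, ← Set.range_comp]
  exact hy

theorem denseRange_defectMap (S : H →L[ℂ] H) : DenseRange (defectMap S) :=
  denseRange_codRestrict_topologicalClosure _ _

theorem denseRange_asympMap (S : H →L[ℂ] H) : DenseRange (asympMap S) :=
  denseRange_codRestrict_topologicalClosure _ _

end General

/-! ### Operators on the Hardy space -/

section Hardy

variable {F G : Type*} [NormedAddCommGroup F] [InnerProductSpace ℂ F]
  [NormedAddCommGroup G] [InnerProductSpace ℂ G]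

/-- The monomial `zⁿ x` in `H²(F)`. -/
noncomputable def H2.single (n : ℕ) : F →L[ℂ] H2 F := lp.singleContinuousLinearMap ℂ (fun _ : ℕ => F) 2 n

theorem H2.single_eq (n : ℕ) (x : F) : H2.single n x = lp.single 2 n x := rfl

@[simp] theorem H2.single_apply_self (n : ℕ) (x : F) : H2.single n x n = x := by
  rw [H2.single_eq, lp.single_apply_self]

theorem H2.single_apply_ne {n m : ℕ} (h : m ≠ n) (x : F) : H2.single n x m = 0 := by
  rw [H2.single_eq, lp.single_apply_ne _ _ _ h]

theorem H2.hasSum_single (f : H2 F) : HasSum (fun n => H2.single n (f n)) f :=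
  lp.hasSum_single (by simp) f

theorem H2.ext {f g : H2 F} (h : ∀ n, f n = g n) : f = g := lp.ext (funext h)

theorem H2.mem_of_single_mem {N : Submodule ℂ (H2 F)} (hN : IsClosed (N : Set (H2 F))) {f : H2 F}
    (h : ∀ n, H2.single n (f n) ∈ N) : f ∈ N :=
  hN.mem_of_tendsto (H2.hasSum_single f)
    (Filter.Eventually.of_forall fun _ => N.sum_mem fun n _ => h n)

theorem H2.shift_single (n : ℕ) (x : F) : H2.shift (H2.single n x) = H2.single (n + 1) x := by
  refine H2.ext fun m => ?_
  rcases m with _ | m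
  · rw [H2.shift_zero, H2.single_apply_ne (by omega)]
  · rw [H2.shift_succ]
    by_cases h : m = n
    · subst h; rw [H2.single_apply_self, H2.single_apply_self]
    · rw [H2.single_apply_ne h, H2.single_apply_ne (by omega)]

theorem H2.map_single (A : F →L[ℂ] G) (n : ℕ) (x : F) :
    H2.map A (H2.single n x) = H2.single n (A x) := by
  refine H2.ext fun m => ?_
  rw [H2.map_apply]
  by_cases h : m = n
  · subst h; rw [H2.single_apply_self, H2.single_apply_self]
  · rw [H2.single_apply_ne h, H2.single_apply_ne h, map_zero]

theorem H2.norm_shift (f : H2 F) : ‖H2.shift f‖ = ‖f‖ := by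
  rw [← sq_eq_sq₀ (norm_nonneg _) (norm_nonneg _), H2_norm_sq, H2_norm_sq,
    (H2_summable (H2.shift f)).tsum_eq_zero_add]
  simp

theorem H2.norm_map {A : F →L[ℂ] G} (hA : ∀ x, ‖A x‖ = ‖x‖) (f : H2 F) : ‖H2.map A f‖ = ‖f‖ := by
  rw [← sq_eq_sq₀ (norm_nonneg _) (norm_nonneg _), H2_norm_sq, H2_norm_sq]
  simp [hA]

theorem H2.mulLinear_apply (A B : F →L[ℂ] F) (f : H2 F) (n : ℕ) :
    H2.mulLinear A B f n = A (f n) + B (H2.shift f n) := by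
  rcases n with _ | n
  · change A (f 0) + 0 = A (f 0) + B 0
    rw [map_zero]
  · rfl

/-- Each coefficient `A fₙ + B fₙ₋₁` is an orthogonal sum by `h`. Reindexing the second family of
squares lets `h'` recombine them coefficient by coefficient. -/
theorem H2.norm_mulLinear {A B : F →L[ℂ] F}
    (h : ∀ x y, ‖A x + B y‖ ^ 2 = ‖A x‖ ^ 2 + ‖B y‖ ^ 2)
    (h' : ∀ x, ‖A x‖ ^ 2 + ‖B x‖ ^ 2 = ‖x‖ ^ 2) (f : H2 F) : ‖H2.mulLinear A B f‖ = ‖f‖ := by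
  have hs : ∑' n, ‖B (H2.shift f n)‖ ^ 2 = ∑' n, ‖B (f n)‖ ^ 2 := by
    rw [(H2_summable_map B (H2.shift f)).tsum_eq_zero_add]
    simp
  rw [← sq_eq_sq₀ (norm_nonneg _) (norm_nonneg _), H2_norm_sq, H2_norm_sq]
  simp only [H2.mulLinear_apply, h]
  rw [(H2_summable_map A f).tsum_add (H2_summable_map B (H2.shift f)), hs,
    ← (H2_summable_map A f).tsum_add (H2_summable_map B f)]
  simp only [h']

variable [CompleteSpace F] [CompleteSpace G]

theorem H2.inner_map_left (A : F →L[ℂ] G) (f : H2 F) (g : H2 G) :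
    inner ℂ (H2.map A f) g = inner ℂ f (H2.map (adjoint A) g) := by
  rw [lp.inner_eq_tsum, lp.inner_eq_tsum]
  simp [adjoint_inner_right]

theorem H2.inner_shift_left (f g : H2 F) :
    inner ℂ (H2.shift f) g = inner ℂ f (H2.backShift g) := by
  rw [lp.inner_eq_tsum (H2.shift f) g, lp.inner_eq_tsum f (H2.backShift g),
    (lp.summable_inner (𝕜 := ℂ) (H2.shift f) g).tsum_eq_zero_add, H2.shift_zero, inner_zero_left,
    zero_add]
  rfl

theorem H2.adjoint_shift : adjoint (H2.shift (F := F)) = H2.backShift :=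
  ((eq_adjoint_iff _ _).2 fun x y => by
    rw [← inner_conj_symm, ← H2.inner_shift_left, inner_conj_symm]).symm

theorem H2.adjoint_map (A : F →L[ℂ] G) : adjoint (H2.map A) = H2.map (adjoint A) :=
  ((eq_adjoint_iff _ _).2 fun x y => by
    rw [← inner_conj_symm, ← H2.inner_map_left, inner_conj_symm]).symm

theorem H2.adjoint_mulLinear_apply (A B : F →L[ℂ] F) (f : H2 F) (n : ℕ) :
    adjoint (H2.mulLinear A B) f n = adjoint A (f n) + adjoint B (f (n + 1)) := by
  rw [H2.mulLinear, map_add, adjoint_comp, H2.adjoint_map, H2.adjoint_map, H2.adjoint_shift]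
  rfl

end Hardy

/-! ### Block operators -/

section Block

variable {E E' F F' H : Type*} [NormedAddCommGroup E] [InnerProductSpace ℂ E]
  [NormedAddCommGroup F] [InnerProductSpace ℂ F] [NormedAddCommGroup E'] [InnerProductSpace ℂ E']
  [NormedAddCommGroup F'] [InnerProductSpace ℂ F'] [NormedAddCommGroup H] [InnerProductSpace ℂ H]

theorem blockDiag_apply (A : E →L[ℂ] E') (B : F →L[ℂ] F') (x : WithLp 2 (E × F)) :
    blockDiag A B x = WithLp.toLp 2 (A x.fst, B x.snd) := rfl

theorem blockCol_apply (A : H →L[ℂ] E) (B : H →L[ℂ] F) (x : H) :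
    blockCol A B x = WithLp.toLp 2 (A x, B x) := rfl

theorem norm_blockDiag {A : E →L[ℂ] E'} {B : F →L[ℂ] F'} (hA : ∀ x, ‖A x‖ = ‖x‖)
    (hB : ∀ x, ‖B x‖ = ‖x‖) (x : WithLp 2 (E × F)) : ‖blockDiag A B x‖ = ‖x‖ := by
  rw [← sq_eq_sq₀ (norm_nonneg _) (norm_nonneg _), WithLp.prod_norm_sq_eq_of_L2,
    WithLp.prod_norm_sq_eq_of_L2, blockDiag_apply]
  simp only [WithLp.toLp_fst, WithLp.toLp_snd, hA, hB]

theorem adjoint_blockDiag [CompleteSpace E] [CompleteSpace F] [CompleteSpace E'] [CompleteSpace F']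
    (A : E →L[ℂ] E') (B : F →L[ℂ] F') :
    adjoint (blockDiag A B) = blockDiag (adjoint A) (adjoint B) :=
  ((eq_adjoint_iff _ _).2 fun x y => by
    rw [WithLp.prod_inner_apply, WithLp.prod_inner_apply]
    change inner ℂ (adjoint A x.fst) y.fst + inner ℂ (adjoint B x.snd) y.snd =
      inner ℂ x.fst (A y.fst) + inner ℂ x.snd (B y.snd)
    rw [adjoint_inner_left, adjoint_inner_left]).symm

end Block

/-! ### The asymptotic limit of a contraction -/

section Asymptotic

variable {H : Type*} [NormedAddCommGroup H] [InnerProductSpace ℂ H] [CompleteSpace H]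
  {T : H →L[ℂ] H}

theorem adjoint_pow (T : H →L[ℂ] H) (n : ℕ) : adjoint (T ^ n) = adjoint T ^ n := star_pow T n

theorem norm_apply_le_of_norm_le_one {S : H →L[ℂ] H} (hS : ‖S‖ ≤ 1) (x : H) : ‖S x‖ ≤ ‖x‖ := by
  simpa using S.le_of_opNorm_le hS x

theorem norm_adjoint_le_one {S : H →L[ℂ] H} (hS : ‖S‖ ≤ 1) : ‖adjoint S‖ ≤ 1 := by
  rwa [LinearIsometryEquiv.norm_map]

theorem norm_pow_le_one {S : H →L[ℂ] H} (hS : ‖S‖ ≤ 1) (n : ℕ) : ‖S ^ n‖ ≤ 1 := by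
  rcases n with _ | n
  · rw [pow_zero]; exact norm_id_le
  · exact (norm_pow_le' S n.succ_pos).trans (pow_le_one₀ (norm_nonneg _) hS)

theorem antitone_norm_pow_apply_sq {S : H →L[ℂ] H} (hS : ‖S‖ ≤ 1) (x : H) :
    Antitone fun n => ‖(S ^ n) x‖ ^ 2 :=
  antitone_nat_of_succ_le fun n => by
    rw [pow_succ' S, mul_apply_eq_comp]
    gcongr
    exact norm_apply_le_of_norm_le_one hS _

/-- With `y = T*ⁿx` and `D` the defect operator of `T*ᵏ`, the difference is `TⁿD²y`, of norm at most
`‖Dy‖`, and `‖Dy‖² = ‖y‖² - ‖T*ᵏy‖²`. -/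
theorem norm_sq_sub_le (hT : ‖T‖ ≤ 1) (x : H) (n k : ℕ) :
    ‖(T ^ n * adjoint T ^ n) x - (T ^ (n + k) * adjoint T ^ (n + k)) x‖ ^ 2 ≤
      ‖(adjoint T ^ n) x‖ ^ 2 - ‖(adjoint T ^ (n + k)) x‖ ^ 2 := by
  have hk : ‖adjoint T ^ k‖ ≤ 1 := norm_pow_le_one (norm_adjoint_le_one hT) k
  set y := (adjoint T ^ n) x with hy
  have h1 : (adjoint T ^ (n + k)) x = (adjoint T ^ k) y := by
    rw [add_comm, pow_add, mul_apply_eq_comp]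
  have h2 : (T ^ n * adjoint T ^ n) x - (T ^ (n + k) * adjoint T ^ (n + k)) x =
      (T ^ n) (defectOp (adjoint T ^ k) (defectOp (adjoint T ^ k) y)) := by
    rw [defectOp_defectOp_apply _ hk, mul_apply_eq_comp, mul_apply_eq_comp, h1, map_sub,
      adjoint_pow, adjoint_adjoint, pow_add, mul_apply_eq_comp]
  rw [h1, h2, ← norm_defectOp_apply_sq _ hk]
  gcongr
  exact (norm_apply_le_of_norm_le_one (norm_pow_le_one hT n) _).trans
    (norm_defectOp_apply_le _ hk _)

/-- The numbers `‖T*ⁿx‖²` decrease to their infimum, so the preceding bound makes `TⁿT*ⁿx` a Cauchy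
sequence. -/
theorem exists_sotLim (hT : ‖T‖ ≤ 1) : ∃ L : H →L[ℂ] H,
    ∀ x, Filter.Tendsto (fun n => (T ^ n * adjoint T ^ n) x) Filter.atTop (𝓝 (L x)) := by
  have key : ∀ x, ∃ y, Filter.Tendsto (fun n => (T ^ n * adjoint T ^ n) x) Filter.atTop (𝓝 y) := by
    intro x
    have ha := antitone_norm_pow_apply_sq (norm_adjoint_le_one hT) x
    have hb : BddBelow (Set.range fun n => ‖(adjoint T ^ n) x‖ ^ 2) :=
      ⟨0, by rintro _ ⟨n, rfl⟩; positivity⟩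
    have hl := tendsto_atTop_ciInf ha hb
    refine cauchySeq_tendsto_of_complete (cauchySeq_of_le_tendsto_0'
      (fun n => √(‖(adjoint T ^ n) x‖ ^ 2 - ⨅ n, ‖(adjoint T ^ n) x‖ ^ 2)) (fun n m hnm => ?_) ?_)
    · obtain ⟨k, rfl⟩ := Nat.exists_eq_add_of_le hnm
      rw [dist_eq_norm]
      refine Real.le_sqrt_of_sq_le ((norm_sq_sub_le hT x n k).trans ?_)
      gcongr
      exact ciInf_le hb (n + k)
    · have h2 := (hl.sub_const (⨅ n, ‖(adjoint T ^ n) x‖ ^ 2)).sqrt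
      simpa using h2
  choose f hf using key
  exact ⟨continuousLinearMapOfTendsto (fun n => T ^ n * adjoint T ^ n) (f := f)
    (tendsto_pi_nhds.2 hf), hf⟩

theorem tendsto_sotLim (hT : ‖T‖ ≤ 1) (x : H) :
    Filter.Tendsto (fun n => (T ^ n * adjoint T ^ n) x) Filter.atTop
      (𝓝 (sotLim (fun n => T ^ n * adjoint T ^ n) x)) := by
  rw [sotLim, dif_pos (exists_sotLim hT)]
  exact (exists_sotLim hT).choose_spec x

theorem tendsto_inner_sotLim (hT : ‖T‖ ≤ 1) (x : H) :
    Filter.Tendsto (fun n => ((‖(adjoint T ^ n) x‖ ^ 2 : ℝ) : ℂ)) Filter.atTop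
      (𝓝 (inner ℂ (sotLim (fun n => T ^ n * adjoint T ^ n) x) x)) := by
  refine ((tendsto_sotLim hT x).inner tendsto_const_nhds).congr fun n => ?_
  rw [mul_apply_eq_comp, ← adjoint_inner_right, adjoint_pow, inner_self_eq_norm_sq_to_K]
  norm_cast

theorem sotLim_nonneg (hT : ‖T‖ ≤ 1) : 0 ≤ sotLim (fun n => T ^ n * adjoint T ^ n) := by
  rw [nonneg_iff_isPositive, isPositive_iff_complex]
  intro x
  have h1 := tendsto_inner_sotLim hT x
  have h2 := (Complex.continuous_re.tendsto _).comp h1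
  have h3 := (Complex.continuous_ofReal.tendsto _).comp h2
  refine ⟨tendsto_nhds_unique h3 h1, ge_of_tendsto' h2 fun n => ?_⟩
  simp only [Function.comp, Complex.ofReal_re]
  positivity

/-- All norm relations for `Q_{T*}` below are derived from this limit. -/
theorem tendsto_norm_asympMap (hT : ‖T‖ ≤ 1) (x : H) :
    Filter.Tendsto (fun n => ‖(adjoint T ^ n) x‖ ^ 2) Filter.atTop (𝓝 (‖asympMap T x‖ ^ 2)) := by
  have h : ‖asympMap T x‖ ^ 2 = Complex.re (inner ℂ (sotLim (fun n => T ^ n * adjoint T ^ n) x) x) :=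
    norm_sqrt_apply_sq (sotLim_nonneg hT) x
  rw [h]
  exact (Complex.continuous_re.tendsto _).comp (tendsto_inner_sotLim hT x)

theorem norm_asympMap_adjoint (hT : ‖T‖ ≤ 1) (x : H) :
    ‖asympMap T (adjoint T x)‖ = ‖asympMap T x‖ := by
  rw [← sq_eq_sq₀ (norm_nonneg _) (norm_nonneg _)]
  refine tendsto_nhds_unique (tendsto_norm_asympMap hT _)
    (((Filter.tendsto_add_atTop_iff_nat 1).2 (tendsto_norm_asympMap hT x)).congr fun n => ?_)
  rw [pow_succ (adjoint T) n, mul_apply_eq_comp]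

theorem norm_asympMap_adjoint_le (hT : ‖T‖ ≤ 1) {S : H →L[ℂ] H} (hS : ‖S‖ ≤ 1)
    (hc : Commute (adjoint S) (adjoint T)) (x : H) :
    ‖asympMap T (adjoint S x)‖ ≤ ‖asympMap T x‖ := by
  rw [← sq_le_sq₀ (norm_nonneg _) (norm_nonneg _)]
  refine le_of_tendsto_of_tendsto' (tendsto_norm_asympMap hT _) (tendsto_norm_asympMap hT x)
    fun n => ?_
  rw [← mul_apply_eq_comp, ← (hc.pow_right n).eq, mul_apply_eq_comp]
  gcongr
  exact norm_apply_le_of_norm_le_one (norm_adjoint_le_one hS) _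

theorem asympIsom_asympMap (hT : ‖T‖ ≤ 1) (x : H) :
    asympIsom T (asympMap T x) = asympMap T (adjoint T x) :=
  extendOfNorm_apply (f := (asympMap T ∘L adjoint T).toLinearMap) (e := (asympMap T).toLinearMap)
    (denseRange_asympMap T) (norm_asympMap_adjoint hT) x

theorem norm_asympIsom (hT : ‖T‖ ≤ 1) (r : asympRange T) : ‖asympIsom T r‖ = ‖r‖ :=
  norm_extendOfNorm_apply (f := (asympMap T ∘L adjoint T).toLinearMap)
    (e := (asympMap T).toLinearMap) (denseRange_asympMap T) (norm_asympMap_adjoint hT) r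

/-- The squared norms of the coefficients of the observability operator add up to
`‖h‖² - lim ‖T*ⁿ h‖²`. -/
theorem norm_obsOp_sq (hT : ‖T‖ ≤ 1) (hT' : ‖adjoint T‖ ≤ 1) (x : H) :
    ‖obsOp (adjoint T) hT' x‖ ^ 2 = ‖x‖ ^ 2 - ‖asympMap T x‖ ^ 2 := by
  rw [H2_norm_sq]
  refine tendsto_nhds_unique (summable_norm_defectMap_sq (adjoint T) hT' x).hasSum.tendsto_sum_nat
    ((tendsto_const_nhds.sub (tendsto_norm_asympMap hT x)).congr fun n => ?_)
  induction n with
  | zero => simp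
  | succ n ih =>
    rw [Finset.sum_range_succ, ← ih, norm_defectMap_sq (adjoint T) hT', pow_succ' (adjoint T) n,
      mul_apply_eq_comp]
    ring

end Asymptotic

/-! ### The minimal unitary extension -/

section Residual

variable {H : Type u} [NormedAddCommGroup H] [InnerProductSpace ℂ H] [CompleteSpace H]
  {T : H →L[ℂ] H}

/-- The vector `(r, e)` of the residual space. -/
noncomputable def resMk (r : asympRange T) (e : H2 (asympKer T)) : ResSpace T := WithLp.toLp 2 (r, e)

theorem exists_eq_resMk (x : ResSpace T) : ∃ r e, x = resMk r e :=
  ⟨(resEquiv T x).1, (resEquiv T x).2, rfl⟩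

theorem norm_resMk_sq (r : asympRange T) (e : H2 (asympKer T)) :
    ‖resMk r e‖ ^ 2 = ‖r‖ ^ 2 + ‖e‖ ^ 2 :=
  WithLp.prod_norm_sq_eq_of_L2 (WithLp.toLp 2 (r, e))

theorem resMap_eq (x : H) : resMap T x = resMk (asympMap T x) 0 := rfl

theorem norm_resMap (x : H) : ‖resMap T x‖ = ‖asympMap T x‖ := by
  rw [← sq_eq_sq₀ (norm_nonneg _) (norm_nonneg _), resMap_eq, norm_resMk_sq]
  simp

theorem resUnitaryAdj_resMk (r : asympRange T) (e : H2 (asympKer T)) :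
    resUnitaryAdj T (resMk r e) =
      resMk (asympIsom T r + (e 0 : asympRange T)) (H2.backShift e) := rfl

theorem norm_resUnitaryAdj (hT : ‖T‖ ≤ 1) (x : ResSpace T) : ‖resUnitaryAdj T x‖ = ‖x‖ := by
  obtain ⟨r, e, rfl⟩ := exists_eq_resMk x
  have h0 : inner ℂ (asympIsom T r) (e 0 : asympRange T) = 0 := by
    rw [← adjoint_inner_right]
    have : adjoint (asympIsom T) (e 0 : asympRange T) = 0 := (e 0).2
    rw [this, inner_zero_right]
  rw [← sq_eq_sq₀ (norm_nonneg _) (norm_nonneg _), resUnitaryAdj_resMk, norm_resMk_sq,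
    norm_resMk_sq, norm_sq_add_of_inner_eq_zero h0, norm_asympIsom hT, H2_norm_sq, H2_norm_sq,
    (H2_summable e).tsum_eq_zero_add, add_assoc]
  rfl

theorem surjective_resUnitaryAdj (hT : ‖T‖ ≤ 1) : Function.Surjective (resUnitaryAdj T) := by
  intro y
  obtain ⟨s, f, rfl⟩ := exists_eq_resMk y
  -- The preimage of `(s, f)` is `(Xs, (s - X*Xs, f₀, f₁, …))`: the part of `s` outside `Ran X*`
  -- becomes the new zeroth coefficient.
  let r := adjoint (asympIsom T) s
  have hk : s - asympIsom T r ∈ asympKer T := by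
    change adjoint (asympIsom T) (s - asympIsom T r) = 0
    rw [map_sub, adjoint_apply_apply_of_norm (norm_asympIsom hT), sub_self]
  refine ⟨resMk r (H2.single 0 ⟨_, hk⟩ + H2.shift f), ?_⟩
  rw [resUnitaryAdj_resMk]
  congr 1
  · rw [lp.coeFn_add, Pi.add_apply, H2.single_apply_self, H2.shift_zero, add_zero]
    exact add_sub_cancel _ _
  · refine H2.ext fun n => ?_
    rw [H2.backShift_apply, lp.coeFn_add, Pi.add_apply, H2.shift_succ,
      H2.single_apply_ne n.succ_ne_zero, zero_add]

theorem adjoint_resUnitary : adjoint (resUnitary T) = resUnitaryAdj T := adjoint_adjoint _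

theorem resUnitary_resUnitaryAdj (hT : ‖T‖ ≤ 1) (x : ResSpace T) :
    resUnitary T (resUnitaryAdj T x) = x :=
  adjoint_apply_apply_of_norm (norm_resUnitaryAdj hT) x

theorem resUnitaryAdj_resUnitary (hT : ‖T‖ ≤ 1) (x : ResSpace T) :
    resUnitaryAdj T (resUnitary T x) = x :=
  apply_adjoint_apply_of_surjective (norm_resUnitaryAdj hT) (surjective_resUnitaryAdj hT) x

theorem norm_resUnitary (hT : ‖T‖ ≤ 1) (x : ResSpace T) : ‖resUnitary T x‖ = ‖x‖ :=
  norm_adjoint_apply_of_surjective (norm_resUnitaryAdj hT) (surjective_resUnitaryAdj hT) x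

theorem resUnitaryAdj_resMap (hT : ‖T‖ ≤ 1) (x : H) :
    resUnitaryAdj T (resMap T x) = resMap T (adjoint T x) := by
  rw [resMap_eq, resUnitaryAdj_resMk, asympIsom_asympMap hT]
  have h1 : ((0 : H2 (asympKer T)) 0 : asympRange T) = 0 := rfl
  rw [h1, add_zero, map_zero, resMap_eq]

theorem resUnitary_resMap_adjoint (hT : ‖T‖ ≤ 1) (x : H) :
    resUnitary T (resMap T (adjoint T x)) = resMap T x := by
  rw [← resUnitaryAdj_resMap hT, resUnitary_resUnitaryAdj hT]

theorem resMk_eq_add (r : asympRange T) (e : H2 (asympKer T)) :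
    resMk r e = resMk r 0 + resMk 0 e := by
  have h : (r, e) = (r, (0 : H2 (asympKer T))) + ((0 : asympRange T), e) := by
    rw [Prod.mk_add_mk, add_zero, zero_add]
  exact congrArg (WithLp.toLp 2) h

theorem H2.backShift_single_zero {F : Type*} [NormedAddCommGroup F] [InnerProductSpace ℂ F]
    (x : F) : H2.backShift (H2.single 0 x) = 0 :=
  H2.ext fun n => by
    rw [H2.backShift_apply, H2.single_apply_ne n.succ_ne_zero]
    rfl

theorem H2.backShift_single_succ {F : Type*} [NormedAddCommGroup F] [InnerProductSpace ℂ F]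
    (n : ℕ) (x : F) : H2.backShift (H2.single (n + 1) x) = H2.single n x := by
  rw [← H2.shift_single]
  rfl

theorem continuous_resMk_zero : Continuous fun r : asympRange T => resMk r 0 :=
  (resEquiv T).symm.continuous.comp (by fun_prop)

theorem resMk_zero_mem {N : Submodule ℂ (ResSpace T)}
    (hN : IsClosed (N : Set (ResSpace T))) (h0 : ∀ x, resMap T x ∈ N) (r : asympRange T) :
    resMk r 0 ∈ N := by
  refine (denseRange_asympMap T).induction (P := fun r => resMk r 0 ∈ N) ?_
    (hN.preimage continuous_resMk_zero) r
  rintro _ ⟨x, rfl⟩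
  exact h0 x

/-- `W_D*` moves `(0, zⁿ⁺¹k)` to `(0, zⁿk)` and `(0, k)` to `(k, 0)`, so these vectors are
`W_D`-translates of vectors in the closure of `Ran Q_{T*}`. -/
theorem resMk_single_mem (hT : ‖T‖ ≤ 1) {N : Submodule ℂ (ResSpace T)}
    (hN : IsClosed (N : Set (ResSpace T))) (h0 : ∀ x, resMap T x ∈ N)
    (hW : ∀ x ∈ N, resUnitary T x ∈ N) (n : ℕ) (k : asympKer T) :
    resMk 0 (H2.single n k) ∈ N := by
  induction n with
  | zero =>
    have h3 : resUnitaryAdj T (resMk 0 (H2.single 0 k)) = resMk (k : asympRange T) 0 := by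
      rw [resUnitaryAdj_resMk, map_zero, zero_add, H2.single_apply_self,
        H2.backShift_single_zero]
    rw [← resUnitary_resUnitaryAdj hT (resMk 0 (H2.single 0 k)), h3]
    exact hW _ (resMk_zero_mem hN h0 _)
  | succ n ih =>
    have h3 : resUnitaryAdj T (resMk 0 (H2.single (n + 1) k)) = resMk 0 (H2.single n k) := by
      rw [resUnitaryAdj_resMk, map_zero, zero_add, H2.single_apply_ne n.succ_ne_zero.symm,
        H2.backShift_single_succ]
      rfl
    rw [← resUnitary_resUnitaryAdj hT (resMk 0 (H2.single (n + 1) k)), h3]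
    exact hW _ ih

/-- The inclusion of the second summand into the residual space. -/
noncomputable def resInr (T : H →L[ℂ] H) : H2 (asympKer T) →L[ℂ] ResSpace T :=
  (resEquiv T).symm.toContinuousLinearMap ∘L
    ContinuousLinearMap.inr ℂ (asympRange T) (H2 (asympKer T))

theorem resInr_apply (e : H2 (asympKer T)) : resInr T e = resMk 0 e := rfl

/-- Minimality of the unitary extension: a closed subspace that contains the range of `Q_{T*}` and
is invariant under `W_D` is the whole space. -/
theorem eq_top_of_resUnitary_mem (hT : ‖T‖ ≤ 1) {N : Submodule ℂ (ResSpace T)}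
    (hN : IsClosed (N : Set (ResSpace T))) (h0 : ∀ x, resMap T x ∈ N)
    (hW : ∀ x ∈ N, resUnitary T x ∈ N) : N = ⊤ := by
  rw [Submodule.eq_top_iff']
  intro x
  obtain ⟨r, e, rfl⟩ := exists_eq_resMk x
  rw [resMk_eq_add, ← resInr_apply]
  refine N.add_mem (resMk_zero_mem hN h0 r) (hN.mem_of_tendsto
    ((resInr T).hasSum (H2.hasSum_single e)) (Filter.Eventually.of_forall fun _ =>
      N.sum_mem fun n _ => resMk_single_mem hT hN h0 hW n (e n)))

theorem resGen_single (T S : H →L[ℂ] H) (n : ℕ) (x : H) :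
    resGen T S (Finsupp.single n x) = (resUnitary T ^ n) (resMap T (S x)) := by
  rw [resGen, Finsupp.lsum_single]
  rfl

theorem denseRange_resGen (hT : ‖T‖ ≤ 1) : DenseRange (resGen T 1) := by
  have h := eq_top_of_resUnitary_mem hT
    (N := (LinearMap.range (resGen T 1)).topologicalClosure)
    (Submodule.isClosed_topologicalClosure _) (fun x => subset_closure
      ⟨Finsupp.single 0 x, by rw [resGen_single]; rfl⟩) (fun x hx => by
      refine map_mem_closure (resUnitary T).continuous hx ?_
      rintro _ ⟨f, rfl⟩
      induction f using Finsupp.induction_linear with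
      | zero => rw [map_zero, map_zero]; exact zero_mem _
      | add f g hf hg => rw [map_add, map_add]; exact add_mem hf hg
      | single n x =>
        refine ⟨Finsupp.single (n + 1) x, ?_⟩
        rw [resGen_single, resGen_single, pow_succ', mul_apply_eq_comp])
  rw [DenseRange, dense_iff_closure_eq]
  exact congrArg (fun N : Submodule ℂ (ResSpace T) => (N : Set (ResSpace T))) h

/-- A finite sum `∑ Wⁿ A hₙ` with `W A T* = A` is of the form `Wᴺ A g`, where `g` depends only on
`T*` and `(hₙ)`. -/
theorem exists_pow_apply_eq {T' : H →L[ℂ] H} (f : ℕ →₀ H) :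
    ∃ (N : ℕ) (g : H), ∀ {K : Type u} [NormedAddCommGroup K] [InnerProductSpace ℂ K]
      (W : K →L[ℂ] K) (A : H →L[ℂ] K), (∀ x, W (A (T' x)) = A x) →
      Finsupp.lsum ℂ (fun n => ((W ^ n) ∘L A).toLinearMap) f = (W ^ N) (A g) := by
  have hpow : ∀ {K : Type u} [NormedAddCommGroup K] [InnerProductSpace ℂ K]
      (W : K →L[ℂ] K) (A : H →L[ℂ] K), (∀ x, W (A (T' x)) = A x) → ∀ (n : ℕ) (x : H),
      (W ^ n) (A ((T' ^ n) x)) = A x := by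
    intro K _ _ W A h n x
    induction n generalizing x with
    | zero => rfl
    | succ n ih => rw [pow_succ W, pow_succ' T', mul_apply_eq_comp, mul_apply_eq_comp, h, ih]
  induction f using Finsupp.induction_linear with
  | zero => exact ⟨0, 0, fun W A _ => by simp⟩
  | single n x => exact ⟨n, x, fun W A _ => by rw [Finsupp.lsum_single]; rfl⟩
  | add f₁ f₂ h₁ h₂ =>
    obtain ⟨N₁, g₁, h₁⟩ := h₁
    obtain ⟨N₂, g₂, h₂⟩ := h₂
    -- Common exponent: `A g = Wᵐ A T'ᵐ g` raises the power in either summand at will.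
    refine ⟨N₁ + N₂, (T' ^ N₂) g₁ + (T' ^ N₁) g₂, fun W A h => ?_⟩
    rw [map_add, h₁ W A h, h₂ W A h, map_add, map_add, pow_add, mul_apply_eq_comp, hpow W A h,
      ← pow_add, add_comm N₁, pow_add, mul_apply_eq_comp, hpow W A h]

end Residual

/-! ### The canonical commuting unitaries -/

section Canonical

variable {H : Type u} [NormedAddCommGroup H] [InnerProductSpace ℂ H] [CompleteSpace H]
  {T S : H →L[ℂ] H}

/-- The vectors `W_DⁿQ_{T*}h` span a dense subspace, so operator identities on `𝒬_{T*}` are tested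
on them. -/
theorem eq_of_forall_resUnitary_pow {K : Type*} [NormedAddCommGroup K] [NormedSpace ℂ K]
    (hT : ‖T‖ ≤ 1) {A B : ResSpace T →L[ℂ] K}
    (h : ∀ (n : ℕ) (x : H), A ((resUnitary T ^ n) (resMap T x)) =
      B ((resUnitary T ^ n) (resMap T x))) : A = B := by
  refine ContinuousLinearMap.coeFn_injective
    ((denseRange_resGen hT).equalizer A.continuous B.continuous (funext fun f => ?_))
  have h2 : A.toLinearMap ∘ₗ resGen T 1 = B.toLinearMap ∘ₗ resGen T 1 :=
    Finsupp.lhom_ext fun n x => by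
      simp only [LinearMap.comp_apply, resGen_single]
      exact h n x
  exact congrArg (fun L : (ℕ →₀ H) →ₗ[ℂ] K => L f) h2

/-- Let `W` be an isometry and `A` an operator with `W A T* = A` and `‖A x‖ = ‖Q_{T*} x‖`. Then
the map `∑ W_Dⁿ Q_{T*} hₙ ↦ ∑ Wⁿ A hₙ` preserves norms. -/
theorem norm_lsum_pow_eq (hT : ‖T‖ ≤ 1) {K : Type u} [NormedAddCommGroup K]
    [InnerProductSpace ℂ K] [CompleteSpace K] {W : K →L[ℂ] K} {A : H →L[ℂ] K}
    (hW : ∀ x, ‖W x‖ = ‖x‖) (hA : ∀ x, W (A (adjoint T x)) = A x)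
    (hn : ∀ x, ‖A x‖ = ‖resMap T x‖) (f : ℕ →₀ H) :
    ‖Finsupp.lsum ℂ (fun n => ((W ^ n) ∘L A).toLinearMap) f‖ = ‖resGen T 1 f‖ := by
  obtain ⟨N, g, hg⟩ := exists_pow_apply_eq (T' := adjoint T) f
  have h1 : resGen T 1 f = (resUnitary T ^ N) (resMap T g) :=
    hg (resUnitary T) (resMap T) (resUnitary_resMap_adjoint hT)
  rw [h1, hg W A hA, norm_pow_apply hW, norm_pow_apply (norm_resUnitary hT), hn]

theorem resUnitary_resMap_adjoint_of_commute (hT : ‖T‖ ≤ 1)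
    (hc : Commute (adjoint S) (adjoint T)) (x : H) :
    resUnitary T ((resMap T ∘L adjoint S) (adjoint T x)) = (resMap T ∘L adjoint S) x := by
  rw [comp_apply, comp_apply, ← mul_apply_eq_comp (adjoint S), hc.eq, mul_apply_eq_comp,
    resUnitary_resMap_adjoint hT]

theorem norm_resGen_eq (hT : ‖T‖ ≤ 1) (hc : Commute (adjoint S) (adjoint T))
    (hn : ∀ x, ‖resMap T (adjoint S x)‖ = ‖resMap T x‖) (f : ℕ →₀ H) :
    ‖resGen T (adjoint S) f‖ = ‖resGen T 1 f‖ :=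
  norm_lsum_pow_eq hT (norm_resUnitary hT) (resUnitary_resMap_adjoint_of_commute hT hc) hn f

theorem adjoint_canonicalUnitary_apply (hT : ‖T‖ ≤ 1) (hc : Commute (adjoint S) (adjoint T))
    (hn : ∀ x, ‖resMap T (adjoint S x)‖ = ‖resMap T x‖) (n : ℕ) (x : H) :
    adjoint (canonicalUnitary T S) ((resUnitary T ^ n) (resMap T x)) =
      (resUnitary T ^ n) (resMap T (adjoint S x)) := by
  have h := extendOfNorm_apply (denseRange_resGen hT) (norm_resGen_eq hT hc hn)
    (Finsupp.single n x)
  rw [resGen_single, resGen_single] at h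
  rw [canonicalUnitary, adjoint_adjoint]
  exact h

theorem norm_adjoint_canonicalUnitary (hT : ‖T‖ ≤ 1) (hc : Commute (adjoint S) (adjoint T))
    (hn : ∀ x, ‖resMap T (adjoint S x)‖ = ‖resMap T x‖) (y : ResSpace T) :
    ‖adjoint (canonicalUnitary T S) y‖ = ‖y‖ := by
  rw [canonicalUnitary, adjoint_adjoint]
  exact norm_extendOfNorm_apply (denseRange_resGen hT) (norm_resGen_eq hT hc hn) y

end Canonical

/-! ### The pair `W_{♭1}`, `W_{♭2}`: commuting unitaries with product `W_D` -/

section Pair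

variable {H : Type u} [NormedAddCommGroup H] [InnerProductSpace ℂ H] [CompleteSpace H]
  {T₁ T₂ : H →L[ℂ] H}

theorem norm_mul_le_one (h₁ : ‖T₁‖ ≤ 1) (h₂ : ‖T₂‖ ≤ 1) : ‖T₁ * T₂‖ ≤ 1 :=
  (norm_mul_le _ _).trans (mul_le_one₀ h₁ (norm_nonneg _) h₂)

theorem adjoint_mul_apply (A B : H →L[ℂ] H) (x : H) :
    adjoint (A * B) x = adjoint B (adjoint A x) := by
  rw [mul_def, adjoint_comp, comp_apply]

theorem adjoint_adjoint_apply_comm (hcomm : T₁ * T₂ = T₂ * T₁) (x : H) :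
    adjoint T₁ (adjoint T₂ x) = adjoint T₂ (adjoint T₁ x) := by
  rw [← adjoint_mul_apply, ← adjoint_mul_apply, hcomm]

theorem commute_adjoint_mul_left (hcomm : T₁ * T₂ = T₂ * T₁) :
    Commute (adjoint T₁) (adjoint (T₁ * T₂)) := by
  ext x
  simp only [mul_apply_eq_comp, adjoint_mul_apply]
  rw [adjoint_adjoint_apply_comm hcomm]

theorem commute_adjoint_mul_right (hcomm : T₁ * T₂ = T₂ * T₁) :
    Commute (adjoint T₂) (adjoint (T₁ * T₂)) := by
  rw [hcomm]
  exact commute_adjoint_mul_left hcomm.symm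

/-- A squeeze: `‖QT*x‖ = ‖QT₂*T₁*x‖ ≤ ‖QT₁*x‖ ≤ ‖Qx‖`, and the two ends are equal. -/
theorem norm_resMap_adjoint_left (hcomm : T₁ * T₂ = T₂ * T₁) (h₁ : ‖T₁‖ ≤ 1) (h₂ : ‖T₂‖ ≤ 1)
    (x : H) : ‖resMap (T₁ * T₂) (adjoint T₁ x)‖ = ‖resMap (T₁ * T₂) x‖ := by
  have hT := norm_mul_le_one h₁ h₂
  rw [norm_resMap, norm_resMap]
  refine le_antisymm (norm_asympMap_adjoint_le hT h₁ (commute_adjoint_mul_left hcomm) x) ?_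
  rw [← norm_asympMap_adjoint hT x, adjoint_mul_apply]
  exact norm_asympMap_adjoint_le hT h₂ (commute_adjoint_mul_right hcomm) _

theorem norm_resMap_adjoint_right (hcomm : T₁ * T₂ = T₂ * T₁) (h₁ : ‖T₁‖ ≤ 1) (h₂ : ‖T₂‖ ≤ 1)
    (x : H) : ‖resMap (T₁ * T₂) (adjoint T₂ x)‖ = ‖resMap (T₁ * T₂) x‖ := by
  have h := norm_resMap_adjoint_left hcomm.symm h₂ h₁ x
  rwa [← hcomm] at h

theorem resUnitaryAdj_resUnitary_pow_resMap {T : H →L[ℂ] H} (hT : ‖T‖ ≤ 1) (n : ℕ) (x : H) :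
    resUnitaryAdj T ((resUnitary T ^ n) (resMap T x)) =
      (resUnitary T ^ n) (resMap T (adjoint T x)) := by
  rcases n with _ | n
  · exact resUnitaryAdj_resMap hT x
  · rw [pow_succ', mul_apply_eq_comp, resUnitaryAdj_resUnitary hT, ← pow_succ', pow_succ,
      mul_apply_eq_comp, resUnitary_resMap_adjoint hT]

variable (hcomm : T₁ * T₂ = T₂ * T₁) (h₁ : ‖T₁‖ ≤ 1) (h₂ : ‖T₂‖ ≤ 1)
include hcomm h₁ h₂

theorem adjoint_canonicalUnitary_left (n : ℕ) (x : H) :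
    adjoint (canonicalUnitary (T₁ * T₂) T₁) ((resUnitary (T₁ * T₂) ^ n) (resMap (T₁ * T₂) x)) =
      (resUnitary (T₁ * T₂) ^ n) (resMap (T₁ * T₂) (adjoint T₁ x)) :=
  adjoint_canonicalUnitary_apply (norm_mul_le_one h₁ h₂) (commute_adjoint_mul_left hcomm)
    (norm_resMap_adjoint_left hcomm h₁ h₂) n x

theorem adjoint_canonicalUnitary_right (n : ℕ) (x : H) :
    adjoint (canonicalUnitary (T₁ * T₂) T₂) ((resUnitary (T₁ * T₂) ^ n) (resMap (T₁ * T₂) x)) =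
      (resUnitary (T₁ * T₂) ^ n) (resMap (T₁ * T₂) (adjoint T₂ x)) :=
  adjoint_canonicalUnitary_apply (norm_mul_le_one h₁ h₂) (commute_adjoint_mul_right hcomm)
    (norm_resMap_adjoint_right hcomm h₁ h₂) n x

theorem adjoint_canonicalUnitary_comp :
    adjoint (canonicalUnitary (T₁ * T₂) T₁) ∘L adjoint (canonicalUnitary (T₁ * T₂) T₂) =
      resUnitaryAdj (T₁ * T₂) :=
  eq_of_forall_resUnitary_pow (norm_mul_le_one h₁ h₂) fun n x => by
    rw [comp_apply, adjoint_canonicalUnitary_right hcomm h₁ h₂,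
      adjoint_canonicalUnitary_left hcomm h₁ h₂,
      resUnitaryAdj_resUnitary_pow_resMap (norm_mul_le_one h₁ h₂), adjoint_mul_apply,
      adjoint_adjoint_apply_comm hcomm]

theorem adjoint_canonicalUnitary_comp' :
    adjoint (canonicalUnitary (T₁ * T₂) T₂) ∘L adjoint (canonicalUnitary (T₁ * T₂) T₁) =
      resUnitaryAdj (T₁ * T₂) :=
  eq_of_forall_resUnitary_pow (norm_mul_le_one h₁ h₂) fun n x => by
    rw [comp_apply, adjoint_canonicalUnitary_left hcomm h₁ h₂,
      adjoint_canonicalUnitary_right hcomm h₁ h₂,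
      resUnitaryAdj_resUnitary_pow_resMap (norm_mul_le_one h₁ h₂), adjoint_mul_apply]

theorem canonicalUnitary_apply_apply (x : ResSpace (T₁ * T₂)) :
    canonicalUnitary (T₁ * T₂) T₁ (canonicalUnitary (T₁ * T₂) T₂ x) = resUnitary (T₁ * T₂) x := by
  rw [resUnitary, ← adjoint_canonicalUnitary_comp' hcomm h₁ h₂, adjoint_comp, adjoint_adjoint,
    adjoint_adjoint, comp_apply]

theorem canonicalUnitary_apply_apply' (x : ResSpace (T₁ * T₂)) :
    canonicalUnitary (T₁ * T₂) T₂ (canonicalUnitary (T₁ * T₂) T₁ x) = resUnitary (T₁ * T₂) x := by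
  rw [resUnitary, ← adjoint_canonicalUnitary_comp hcomm h₁ h₂, adjoint_comp, adjoint_adjoint,
    adjoint_adjoint, comp_apply]

/-- `W_{♭1}*` is the left factor of the surjection `W_D* = W_{♭1}*W_{♭2}*`. -/
theorem surjective_adjoint_canonicalUnitary_left :
    Function.Surjective (adjoint (canonicalUnitary (T₁ * T₂) T₁)) := fun y => by
  obtain ⟨x, rfl⟩ := surjective_resUnitaryAdj (norm_mul_le_one h₁ h₂) y
  exact ⟨adjoint (canonicalUnitary (T₁ * T₂) T₂) x,
    congrArg (fun A : ResSpace (T₁ * T₂) →L[ℂ] _ => A x)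
      (adjoint_canonicalUnitary_comp hcomm h₁ h₂)⟩

theorem surjective_adjoint_canonicalUnitary_right :
    Function.Surjective (adjoint (canonicalUnitary (T₁ * T₂) T₂)) := fun y => by
  obtain ⟨x, rfl⟩ := surjective_resUnitaryAdj (norm_mul_le_one h₁ h₂) y
  exact ⟨adjoint (canonicalUnitary (T₁ * T₂) T₁) x,
    congrArg (fun A : ResSpace (T₁ * T₂) →L[ℂ] _ => A x)
      (adjoint_canonicalUnitary_comp' hcomm h₁ h₂)⟩

theorem norm_adjoint_canonicalUnitary_left (x : ResSpace (T₁ * T₂)) :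
    ‖adjoint (canonicalUnitary (T₁ * T₂) T₁) x‖ = ‖x‖ :=
  norm_adjoint_canonicalUnitary (norm_mul_le_one h₁ h₂) (commute_adjoint_mul_left hcomm)
    (norm_resMap_adjoint_left hcomm h₁ h₂) x

theorem norm_adjoint_canonicalUnitary_right (x : ResSpace (T₁ * T₂)) :
    ‖adjoint (canonicalUnitary (T₁ * T₂) T₂) x‖ = ‖x‖ :=
  norm_adjoint_canonicalUnitary (norm_mul_le_one h₁ h₂) (commute_adjoint_mul_right hcomm)
    (norm_resMap_adjoint_right hcomm h₁ h₂) x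

theorem norm_canonicalUnitary_left (x : ResSpace (T₁ * T₂)) :
    ‖canonicalUnitary (T₁ * T₂) T₁ x‖ = ‖x‖ := by
  rw [← norm_adjoint_apply_of_surjective (norm_adjoint_canonicalUnitary_left hcomm h₁ h₂)
    (surjective_adjoint_canonicalUnitary_left hcomm h₁ h₂) x, adjoint_adjoint]

theorem norm_canonicalUnitary_right (x : ResSpace (T₁ * T₂)) :
    ‖canonicalUnitary (T₁ * T₂) T₂ x‖ = ‖x‖ := by
  rw [← norm_adjoint_apply_of_surjective (norm_adjoint_canonicalUnitary_right hcomm h₁ h₂)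
    (surjective_adjoint_canonicalUnitary_right hcomm h₁ h₂) x, adjoint_adjoint]

end Pair

/-! ### The multiplication operators of a tuple -/

namespace PreAndoTuple

variable {H : Type u} [NormedAddCommGroup H] [InnerProductSpace ℂ H] [CompleteSpace H]
  {S : H →L[ℂ] H} (t : PreAndoTuple S)

theorem P_P (x : t.F) : t.P (t.P x) = t.P x :=
  congrArg (fun A : t.F →L[ℂ] t.F => A x) t.isProj.isIdempotentElem.eq

theorem adjoint_P : adjoint t.P = t.P := t.isProj.isSelfAdjoint.star_eq

theorem adjoint_U_U (x : t.F) : adjoint t.U (t.U x) = x :=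
  congrArg (fun A : t.F →L[ℂ] t.F => A x) (Unitary.mem_iff.1 t.isUnitary).1

theorem U_adjoint_U (x : t.F) : t.U (adjoint t.U x) = x :=
  congrArg (fun A : t.F →L[ℂ] t.F => A x) (Unitary.mem_iff.1 t.isUnitary).2

theorem norm_U (x : t.F) : ‖t.U x‖ = ‖x‖ :=
  (norm_map_iff_adjoint_comp_self t.U).2 (Unitary.mem_iff.1 t.isUnitary).1 x

theorem norm_adjoint_U (x : t.F) : ‖adjoint t.U x‖ = ‖x‖ := by
  rw [← t.norm_U, t.U_adjoint_U]

theorem M₁_apply (f : H2 t.F) (n : ℕ) : t.M₁ f n =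
    adjoint t.U (f n - t.P (f n)) + adjoint t.U (t.P (H2.shift f n)) :=
  H2.mulLinear_apply _ _ f n

theorem M₂_apply (f : H2 t.F) (n : ℕ) : t.M₂ f n =
    t.P (t.U (f n)) + (t.U (H2.shift f n) - t.P (t.U (H2.shift f n))) :=
  H2.mulLinear_apply _ _ f n

theorem adjoint_one_sub_P : adjoint (1 - t.P) = 1 - t.P := by
  have h := t.isProj.one_sub.isSelfAdjoint.star_eq
  exact h

theorem adjoint_M₁_apply (f : H2 t.F) (n : ℕ) : adjoint t.M₁ f n =
    (t.U (f n) - t.P (t.U (f n))) + t.P (t.U (f (n + 1))) := by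
  rw [M₁, H2.adjoint_mulLinear_apply, mul_def, mul_def, adjoint_comp, adjoint_comp,
    adjoint_adjoint, adjoint_one_sub_P, adjoint_P]
  rfl

theorem adjoint_M₂_apply (f : H2 t.F) (n : ℕ) : adjoint t.M₂ f n =
    adjoint t.U (t.P (f n)) + adjoint t.U (f (n + 1) - t.P (f (n + 1))) := by
  rw [M₂, H2.adjoint_mulLinear_apply, mul_def, mul_def, adjoint_comp, adjoint_comp,
    adjoint_one_sub_P, adjoint_P]
  rfl

/-- As symbols, `(Pᗮ + zP)(P + zPᗮ) = z` because `P Pᗮ = 0`, and then `U*zU = z`. -/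
theorem M₁_M₂ (f : H2 t.F) : t.M₁ (t.M₂ f) = H2.shift f := by
  refine H2.ext fun n => ?_
  rcases n with _ | n
  · simp [M₁_apply, M₂_apply, P_P]
  · simp [M₁_apply, M₂_apply, P_P, adjoint_U_U]

theorem M₂_M₁ (f : H2 t.F) : t.M₂ (t.M₁ f) = H2.shift f := by
  refine H2.ext fun n => ?_
  rcases n with _ | n
  · simp [M₁_apply, M₂_apply, P_P, U_adjoint_U]
  · simp [M₁_apply, M₂_apply, P_P, U_adjoint_U]

theorem inner_sub_P_P (x y : t.F) : Inner.inner ℂ (x - t.P x) (t.P y) = 0 := by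
  rw [← adjoint_inner_left, adjoint_P, map_sub, P_P, sub_self, inner_zero_left]

theorem norm_sq_sub_P_add_P (x : t.F) : ‖x - t.P x‖ ^ 2 + ‖t.P x‖ ^ 2 = ‖x‖ ^ 2 := by
  rw [← norm_sq_add_of_inner_eq_zero (t.inner_sub_P_P x x), sub_add_cancel]

theorem norm_M₁ (f : H2 t.F) : ‖t.M₁ f‖ = ‖f‖ := by
  refine H2.norm_mulLinear (fun x y => ?_) (fun x => ?_) f
  · change ‖adjoint t.U (x - t.P x) + adjoint t.U (t.P y)‖ ^ 2 =
      ‖adjoint t.U (x - t.P x)‖ ^ 2 + ‖adjoint t.U (t.P y)‖ ^ 2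
    rw [← map_add, norm_adjoint_U, norm_adjoint_U, norm_adjoint_U,
      norm_sq_add_of_inner_eq_zero (t.inner_sub_P_P x y)]
  · change ‖adjoint t.U (x - t.P x)‖ ^ 2 + ‖adjoint t.U (t.P x)‖ ^ 2 = ‖x‖ ^ 2
    rw [norm_adjoint_U, norm_adjoint_U, norm_sq_sub_P_add_P]

theorem norm_M₂ (f : H2 t.F) : ‖t.M₂ f‖ = ‖f‖ := by
  rw [← t.norm_M₁, M₁_M₂, H2.norm_shift]

end PreAndoTuple

/-! ### The Douglas model is a lift -/

section Douglas

variable {H : Type u} [NormedAddCommGroup H] [InnerProductSpace ℂ H] [CompleteSpace H]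
  {T₁ T₂ : H →L[ℂ] H}

/-- Stated with free `y` and `z`, so that powers of `T*` can be inserted in the form in which they
occur. -/
theorem PreAndoTuple.IsTypeI.left_apply {t : PreAndoTuple (adjoint (T₁ * T₂))}
    (ht : t.IsTypeI T₁ T₂) {x y z : H} (hy : adjoint (T₁ * T₂) x = y) (hz : adjoint T₁ x = z) :
    (t.U (t.Lam (defectMap (adjoint (T₁ * T₂)) x)) -
        t.P (t.U (t.Lam (defectMap (adjoint (T₁ * T₂)) x)))) +
      t.P (t.U (t.Lam (defectMap (adjoint (T₁ * T₂)) y))) =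
      t.Lam (defectMap (adjoint (T₁ * T₂)) z) := by
  subst hy hz
  exact congrArg (fun A : H →L[ℂ] t.F => A x) ht.1

theorem PreAndoTuple.IsTypeI.right_apply {t : PreAndoTuple (adjoint (T₁ * T₂))}
    (ht : t.IsTypeI T₁ T₂) {x y z : H} (hy : adjoint (T₁ * T₂) x = y) (hz : adjoint T₂ x = z) :
    adjoint t.U (t.P (t.Lam (defectMap (adjoint (T₁ * T₂)) x))) +
      adjoint t.U (t.Lam (defectMap (adjoint (T₁ * T₂)) y) -
        t.P (t.Lam (defectMap (adjoint (T₁ * T₂)) y))) =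
      t.Lam (defectMap (adjoint (T₁ * T₂)) z) := by
  subst hy hz
  exact congrArg (fun A : H →L[ℂ] t.F => A x) ht.2

theorem apply_pow_apply (A : H →L[ℂ] H) (n : ℕ) (x : H) : A ((A ^ n) x) = (A ^ (n + 1)) x := by
  rw [pow_succ', mul_apply_eq_comp]

theorem pow_adjoint_apply_comm {A B : H →L[ℂ] H} (h : Commute A B) (n : ℕ) (x : H) :
    A ((B ^ n) x) = (B ^ n) (A x) :=
  congrArg (fun C : H →L[ℂ] H => C x) (h.pow_right n).eq

variable (hcomm : T₁ * T₂ = T₂ * T₁) (h₁ : ‖T₁‖ ≤ 1) (h₂ : ‖T₂‖ ≤ 1)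

/-- The vector `(f, q)` of the space of the Douglas model. -/
noncomputable def douglasMk (t : PreAndoTuple (adjoint (T₁ * T₂))) (f : H2 t.F)
    (q : ResSpace (T₁ * T₂)) : (douglasLift T₁ T₂ h₁ h₂ t).K := WithLp.toLp 2 (f, q)

theorem exists_eq_douglasMk (t : PreAndoTuple (adjoint (T₁ * T₂)))
    (k : (douglasLift T₁ T₂ h₁ h₂ t).K) : ∃ f q, k = douglasMk h₁ h₂ t f q :=
  ⟨WithLp.fst (α := H2 t.F) (β := ResSpace (T₁ * T₂)) k, WithLp.snd (α := H2 t.F) k, rfl⟩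

theorem norm_douglasMk_sq (t : PreAndoTuple (adjoint (T₁ * T₂))) (f : H2 t.F)
    (q : ResSpace (T₁ * T₂)) : ‖douglasMk h₁ h₂ t f q‖ ^ 2 = ‖f‖ ^ 2 + ‖q‖ ^ 2 :=
  WithLp.prod_norm_sq_eq_of_L2 (WithLp.toLp 2 (f, q))

theorem douglasLift_emb_apply (t : PreAndoTuple (adjoint (T₁ * T₂))) (x : H) :
    (douglasLift T₁ T₂ h₁ h₂ t).emb x = douglasMk h₁ h₂ t
      (H2.map t.Lam.toContinuousLinearMap (obsOp (adjoint (T₁ * T₂))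
        (norm_adjoint_mul_le_one h₁ h₂) x)) (resMap (T₁ * T₂) x) := rfl

theorem norm_douglasLift_emb (t : PreAndoTuple (adjoint (T₁ * T₂))) (x : H) :
    ‖(douglasLift T₁ T₂ h₁ h₂ t).emb x‖ = ‖x‖ := by
  rw [← sq_eq_sq₀ (norm_nonneg _) (norm_nonneg _), douglasLift_emb_apply, norm_douglasMk_sq,
    H2.norm_map (fun y => t.Lam.norm_map y), norm_obsOp_sq (norm_mul_le_one h₁ h₂), norm_resMap,
    sub_add_cancel]

theorem douglasLift_V₁_apply (t : PreAndoTuple (adjoint (T₁ * T₂))) (f : H2 t.F)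
    (q : ResSpace (T₁ * T₂)) : (douglasLift T₁ T₂ h₁ h₂ t).V₁ (douglasMk h₁ h₂ t f q) =
      douglasMk h₁ h₂ t (t.M₁ f) (canonicalUnitary (T₁ * T₂) T₁ q) := rfl

theorem douglasLift_V₂_apply (t : PreAndoTuple (adjoint (T₁ * T₂))) (f : H2 t.F)
    (q : ResSpace (T₁ * T₂)) : (douglasLift T₁ T₂ h₁ h₂ t).V₂ (douglasMk h₁ h₂ t f q) =
      douglasMk h₁ h₂ t (t.M₂ f) (canonicalUnitary (T₁ * T₂) T₂ q) := rfl

theorem adjoint_douglasLift_V₁_apply (t : PreAndoTuple (adjoint (T₁ * T₂))) (f : H2 t.F)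
    (q : ResSpace (T₁ * T₂)) : adjoint (douglasLift T₁ T₂ h₁ h₂ t).V₁ (douglasMk h₁ h₂ t f q) =
      douglasMk h₁ h₂ t (adjoint t.M₁ f) (adjoint (canonicalUnitary (T₁ * T₂) T₁) q) :=
  congrArg (fun A : WithLp 2 (H2 t.F × ResSpace (T₁ * T₂)) →L[ℂ] _ => A (WithLp.toLp 2 (f, q)))
    (adjoint_blockDiag t.M₁ (canonicalUnitary (T₁ * T₂) T₁))

theorem adjoint_douglasLift_V₂_apply (t : PreAndoTuple (adjoint (T₁ * T₂))) (f : H2 t.F)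
    (q : ResSpace (T₁ * T₂)) : adjoint (douglasLift T₁ T₂ h₁ h₂ t).V₂ (douglasMk h₁ h₂ t f q) =
      douglasMk h₁ h₂ t (adjoint t.M₂ f) (adjoint (canonicalUnitary (T₁ * T₂) T₂) q) :=
  congrArg (fun A : WithLp 2 (H2 t.F × ResSpace (T₁ * T₂)) →L[ℂ] _ => A (WithLp.toLp 2 (f, q)))
    (adjoint_blockDiag t.M₂ (canonicalUnitary (T₁ * T₂) T₂))

include hcomm

/-- The `n`-th coefficient of `M₁*f` is `PᗮUfₙ + PUfₙ₊₁`. For `fₙ = ΛD_{T*}T*ⁿx` this is the first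
Type I equation at `T*ⁿx`. -/
theorem adjoint_M₁_map_obsOp {t : PreAndoTuple (adjoint (T₁ * T₂))} (ht : t.IsTypeI T₁ T₂)
    (hT : ‖adjoint (T₁ * T₂)‖ ≤ 1) (x : H) :
    adjoint t.M₁ (H2.map t.Lam.toContinuousLinearMap (obsOp (adjoint (T₁ * T₂)) hT x)) =
      H2.map t.Lam.toContinuousLinearMap (obsOp (adjoint (T₁ * T₂)) hT (adjoint T₁ x)) := by
  refine H2.ext fun n => ?_
  have h2 := ht.left_apply (apply_pow_apply _ n x)
    (pow_adjoint_apply_comm (commute_adjoint_mul_left hcomm) n x)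
  exact (t.adjoint_M₁_apply _ n).trans h2

theorem adjoint_M₂_map_obsOp {t : PreAndoTuple (adjoint (T₁ * T₂))} (ht : t.IsTypeI T₁ T₂)
    (hT : ‖adjoint (T₁ * T₂)‖ ≤ 1) (x : H) :
    adjoint t.M₂ (H2.map t.Lam.toContinuousLinearMap (obsOp (adjoint (T₁ * T₂)) hT x)) =
      H2.map t.Lam.toContinuousLinearMap (obsOp (adjoint (T₁ * T₂)) hT (adjoint T₂ x)) := by
  refine H2.ext fun n => ?_
  have h2 := ht.right_apply (apply_pow_apply _ n x)
    (pow_adjoint_apply_comm (commute_adjoint_mul_right hcomm) n x)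
  exact (t.adjoint_M₂_apply _ n).trans h2

/-- Both products of `V₁` and `V₂` are `M_z ⊕ W_D`. The intertwining relations split into the Type I
equations on `H²(ℱ)` and the case `n = 0` of the relation defining `W_{♭j}`. -/
theorem isAndoLift_douglasLift {t : PreAndoTuple (adjoint (T₁ * T₂))} (ht : t.IsTypeI T₁ T₂) :
    IsAndoLift T₁ T₂ (douglasLift T₁ T₂ h₁ h₂ t) where
  isometry_emb := isometry_of_norm (norm_douglasLift_emb h₁ h₂ t)
  isometry_V₁ := isometry_of_norm
    (norm_blockDiag t.norm_M₁ (norm_canonicalUnitary_left hcomm h₁ h₂))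
  isometry_V₂ := isometry_of_norm
    (norm_blockDiag t.norm_M₂ (norm_canonicalUnitary_right hcomm h₁ h₂))
  comm := by
    refine ContinuousLinearMap.ext fun x => ?_
    obtain ⟨f, q, rfl⟩ := exists_eq_douglasMk h₁ h₂ t x
    rw [mul_apply_eq_comp, mul_apply_eq_comp, douglasLift_V₁_apply, douglasLift_V₂_apply,
      douglasLift_V₁_apply, douglasLift_V₂_apply, t.M₁_M₂, t.M₂_M₁,
      canonicalUnitary_apply_apply hcomm h₁ h₂, canonicalUnitary_apply_apply' hcomm h₁ h₂]
  intertwine₁ := by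
    refine ContinuousLinearMap.ext fun x => ?_
    rw [comp_apply, comp_apply, douglasLift_emb_apply, douglasLift_emb_apply,
      adjoint_douglasLift_V₁_apply, adjoint_M₁_map_obsOp hcomm ht]
    have h := adjoint_canonicalUnitary_left hcomm h₁ h₂ 0 x
    rw [pow_zero, one_apply_eq_self, one_apply_eq_self] at h
    rw [h]
  intertwine₂ := by
    refine ContinuousLinearMap.ext fun x => ?_
    rw [comp_apply, comp_apply, douglasLift_emb_apply, douglasLift_emb_apply,
      adjoint_douglasLift_V₂_apply, adjoint_M₂_map_obsOp hcomm ht]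
    have h := adjoint_canonicalUnitary_right hcomm h₁ h₂ 0 x
    rw [pow_zero, one_apply_eq_self, one_apply_eq_self] at h
    rw [h]

end Douglas

/-! ### Unitary equivalence of models -/

section Equivalence

variable {H : Type u} [NormedAddCommGroup H] [InnerProductSpace ℂ H] [CompleteSpace H]

theorem unitarilyEquivalent_of_surjective {L L' : LiftTriple H} (A : L.K →L[ℂ] L'.K)
    (hn : ∀ k, ‖A k‖ = ‖k‖) (hs : Function.Surjective A) (h0 : ∀ h, A (L.emb h) = L'.emb h)
    (h1 : ∀ k, A (L.V₁ k) = L'.V₁ (A k)) (h2 : ∀ k, A (L.V₂ k) = L'.V₂ (A k)) :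
    UnitarilyEquivalent L L' :=
  ⟨LinearIsometryEquiv.ofSurjective ⟨A.toLinearMap, hn⟩ hs, h0, h1, h2⟩

theorem adjoint_apply_of_equiv {K K' : Type*} [NormedAddCommGroup K] [InnerProductSpace ℂ K]
    [CompleteSpace K] [NormedAddCommGroup K'] [InnerProductSpace ℂ K'] [CompleteSpace K']
    (τ : K ≃ₗᵢ[ℂ] K') {V : K →L[ℂ] K} {V' : K' →L[ℂ] K'} (h : ∀ k, τ (V k) = V' (τ k)) (k : K) :
    τ (adjoint V k) = adjoint V' (τ k) := by
  refine ext_inner_right ℂ fun y => ?_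
  rw [adjoint_inner_left]
  obtain ⟨x, rfl⟩ := τ.surjective y
  rw [← h, τ.inner_map_map, τ.inner_map_map, adjoint_inner_left]

theorem UnitarilyEquivalent.isAndoLift {T₁ T₂ : H →L[ℂ] H} {L L' : LiftTriple H}
    (h : UnitarilyEquivalent L L') (hL : IsAndoLift T₁ T₂ L) : IsAndoLift T₁ T₂ L' := by
  obtain ⟨τ, h0, h1, h2⟩ := h
  refine ⟨isometry_of_norm fun x => ?_, isometry_of_norm fun y => ?_, isometry_of_norm fun y => ?_,
    ContinuousLinearMap.ext fun y => ?_, ContinuousLinearMap.ext fun x => ?_,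
    ContinuousLinearMap.ext fun x => ?_⟩
  · rw [← h0, τ.norm_map, norm_of_isometry hL.isometry_emb]
  · obtain ⟨x, rfl⟩ := τ.surjective y
    rw [← h1, τ.norm_map, τ.norm_map, norm_of_isometry hL.isometry_V₁]
  · obtain ⟨x, rfl⟩ := τ.surjective y
    rw [← h2, τ.norm_map, τ.norm_map, norm_of_isometry hL.isometry_V₂]
  · obtain ⟨x, rfl⟩ := τ.surjective y
    have h3 : L.V₁ (L.V₂ x) = L.V₂ (L.V₁ x) :=
      congrArg (fun A : L.K →L[ℂ] L.K => A x) hL.comm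
    rw [mul_apply_eq_comp, mul_apply_eq_comp, ← h2, ← h1, ← h1, ← h2, h3]
  · have h3 : adjoint L.V₁ (L.emb x) = L.emb (adjoint T₁ x) :=
      congrArg (fun A : H →L[ℂ] L.K => A x) hL.intertwine₁
    rw [comp_apply, comp_apply, ← h0, ← h0, ← adjoint_apply_of_equiv τ h1, h3]
  · have h3 : adjoint L.V₂ (L.emb x) = L.emb (adjoint T₂ x) :=
      congrArg (fun A : H →L[ℂ] L.K => A x) hL.intertwine₂
    rw [comp_apply, comp_apply, ← h0, ← h0, ← adjoint_apply_of_equiv τ h2, h3]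

end Equivalence

/-! ### Low coefficients in `H²(F)` -/

section Hardy

variable {F : Type*} [NormedAddCommGroup F] [InnerProductSpace ℂ F]

theorem H2.norm_single (n : ℕ) (x : F) : ‖H2.single n x‖ = ‖x‖ := by
  rw [H2.single_eq]
  exact lp.norm_single (E := fun _ : ℕ => F) (p := 2) (by norm_num) n x

theorem H2.eq_single_zero {f : H2 F} (h : H2.backShift f = 0) : f = H2.single 0 (f 0) := by
  refine H2.ext fun n => ?_
  rcases n with _ | n
  · rw [H2.single_apply_self]
  · rw [H2.single_apply_ne n.succ_ne_zero, ← H2.backShift_apply, h]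
    rfl

theorem H2.add_apply (f g : H2 F) (n : ℕ) : (f + g) n = f n + g n := rfl

theorem H2.single_add_shift_injective {a b a' b' : F}
    (h : H2.single 0 a + H2.shift (H2.single 0 b) = H2.single 0 a' + H2.shift (H2.single 0 b')) :
    a = a' ∧ b = b' := by
  constructor
  · have h4 := congrArg (fun f : H2 F => f 0) h
    simpa only [H2.add_apply, H2.shift_zero, H2.single_apply_self, add_zero] using h4
  · have h4 := congrArg (fun f : H2 F => f 1) h
    simpa only [H2.add_apply, H2.shift_succ, H2.single_apply_self, H2.single_apply_ne one_ne_zero,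
      zero_add] using h4

theorem H2.shift_map {G : Type*} [NormedAddCommGroup G] [InnerProductSpace ℂ G] (A : F →L[ℂ] G)
    (f : H2 F) (n : ℕ) : H2.shift (H2.map A f) n = A (H2.shift f n) := by
  rcases n with _ | n
  · rw [H2.shift_zero, H2.shift_zero, map_zero]
  · rfl

end Hardy

/-! ### Gluing isometries and recovering `P` and `U` from `U*P` and `U*Pᗮ` -/

section Generic

variable {E F K K' : Type*} [NormedAddCommGroup E] [InnerProductSpace ℂ E] [CompleteSpace E]
  [NormedAddCommGroup F] [InnerProductSpace ℂ F] [CompleteSpace F]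
  [NormedAddCommGroup K] [InnerProductSpace ℂ K] [CompleteSpace K]
  [NormedAddCommGroup K'] [InnerProductSpace ℂ K'] [CompleteSpace K']

/-- An orthogonal decomposition `K = E ⊕ F` and a pair of isometries of `E` and `F` with orthogonal
ranges in `K'` give an isometry from `K` to `K'`. -/
theorem exists_isometry_of_sum {a : E →L[ℂ] K} {b : F →L[ℂ] K} {a' : E →L[ℂ] K'} {b' : F →L[ℂ] K'}
    (h : ∀ x y, ‖a x + b y‖ ^ 2 = ‖x‖ ^ 2 + ‖y‖ ^ 2)
    (h' : ∀ x y, ‖a' x + b' y‖ ^ 2 = ‖x‖ ^ 2 + ‖y‖ ^ 2) (hs : ∀ k, ∃ x y, k = a x + b y) :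
    ∃ B : K →L[ℂ] K', (∀ k, ‖B k‖ = ‖k‖) ∧ (∀ x, B (a x) = a' x) ∧ ∀ y, B (b y) = b' y := by
  let J : WithLp 2 (E × F) →L[ℂ] K :=
    (a.coprod b) ∘L (WithLp.prodContinuousLinearEquiv 2 ℂ E F).toContinuousLinearMap
  let J' : WithLp 2 (E × F) →L[ℂ] K' :=
    (a'.coprod b') ∘L (WithLp.prodContinuousLinearEquiv 2 ℂ E F).toContinuousLinearMap
  have hJ : ∀ x, J x = a x.fst + b x.snd := fun x => rfl
  have hJ' : ∀ x, J' x = a' x.fst + b' x.snd := fun x => rfl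
  have hJn : ∀ x, ‖J x‖ = ‖x‖ := fun x => by
    rw [← sq_eq_sq₀ (norm_nonneg _) (norm_nonneg _), hJ, h, WithLp.prod_norm_sq_eq_of_L2]
  have hJn' : ∀ x, ‖J' x‖ = ‖x‖ := fun x => by
    rw [← sq_eq_sq₀ (norm_nonneg _) (norm_nonneg _), hJ', h', WithLp.prod_norm_sq_eq_of_L2]
  have hJs : Function.Surjective J := fun k => by
    obtain ⟨x, y, rfl⟩ := hs k
    exact ⟨WithLp.toLp 2 (x, y), rfl⟩
  refine ⟨J' ∘L adjoint J, fun k => ?_, fun x => ?_, fun y => ?_⟩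
  · rw [comp_apply, hJn', norm_adjoint_apply_of_surjective hJn hJs]
  · have e : a x = J (WithLp.toLp 2 (x, 0)) := by
      rw [hJ, WithLp.toLp_fst, WithLp.toLp_snd, map_zero, add_zero]
    rw [comp_apply, e, adjoint_apply_apply_of_norm hJn, hJ', WithLp.toLp_fst, WithLp.toLp_snd,
      map_zero, add_zero]
  · have e : b y = J (WithLp.toLp 2 (0, y)) := by
      rw [hJ, WithLp.toLp_fst, WithLp.toLp_snd, map_zero, zero_add]
    rw [comp_apply, e, adjoint_apply_apply_of_norm hJn, hJ', WithLp.toLp_fst, WithLp.toLp_snd,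
      map_zero, zero_add]

/-- `W` plays the role of `U*`. Adding `h1` and `h2` shows that `ω` intertwines `W` with `W'`, hence
`U` with `U'`; cancelling `W'` in `h2` then gives the relation for `P`. -/
theorem intertwine_of_adjoint_mul {P U W : E →L[ℂ] E} {P' U' W' : F →L[ℂ] F} (ω : E →ₗ[ℂ] F)
    (hU : ∀ x, W (U x) = x) (hW : ∀ x, U (W x) = x) (hW' : ∀ x, U' (W' x) = x)
    (h1 : ∀ x, ω (W (x - P x)) = W' (ω x - P' (ω x))) (h2 : ∀ x, ω (W (P x)) = W' (P' (ω x))) :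
    (∀ x, ω (P x) = P' (ω x)) ∧ ∀ x, ω (U x) = U' (ω x) := by
  have h3 : ∀ x, ω (U x) = U' (ω x) := fun x => by
    have h4 := ω.map_add (W (U x - P (U x))) (W (P (U x)))
    rw [← map_add W, sub_add_cancel, hU, h1, h2, ← map_add W', sub_add_cancel] at h4
    rw [h4, hW']
  refine ⟨fun x => ?_, h3⟩
  have h := h3 (W (P x))
  rwa [hW, h2, hW'] at h

end Generic

/-! ### Models of a tuple: uniqueness and minimality -/

section Model

variable {H : Type u} [NormedAddCommGroup H] [InnerProductSpace ℂ H] [CompleteSpace H]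
  {T₁ T₂ : H →L[ℂ] H}

theorem PreAndoTuple.M₁_single {S : H →L[ℂ] H} (t : PreAndoTuple S) (x : t.F) :
    t.M₁ (H2.single 0 x) =
      H2.single 0 (adjoint t.U (x - t.P x)) + H2.shift (H2.single 0 (adjoint t.U (t.P x))) := by
  refine H2.ext fun n => ?_
  rw [t.M₁_apply, H2.shift_single, H2.shift_single, lp.coeFn_add, Pi.add_apply]
  rcases n with _ | _ | n
  · simp [H2.single_apply_ne]
  · simp [H2.single_apply_ne]
  · simp [H2.single_apply_ne]

/-- The function `∑ zⁿ Λ D_{T*} T*ⁿ h` in `H²(ℱ)`. -/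
noncomputable def PreAndoTuple.obs {S : H →L[ℂ] H} (t : PreAndoTuple S) (hS : ‖S‖ ≤ 1) :
    H →L[ℂ] H2 t.F := H2.map t.Lam.toContinuousLinearMap ∘L obsOp S hS

theorem PreAndoTuple.obs_apply {S : H →L[ℂ] H} (t : PreAndoTuple S) (hS : ‖S‖ ≤ 1) (x : H)
    (n : ℕ) : t.obs hS x n = t.Lam (defectMap S ((S ^ n) x)) := rfl

/-- Coefficient `n + 1` at `x` equals coefficient `n` at `Sx`, so only the constant term survives.
This is how `Λ` is recovered from the embedding. -/
theorem PreAndoTuple.obs_sub_shift {S : H →L[ℂ] H} (t : PreAndoTuple S) (hS : ‖S‖ ≤ 1) (x : H) :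
    t.obs hS x - H2.shift (t.obs hS (S x)) = H2.single 0 (t.Lam (defectMap S x)) := by
  refine H2.ext fun n => ?_
  rw [lp.coeFn_sub, Pi.sub_apply]
  rcases n with _ | n
  · rw [H2.shift_zero, H2.single_apply_self, sub_zero]
    rfl
  · rw [H2.shift_succ, H2.single_apply_ne n.succ_ne_zero, t.obs_apply, t.obs_apply, pow_succ,
      mul_apply_eq_comp, sub_self]

/-- A decomposition of the space of a triple as `H²(ℱ) ⊕ 𝒬_{T*}` in which the triple is the
Douglas model of the tuple `t`. -/
structure ModelData (hT : ‖adjoint (T₁ * T₂)‖ ≤ 1) (t : PreAndoTuple (adjoint (T₁ * T₂)))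
    (L : LiftTriple H) where
  inl : H2 t.F →L[ℂ] L.K
  inr : ResSpace (T₁ * T₂) →L[ℂ] L.K
  inner_eq : ∀ f q g r, Inner.inner ℂ (inl f + inr q) (inl g + inr r) =
    Inner.inner ℂ f g + Inner.inner ℂ q r
  exists_eq : ∀ k, ∃ f q, k = inl f + inr q
  emb_apply : ∀ x, L.emb x = inl (t.obs hT x) + inr (resMap (T₁ * T₂) x)
  V₁_inl : ∀ f, L.V₁ (inl f) = inl (t.M₁ f)
  V₂_inl : ∀ f, L.V₂ (inl f) = inl (t.M₂ f)
  V₁_inr : ∀ q, L.V₁ (inr q) = inr (canonicalUnitary (T₁ * T₂) T₁ q)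
  V₂_inr : ∀ q, L.V₂ (inr q) = inr (canonicalUnitary (T₁ * T₂) T₂ q)

namespace ModelData

variable {hT : ‖adjoint (T₁ * T₂)‖ ≤ 1} {t t' : PreAndoTuple (adjoint (T₁ * T₂))}
  {L L' : LiftTriple H} (m : ModelData hT t L) (m' : ModelData hT t' L')

theorem norm_sq (f : H2 t.F) (q : ResSpace (T₁ * T₂)) :
    ‖m.inl f + m.inr q‖ ^ 2 = ‖f‖ ^ 2 + ‖q‖ ^ 2 := by
  have h := congrArg Complex.re (m.inner_eq f q f q)
  rw [Complex.add_re] at h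
  rw [← inner_self_eq_norm_sq (𝕜 := ℂ), ← inner_self_eq_norm_sq (𝕜 := ℂ),
    ← inner_self_eq_norm_sq (𝕜 := ℂ)]
  exact h

theorem norm_inl (f : H2 t.F) : ‖m.inl f‖ = ‖f‖ := by
  have h := m.norm_sq f 0
  rw [map_zero, add_zero, norm_zero, zero_pow two_ne_zero, add_zero] at h
  exact (sq_eq_sq₀ (norm_nonneg _) (norm_nonneg _)).1 h

theorem inner_inl_left (f g : H2 t.F) (r : ResSpace (T₁ * T₂)) :
    Inner.inner ℂ (m.inl f) (m.inl g + m.inr r) = Inner.inner ℂ f g := by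
  have h := m.inner_eq f 0 g r
  rwa [map_zero, add_zero, inner_zero_left, add_zero] at h

/-- The wandering subspace `ℱ`. -/
noncomputable def wander : t.F →L[ℂ] L.K := m.inl ∘L H2.single 0

theorem wander_apply (x : t.F) : m.wander x = m.inl (H2.single 0 x) := rfl

theorem norm_wander (x : t.F) : ‖m.wander x‖ = ‖x‖ :=
  (m.norm_inl _).trans (H2.norm_single 0 x)

theorem wander_injective : Function.Injective m.wander :=
  (isometry_of_norm m.norm_wander).injective

theorem V₁_V₂_inl (f : H2 t.F) : L.V₁ (L.V₂ (m.inl f)) = m.inl (H2.shift f) := by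
  rw [m.V₂_inl, m.V₁_inl, t.M₁_M₂]

theorem V₁_wander (x : t.F) : L.V₁ (m.wander x) =
    m.wander (adjoint t.U (x - t.P x)) + L.V₁ (L.V₂ (m.wander (adjoint t.U (t.P x)))) := by
  simp only [wander_apply, V₁_V₂_inl, m.V₁_inl, t.M₁_single, map_add]

theorem wander_add_injective {a b a' b' : t.F}
    (h : m.wander a + L.V₁ (L.V₂ (m.wander b)) = m.wander a' + L.V₁ (L.V₂ (m.wander b'))) :
    a = a' ∧ b = b' := by
  rw [wander_apply, wander_apply, wander_apply, wander_apply, V₁_V₂_inl, V₁_V₂_inl, ← map_add,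
    ← map_add] at h
  exact H2.single_add_shift_injective ((isometry_of_norm m.norm_inl).injective h)

/-- The operator `f ⊕ q ↦ (A f) ⊕ q` between two models. -/
theorem exists_operator (A : H2 t.F →L[ℂ] H2 t'.F) (hA : ∀ f, ‖A f‖ = ‖f‖) :
    ∃ B : L.K →L[ℂ] L'.K, (∀ k, ‖B k‖ = ‖k‖) ∧
      (∀ f, B (m.inl f) = m'.inl (A f)) ∧ ∀ q, B (m.inr q) = m'.inr q :=
  exists_isometry_of_sum m.norm_sq
    (a' := m'.inl ∘L A) (fun f q => by rw [comp_apply, m'.norm_sq, hA]) m.exists_eq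

include m m' in
-- The equivalence is `(I ⊗ ω) ⊕ I`: the residual summand does not depend on the tuple.
theorem unitarilyEquivalent_of_coincide (h : t.Coincide t') : UnitarilyEquivalent L L' := by
  obtain ⟨ω, hL, hP, hU⟩ := h
  have hU' : ∀ x, ω (adjoint t.U x) = adjoint t'.U (ω x) := adjoint_apply_of_equiv ω hU
  let Ω : t.F →L[ℂ] t'.F := ω.toLinearIsometry.toContinuousLinearMap
  have hΩ : ∀ x, Ω x = ω x := fun x => rfl
  obtain ⟨B, hBn, hBl, hBr⟩ := m.exists_operator m' (H2.map Ω) (H2.norm_map ω.norm_map)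
  have hM₁ : ∀ f, H2.map Ω (t.M₁ f) = t'.M₁ (H2.map Ω f) := fun f => H2.ext fun n => by
    simp only [H2.map_apply, t.M₁_apply, t'.M₁_apply, H2.shift_map, hΩ, map_add,
      hU', map_sub, hP]
  have hM₂ : ∀ f, H2.map Ω (t.M₂ f) = t'.M₂ (H2.map Ω f) := fun f => H2.ext fun n => by
    simp only [H2.map_apply, t.M₂_apply, t'.M₂_apply, H2.shift_map, hΩ, map_add,
      map_sub, hP, hU]
  refine unitarilyEquivalent_of_surjective B hBn (fun k => ?_) (fun x => ?_) (fun k => ?_)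
    (fun k => ?_)
  · obtain ⟨f, q, rfl⟩ := m'.exists_eq k
    refine ⟨m.inl (H2.map ω.symm.toLinearIsometry.toContinuousLinearMap f) + m.inr q, ?_⟩
    simp only [map_add, hBl, hBr]
    congr 2
    exact H2.ext fun n => ω.apply_symm_apply (f n)
  · simp only [m.emb_apply, m'.emb_apply, map_add, hBl, hBr]
    congr 2
    exact H2.ext fun n => hL _
  · obtain ⟨f, q, rfl⟩ := m.exists_eq k
    simp only [map_add, m.V₁_inl, m.V₁_inr, hBl, hBr, m'.V₁_inl, m'.V₁_inr, hM₁]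
  · obtain ⟨f, q, rfl⟩ := m.exists_eq k
    simp only [map_add, m.V₂_inl, m.V₂_inr, hBl, hBr, m'.V₂_inl, m'.V₂_inr, hM₂]

/-- By `hE` the copy of `ΛD_{T*}x` is built from `Π` and `V₁V₂`; density of `Ran D_{T*}` does the
rest. -/
theorem wander_Lam_mem_of (hE : ∀ x, L.emb x - L.V₁ (L.V₂ (L.emb (adjoint (T₁ * T₂) x))) =
    m.wander (t.Lam (defectMap (adjoint (T₁ * T₂)) x))) {N : Submodule ℂ L.K}
    (hN : IsClosed (N : Set L.K)) (hemb : ∀ h, L.emb h ∈ N) (hV₁ : ∀ k ∈ N, L.V₁ k ∈ N)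
    (hV₂ : ∀ k ∈ N, L.V₂ k ∈ N) (x : defectSpace (adjoint (T₁ * T₂))) :
    m.wander (t.Lam x) ∈ N := by
  refine (denseRange_defectMap (adjoint (T₁ * T₂))).induction
    (P := fun x => m.wander (t.Lam x) ∈ N) ?_ (hN.preimage
      (m.wander.continuous.comp t.Lam.continuous)) x
  rintro _ ⟨x, rfl⟩
  rw [← hE]
  exact N.sub_mem (hemb x) (hV₁ _ (hV₂ _ (hemb _)))

/-- The projection onto `H²(ℱ)`. -/
noncomputable def proj : L.K →L[ℂ] H2 t.F := adjoint m.inl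

theorem proj_apply (f : H2 t.F) (q : ResSpace (T₁ * T₂)) : m.proj (m.inl f + m.inr q) = f :=
  ext_inner_left ℂ fun g => by rw [proj, adjoint_inner_right, m.inner_inl_left]

theorem proj_emb (x : H) : m.proj (L.emb x) = t.obs hT x := by rw [m.emb_apply, m.proj_apply]

theorem proj_V₁ (k : L.K) : m.proj (L.V₁ k) = t.M₁ (m.proj k) := by
  obtain ⟨f, q, rfl⟩ := m.exists_eq k
  rw [m.proj_apply, map_add, m.V₁_inl, m.V₁_inr, m.proj_apply]

theorem proj_V₂ (k : L.K) : m.proj (L.V₂ k) = t.M₂ (m.proj k) := by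
  obtain ⟨f, q, rfl⟩ := m.exists_eq k
  rw [m.proj_apply, map_add, m.V₂_inl, m.V₂_inr, m.proj_apply]

theorem surjective_proj : Function.Surjective m.proj := fun f => ⟨_, m.proj_apply f 0⟩

include m in
/-- The tuple of a minimal triple is minimal. -/
theorem isMinimal_tuple (h : L.IsMinimal) : t.IsMinimal := by
  intro N hN hR hM₁ hM₂
  have hmem : ∀ k, k ∈ N.comap m.proj.toLinearMap ↔ m.proj k ∈ N := fun k => Iff.rfl
  -- The projection onto `H²(ℱ)` intertwines `V_j` with `M_j`, so the preimage of `N` is invariant.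
  -- It contains `Ran Π` because the coefficients of `∑ zⁿΛD_{T*}T*ⁿx` lie in `Ran Λ`.
  have htop := h (N.comap m.proj.toLinearMap) (hN.preimage m.proj.continuous)
    (fun x => (hmem _).2 (by rw [m.proj_emb]; exact hR _ fun n => ⟨_, rfl⟩))
    (fun k hk => (hmem _).2 (by rw [m.proj_V₁]; exact hM₁ _ hk))
    (fun k hk => (hmem _).2 (by rw [m.proj_V₂]; exact hM₂ _ hk))
  rw [Submodule.eq_top_iff']
  intro f
  obtain ⟨k, rfl⟩ := m.surjective_proj f
  rw [← hmem, htop]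
  trivial

variable (hcomm : T₁ * T₂ = T₂ * T₁) (h₁ : ‖T₁‖ ≤ 1) (h₂ : ‖T₂‖ ≤ 1)
include hcomm h₁ h₂

theorem V₁_V₂_inr (q : ResSpace (T₁ * T₂)) :
    L.V₁ (L.V₂ (m.inr q)) = m.inr (resUnitary (T₁ * T₂) q) := by
  rw [m.V₂_inr, m.V₁_inr, canonicalUnitary_apply_apply hcomm h₁ h₂]

theorem inner_wander_eq_zero (x : t.F) (k : L.K) :
    Inner.inner ℂ (m.wander x) (L.V₁ (L.V₂ k)) = 0 := by
  obtain ⟨f, q, rfl⟩ := m.exists_eq k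
  rw [map_add, map_add, m.V₁_V₂_inl, m.V₁_V₂_inr hcomm h₁ h₂, wander_apply, m.inner_inl_left,
    ← inner_conj_symm, H2.inner_shift_left, H2.backShift_single_zero, inner_zero_right, map_zero]

/-- With `inner_wander_eq_zero` this identifies the copy of `ℱ` with `(Ran V₁V₂)ᗮ`, which no longer
refers to the model. For `k = f ⊕ q`, testing against `M_zM_z*f` kills all but the constant term of
`f`, and testing against `W_DW_D*q = q` kills `q`. -/
theorem exists_eq_wander {k : L.K} (hk : ∀ k', Inner.inner ℂ k (L.V₁ (L.V₂ k')) = 0) :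
    ∃ x, k = m.wander x := by
  obtain ⟨f, q, rfl⟩ := m.exists_eq k
  have hk' : ∀ g r, Inner.inner ℂ f (H2.shift g) +
      Inner.inner ℂ q (resUnitary (T₁ * T₂) r) = 0 := fun g r => by
    rw [← m.inner_eq, ← m.V₁_V₂_inl, ← m.V₁_V₂_inr hcomm h₁ h₂, ← map_add, ← map_add, hk]
  have hf : H2.backShift f = 0 := by
    have h := hk' (H2.backShift f) 0
    rw [map_zero, inner_zero_right, add_zero, ← inner_conj_symm, H2.inner_shift_left,
      map_eq_zero] at h
    exact inner_self_eq_zero.1 h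
  have hq : q = 0 := by
    have h := hk' 0 (resUnitaryAdj (T₁ * T₂) q)
    rw [map_zero, inner_zero_right, zero_add,
      resUnitary_resUnitaryAdj (norm_mul_le_one h₁ h₂)] at h
    exact inner_self_eq_zero.1 h
  exact ⟨f 0, by rw [wander_apply, ← H2.eq_single_zero hf, hq, map_zero, add_zero]⟩

/-- The residual parts cancel since `W_DQ_{T*}T* = Q_{T*}`; the pure parts leave the constant term.
-/
theorem emb_sub (x : H) : L.emb x - L.V₁ (L.V₂ (L.emb (adjoint (T₁ * T₂) x))) =
    m.wander (t.Lam (defectMap (adjoint (T₁ * T₂)) x)) := by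
  rw [m.emb_apply, m.emb_apply, map_add, map_add, m.V₁_V₂_inl, m.V₁_V₂_inr hcomm h₁ h₂,
    resUnitary_resMap_adjoint (norm_mul_le_one h₁ h₂), add_sub_add_right_eq_sub, ← map_sub,
    t.obs_sub_shift, wander_apply]

theorem exists_map_wander (τ : L.K ≃ₗᵢ[ℂ] L'.K) (hV₁ : ∀ k, τ (L.V₁ k) = L'.V₁ (τ k))
    (hV₂ : ∀ k, τ (L.V₂ k) = L'.V₂ (τ k)) (x : t.F) :
    ∃ y, τ (m.wander x) = m'.wander y :=
  m'.exists_eq_wander hcomm h₁ h₂ fun k' => by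
    obtain ⟨k, rfl⟩ := τ.surjective k'
    rw [← hV₂, ← hV₁, τ.inner_map_map, m.inner_wander_eq_zero hcomm h₁ h₂]

include m m' in
-- `ω` is the restriction of `τ` to the spaces `(Ran V₁V₂)ᗮ`, which `τ` and its inverse preserve.
theorem coincide_of_unitarilyEquivalent (h : UnitarilyEquivalent L L') : t.Coincide t' := by
  obtain ⟨τ, h0, hV₁, hV₂⟩ := h
  choose w hw using m.exists_map_wander m' hcomm h₁ h₂ τ hV₁ hV₂
  have hinj : ∀ {y y' : t'.F}, m'.wander y = m'.wander y' → y = y' :=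
    fun {y y'} e => m'.wander_injective e
  let ω₀ : t.F →ₗᵢ[ℂ] t'.F :=
    { toFun := w
      map_add' := fun x y => hinj (by rw [map_add, ← hw, ← hw, ← hw, map_add, map_add])
      map_smul' := fun c x => hinj (by
        rw [RingHom.id_apply, map_smul, ← hw, ← hw, map_smul, map_smul])
      norm_map' := fun x => by
        change ‖w x‖ = ‖x‖
        rw [← m'.norm_wander, ← hw, τ.norm_map, m.norm_wander] }
  have hω : ∀ x, ω₀ x = w x := fun x => rfl
  have hs : Function.Surjective ω₀ := fun y => by
    have hV₁' : ∀ k, τ.symm (L'.V₁ k) = L.V₁ (τ.symm k) := fun k =>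
      τ.injective (by rw [hV₁, τ.apply_symm_apply, τ.apply_symm_apply])
    have hV₂' : ∀ k, τ.symm (L'.V₂ k) = L.V₂ (τ.symm k) := fun k =>
      τ.injective (by rw [hV₂, τ.apply_symm_apply, τ.apply_symm_apply])
    obtain ⟨x, hx⟩ := m'.exists_map_wander m hcomm h₁ h₂ τ.symm hV₁' hV₂' y
    exact ⟨x, hinj (by rw [hω, ← hw, ← hx, τ.apply_symm_apply])⟩
  -- Apply `τ` to `V₁x = U*Pᗮx + V₁V₂U*Px` and compare constant and linear coefficients on the other
  -- side.
  have hM : ∀ x, w (adjoint t.U (x - t.P x)) = adjoint t'.U (w x - t'.P (w x)) ∧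
      w (adjoint t.U (t.P x)) = adjoint t'.U (t'.P (w x)) := fun x => by
    have h := congrArg τ (m.V₁_wander x)
    simp only [map_add, hV₁, hV₂, hw, m'.V₁_wander] at h
    exact m'.wander_add_injective h.symm
  have hadd : ∀ x y, w (x + y) = w x + w y := ω₀.map_add
  have hPU := intertwine_of_adjoint_mul ω₀.toLinearMap t.adjoint_U_U t.U_adjoint_U t'.U_adjoint_U
    (fun x => (hM x).1) (fun x => (hM x).2)
  refine ⟨LinearIsometryEquiv.ofSurjective ω₀ hs, fun x => ?_, hPU.1, hPU.2⟩
  -- On the dense range of `D_{T*}`, `Λ` is expressed by `Π` and `V₁V₂`, all of which `τ` respects.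
  · refine (denseRange_defectMap (adjoint (T₁ * T₂))).induction
      (P := fun x => ω₀ (t.Lam x) = t'.Lam x) ?_ (isClosed_eq
        (ω₀.continuous.comp t.Lam.continuous) t'.Lam.continuous) x
    rintro _ ⟨x, rfl⟩
    refine hinj ?_
    rw [hω, ← hw, ← m.emb_sub hcomm h₁ h₂, ← m'.emb_sub hcomm h₁ h₂, map_sub, hV₁, hV₂, h0, h0]
include m in
/-- The triple of a minimal tuple is minimal. -/
theorem isMinimal_triple (ht : t.IsMinimal) : L.IsMinimal := by
  intro N hN hemb hV₁ hV₂
  have hw := m.wander_Lam_mem_of (m.emb_sub hcomm h₁ h₂) hN hemb hV₁ hV₂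
  -- `V₁V₂` acts on the pure part as `M_z`, so it produces all monomials from the constants.
  have hs : ∀ n x, m.inl (H2.single n (t.Lam x)) ∈ N := fun n x => by
    induction n with
    | zero => exact hw x
    | succ n ih =>
      have h := hV₁ _ (hV₂ _ ih)
      rwa [m.V₁_V₂_inl, H2.shift_single] at h
  let N₁ : Submodule ℂ (H2 t.F) := N.comap m.inl.toLinearMap
  have hN₁mem : ∀ f, f ∈ N₁ ↔ m.inl f ∈ N := fun f => Iff.rfl
  have hN₁ : IsClosed (N₁ : Set (H2 t.F)) := hN.preimage m.inl.continuous
  have hR : ∀ f : H2 t.F, (∀ n, f n ∈ Set.range t.Lam) → f ∈ N₁ := fun f hf =>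
    H2.mem_of_single_mem hN₁ fun n => by
      obtain ⟨x, hx⟩ := hf n
      rw [← hx]
      exact hs n x
  have hN₁top : N₁ = ⊤ := ht N₁ hN₁ hR
    (fun f hf => by
      rw [hN₁mem, ← m.V₁_inl]
      exact hV₁ _ hf)
    (fun f hf => by
      rw [hN₁mem, ← m.V₂_inl]
      exact hV₂ _ hf)
  have hl : ∀ f, m.inl f ∈ N := fun f => by rw [← hN₁mem, hN₁top]; trivial
  let N₂ : Submodule ℂ (ResSpace (T₁ * T₂)) := N.comap m.inr.toLinearMap
  have hN₂mem : ∀ f, f ∈ N₂ ↔ m.inr f ∈ N := fun f => Iff.rfl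
  -- Once `H²(ℱ)` lies in `N`, so does the residual part `Q_{T*}x` of `Πx`; minimality of the
  -- unitary extension fills `𝒬_{T*}`.
  have hN₂top : N₂ = ⊤ := eq_top_of_resUnitary_mem (norm_mul_le_one h₁ h₂)
    (hN.preimage m.inr.continuous)
    (fun x => by
      have h := hemb x
      rw [m.emb_apply] at h
      exact (N.add_mem_iff_right (hl _)).1 h)
    (fun q hq => by
      rw [hN₂mem, ← m.V₁_V₂_inr hcomm h₁ h₂]
      exact hV₁ _ (hV₂ _ hq))
  rw [Submodule.eq_top_iff']
  intro k
  obtain ⟨f, q, rfl⟩ := m.exists_eq k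
  exact N.add_mem (hl f) (by rw [← hN₂mem, hN₂top]; trivial)

end ModelData

end Model

/-! ### The Douglas model as a model of its tuple -/

section Douglas

variable {H : Type u} [NormedAddCommGroup H] [InnerProductSpace ℂ H] [CompleteSpace H]
  {T₁ T₂ : H →L[ℂ] H} (h₁ : ‖T₁‖ ≤ 1) (h₂ : ‖T₂‖ ≤ 1)

theorem toLp_eq_add {E F : Type*} [NormedAddCommGroup E] [NormedAddCommGroup F] (f : E) (q : F) :
    WithLp.toLp 2 (f, q) = WithLp.toLp 2 (f, (0 : F)) + WithLp.toLp 2 ((0 : E), q) := by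
  rw [← WithLp.toLp_add, Prod.mk_add_mk, add_zero, zero_add]

/-- The decomposition of the space of the Douglas model. -/
noncomputable def douglasModelData (t : PreAndoTuple (adjoint (T₁ * T₂))) :
    ModelData (norm_adjoint_mul_le_one h₁ h₂) t (douglasLift T₁ T₂ h₁ h₂ t) where
  inl := (WithLp.prodContinuousLinearEquiv 2 ℂ (H2 t.F)
    (ResSpace (T₁ * T₂))).symm.toContinuousLinearMap ∘L
    ContinuousLinearMap.inl ℂ (H2 t.F) (ResSpace (T₁ * T₂))
  inr := (WithLp.prodContinuousLinearEquiv 2 ℂ (H2 t.F)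
    (ResSpace (T₁ * T₂))).symm.toContinuousLinearMap ∘L
    ContinuousLinearMap.inr ℂ (H2 t.F) (ResSpace (T₁ * T₂))
  inner_eq f q g r := by
    have h := WithLp.prod_inner_apply (𝕜 := ℂ) (WithLp.toLp 2 (f, q)) (WithLp.toLp 2 (g, r))
    refine Eq.trans (congrArg₂ (Inner.inner ℂ) ?_ ?_) h
    · exact (toLp_eq_add f q).symm
    · exact (toLp_eq_add g r).symm
  exists_eq k := ⟨WithLp.fst (α := H2 t.F) (β := ResSpace (T₁ * T₂)) k,
    WithLp.snd (α := H2 t.F) k, toLp_eq_add _ _⟩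
  emb_apply x := toLp_eq_add _ _
  V₁_inl f := congrArg (fun q => WithLp.toLp 2 (t.M₁ f, q))
    (map_zero (canonicalUnitary (T₁ * T₂) T₁))
  V₂_inl f := congrArg (fun q => WithLp.toLp 2 (t.M₂ f, q))
    (map_zero (canonicalUnitary (T₁ * T₂) T₂))
  V₁_inr q := congrArg (fun f => WithLp.toLp 2 (f, canonicalUnitary (T₁ * T₂) T₁ q))
    (map_zero t.M₁)
  V₂_inr q := congrArg (fun f => WithLp.toLp 2 (f, canonicalUnitary (T₁ * T₂) T₂ q))
    (map_zero t.M₂)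

end Douglas

/-! ### The wandering subspace of a pair of commuting isometries -/

section Wandering

variable {K : Type u} [NormedAddCommGroup K] [InnerProductSpace ℂ K] [CompleteSpace K]
  {V₁ V₂ : K →L[ℂ] K}

/-- The wandering subspace `ker (V₁ V₂)*`. -/
noncomputable def wanderSpace (V₁ V₂ : K →L[ℂ] K) : Submodule ℂ K :=
  LinearMap.ker (adjoint (V₁ * V₂)).toLinearMap

instance (V₁ V₂ : K →L[ℂ] K) : CompleteSpace (wanderSpace V₁ V₂) :=
  inferInstanceAs (CompleteSpace (LinearMap.ker (adjoint (V₁ * V₂)).toLinearMap))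

theorem mem_wanderSpace {x : K} : x ∈ wanderSpace V₁ V₂ ↔ adjoint V₂ (adjoint V₁ x) = 0 := by
  rw [← adjoint_mul_apply]
  rfl

theorem inner_wanderSpace {x : K} (hx : x ∈ wanderSpace V₁ V₂) (y : K) :
    inner ℂ x (V₁ (V₂ y)) = 0 := by
  rw [← adjoint_inner_left, ← adjoint_inner_left, mem_wanderSpace.1 hx, inner_zero_left]

/-- The projection `V₂ V₂*`. -/
noncomputable def wanderP₀ (V₂ : K →L[ℂ] K) : K →L[ℂ] K := V₂ * adjoint V₂

/-- The operator `V₁* + V₂ - V₁ V₂ V₁*`. -/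
noncomputable def wanderU₀ (V₁ V₂ : K →L[ℂ] K) : K →L[ℂ] K :=
  adjoint V₁ + V₂ - V₁ * V₂ * adjoint V₁

theorem wanderP₀_apply (V₂ : K →L[ℂ] K) (x : K) : wanderP₀ V₂ x = V₂ (adjoint V₂ x) := rfl

theorem wanderU₀_apply (V₁ V₂ : K →L[ℂ] K) (x : K) :
    wanderU₀ V₁ V₂ x = adjoint V₁ x + V₂ x - V₁ (V₂ (adjoint V₁ x)) := rfl

variable (hV₁ : ∀ x, ‖V₁ x‖ = ‖x‖) (hV₂ : ∀ x, ‖V₂ x‖ = ‖x‖) (hc : V₁ * V₂ = V₂ * V₁)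
include hc

theorem apply_comm (x : K) : V₂ (V₁ x) = V₁ (V₂ x) :=
  (congrArg (fun A : K →L[ℂ] K => A x) hc).symm

theorem wanderSpace_comm : wanderSpace V₂ V₁ = wanderSpace V₁ V₂ := by
  rw [wanderSpace, wanderSpace, hc]

theorem adjoint_adjoint_of_mem {x : K} (hx : x ∈ wanderSpace V₁ V₂) :
    adjoint V₁ (adjoint V₂ x) = 0 := by
  rw [adjoint_adjoint_apply_comm hc, mem_wanderSpace.1 hx]

include hV₁ hV₂

theorem wanderP₀_mem {x : K} (hx : x ∈ wanderSpace V₁ V₂) :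
    wanderP₀ V₂ x ∈ wanderSpace V₁ V₂ := by
  rw [mem_wanderSpace, ← adjoint_adjoint_apply_comm hc, wanderP₀_apply,
    adjoint_apply_apply_of_norm hV₂, adjoint_adjoint_of_mem hc hx]

/-- The operator comes from two decompositions of the wandering space, `ker V₁* ⊕ V₁ ker V₂*` and
`ker V₂* ⊕ V₂ ker V₁*`: it sends `a + V₁b` to `b + V₂a` for `a ∈ ker V₁*`, `b ∈ ker V₂*`. -/
theorem wanderU₀_mem {x : K} (hx : x ∈ wanderSpace V₁ V₂) :
    wanderU₀ V₁ V₂ x ∈ wanderSpace V₁ V₂ := by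
  rw [mem_wanderSpace, wanderU₀_apply, map_sub, map_add, adjoint_apply_apply_of_norm hV₁, map_sub,
    map_add, adjoint_apply_apply_of_norm hV₂, ← adjoint_adjoint_apply_comm hc (V₂ x),
    adjoint_apply_apply_of_norm hV₂, ← adjoint_adjoint_apply_comm hc (adjoint V₁ x),
    mem_wanderSpace.1 hx, map_zero, zero_add, sub_self]

/-- Exchanging `V₁` and `V₂` reverses the correspondence `a + V₁b ↦ b + V₂a`. -/
theorem wanderU₀_wanderU₀ {x : K} (hx : x ∈ wanderSpace V₁ V₂) :
    wanderU₀ V₁ V₂ (wanderU₀ V₂ V₁ x) = x := by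
  have h1 : adjoint V₁ (wanderU₀ V₂ V₁ x) = x - V₂ (adjoint V₂ x) := by
    rw [wanderU₀_apply, map_sub, map_add, adjoint_adjoint_of_mem hc hx,
      adjoint_apply_apply_of_norm hV₁, apply_comm hc, adjoint_apply_apply_of_norm hV₁, zero_add]
  rw [wanderU₀_apply V₁ V₂, h1, wanderU₀_apply, map_sub, map_add, map_sub, map_sub]
  simp only [apply_comm hc]
  abel

/-- `P` projects onto `V₂ ker V₁*`, so it separates the two summands of `U = V₁* + V₂(I - V₁V₁*)`:
`PᗮU = V₁*`, and `PU` is the other one. -/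
theorem wanderU₀_sub_wanderP₀ {x : K} (hx : x ∈ wanderSpace V₁ V₂) :
    wanderU₀ V₁ V₂ x - wanderP₀ V₂ (wanderU₀ V₁ V₂ x) = adjoint V₁ x := by
  have h1 : adjoint V₂ (wanderU₀ V₁ V₂ x) = x - V₁ (adjoint V₁ x) := by
    rw [wanderU₀_apply, map_sub, map_add, mem_wanderSpace.1 hx,
      adjoint_apply_apply_of_norm hV₂, ← apply_comm hc, adjoint_apply_apply_of_norm hV₂, zero_add]
  rw [wanderP₀_apply, h1, map_sub, wanderU₀_apply, apply_comm hc]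
  abel

theorem wanderP₀_wanderU₀ {x : K} (hx : x ∈ wanderSpace V₁ V₂) :
    wanderP₀ V₂ (wanderU₀ V₁ V₂ x) = V₂ x - V₁ (V₂ (adjoint V₁ x)) := by
  have h := wanderU₀_sub_wanderP₀ hV₁ hV₂ hc hx
  have h2 : wanderP₀ V₂ (wanderU₀ V₁ V₂ x) = wanderU₀ V₁ V₂ x - adjoint V₁ x := by
    rw [← h, sub_sub_cancel]
  rw [h2, wanderU₀_apply]
  abel

omit hV₁ in
-- Here `U*P = V₂*`; with `U*Pᗮ = V₁(I - V₂V₂*)` this yields `V₁ = U*Pᗮ + V₁V₂U*P` on the wandering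
-- space.
theorem wanderU₀_wanderP₀ (x : K) : wanderU₀ V₂ V₁ (wanderP₀ V₂ x) = adjoint V₂ x := by
  rw [wanderP₀_apply, wanderU₀_apply, adjoint_apply_apply_of_norm hV₂, apply_comm hc]
  abel

omit hV₁ in
theorem wanderU₀_sub (x : K) :
    wanderU₀ V₂ V₁ (x - wanderP₀ V₂ x) = V₁ x - V₁ (V₂ (adjoint V₂ x)) := by
  rw [map_sub, wanderU₀_wanderP₀ hV₂ hc, wanderU₀_apply, apply_comm hc]
  abel

/-- The projection `P = V₂ V₂*` on the wandering subspace. -/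
noncomputable def wanderP : wanderSpace V₁ V₂ →L[ℂ] wanderSpace V₁ V₂ :=
  (wanderP₀ V₂ ∘L (wanderSpace V₁ V₂).subtypeL).codRestrict _
    fun x => wanderP₀_mem hV₁ hV₂ hc x.2

/-- The unitary `U = V₁* + V₂ - V₁ V₂ V₁*` on the wandering subspace. -/
noncomputable def wanderU : wanderSpace V₁ V₂ →L[ℂ] wanderSpace V₁ V₂ :=
  (wanderU₀ V₁ V₂ ∘L (wanderSpace V₁ V₂).subtypeL).codRestrict _
    fun x => wanderU₀_mem hV₁ hV₂ hc x.2

/-- The inverse `V₂* + V₁ - V₁ V₂ V₂*` of the unitary on the wandering subspace. -/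
noncomputable def wanderW : wanderSpace V₁ V₂ →L[ℂ] wanderSpace V₁ V₂ :=
  (wanderU₀ V₂ V₁ ∘L (wanderSpace V₁ V₂).subtypeL).codRestrict _ fun x => by
    have h := wanderU₀_mem hV₂ hV₁ hc.symm (x := (x : K)) (by rw [wanderSpace_comm hc]; exact x.2)
    rwa [wanderSpace_comm hc] at h

theorem coe_wanderP (x : wanderSpace V₁ V₂) :
    (wanderP hV₁ hV₂ hc x : K) = wanderP₀ V₂ x := rfl

theorem coe_wanderU (x : wanderSpace V₁ V₂) :
    (wanderU hV₁ hV₂ hc x : K) = wanderU₀ V₁ V₂ x := rfl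

theorem coe_wanderW (x : wanderSpace V₁ V₂) :
    (wanderW hV₁ hV₂ hc x : K) = wanderU₀ V₂ V₁ x := rfl

/-- The correction terms lie in `Ran V₁V₂` and vanish against wandering vectors; the remaining sums
`V₁* + V₂` and `V₂* + V₁` are adjoint to each other. -/
theorem adjoint_wanderU : adjoint (wanderU hV₁ hV₂ hc) = wanderW hV₁ hV₂ hc := by
  refine ((eq_adjoint_iff _ _).2 fun x y => ?_).symm
  have h1 : inner ℂ (V₂ (V₁ (adjoint V₂ (x : K)))) (y : K) = 0 := by
    rw [← inner_conj_symm, apply_comm hc, inner_wanderSpace y.2, map_zero]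
  rw [Submodule.coe_inner, Submodule.coe_inner, coe_wanderU, coe_wanderW, wanderU₀_apply,
    wanderU₀_apply, inner_sub_left, inner_sub_right, inner_add_left, inner_add_right, h1,
    inner_wanderSpace x.2, adjoint_inner_left, adjoint_inner_right, add_comm]

theorem isStarProjection_wanderP : IsStarProjection (wanderP hV₁ hV₂ hc) := by
  refine ⟨ContinuousLinearMap.ext fun x => Subtype.ext ?_, ?_⟩
  · rw [mul_apply_eq_comp, coe_wanderP, coe_wanderP, wanderP₀_apply, wanderP₀_apply,
      adjoint_apply_apply_of_norm hV₂]
  · refine ((eq_adjoint_iff _ _).2 fun x y => ?_).symm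
    rw [Submodule.coe_inner, Submodule.coe_inner, coe_wanderP, coe_wanderP, wanderP₀_apply,
      wanderP₀_apply, ← adjoint_inner_right, adjoint_inner_left]

theorem wanderU_mem_unitary : wanderU hV₁ hV₂ hc ∈ unitary _ := by
  have h : star (wanderU hV₁ hV₂ hc) = wanderW hV₁ hV₂ hc := adjoint_wanderU hV₁ hV₂ hc
  rw [Unitary.mem_iff, h]
  constructor
  · refine ContinuousLinearMap.ext fun x => Subtype.ext ?_
    exact wanderU₀_wanderU₀ hV₂ hV₁ hc.symm (by rw [wanderSpace_comm hc]; exact x.2)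
  · exact ContinuousLinearMap.ext fun x => Subtype.ext (wanderU₀_wanderU₀ hV₁ hV₂ hc x.2)

omit hc hV₁ hV₂

/-- The isometry `x ↦ Vⁿ x` on a subspace. -/
noncomputable def powIsometry {V : K →L[ℂ] K} (hV : ∀ x, ‖V x‖ = ‖x‖) (F : Submodule ℂ K) (n : ℕ) :
    F →ₗᵢ[ℂ] K :=
  ⟨((V ^ n) ∘L F.subtypeL).toLinearMap, fun x => norm_pow_apply hV n (x : K)⟩

theorem powIsometry_apply {V : K →L[ℂ] K} (hV : ∀ x, ‖V x‖ = ‖x‖) (F : Submodule ℂ K) (n : ℕ)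
    (x : F) : powIsometry hV F n x = (V ^ n) x := rfl

/-- Cancelling the smaller power of `V` leaves `⟪x, Vᵏ⁺¹y⟫ = 0`. -/
theorem orthogonalFamily_powIsometry {V : K →L[ℂ] K} (hV : ∀ x, ‖V x‖ = ‖x‖) {F : Submodule ℂ K}
    (hF : ∀ x ∈ F, ∀ y, inner ℂ x (V y) = 0) :
    OrthogonalFamily ℂ (fun _ : ℕ => F) (powIsometry hV F) := by
  have key : ∀ (n k : ℕ) (x y : F), inner ℂ ((V ^ n) (x : K)) ((V ^ (n + (k + 1))) (y : K)) = 0 :=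
    fun n k x y => by
      rw [pow_add, mul_apply_eq_comp, inner_map_map_of_norm (norm_pow_apply hV n), pow_succ',
        mul_apply_eq_comp, hF _ x.2]
  intro i j hij x y
  rw [powIsometry_apply, powIsometry_apply]
  rcases lt_or_gt_of_ne hij with h | h
  · obtain ⟨k, rfl⟩ := Nat.exists_eq_add_of_lt h
    exact key i k x y
  · obtain ⟨k, rfl⟩ := Nat.exists_eq_add_of_lt h
    rw [← inner_conj_symm]
    exact (congrArg _ (key j k y x)).trans (map_zero _)

/-- The embedding `∑ zⁿ fₙ ↦ ∑ Vⁿ fₙ` of `H²(F)` for a wandering subspace `F`. -/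
noncomputable def wanderEmb {V : K →L[ℂ] K} (hV : ∀ x, ‖V x‖ = ‖x‖) {F : Submodule ℂ K}
    (hF : ∀ x ∈ F, ∀ y, inner ℂ x (V y) = 0) : H2 F →L[ℂ] K :=
  (orthogonalFamily_powIsometry hV hF).linearIsometry.toContinuousLinearMap

variable {V : K →L[ℂ] K} (hV : ∀ x, ‖V x‖ = ‖x‖) {F : Submodule ℂ K}
  (hF : ∀ x ∈ F, ∀ y, inner ℂ x (V y) = 0)

theorem norm_wanderEmb (f : H2 F) : ‖wanderEmb hV hF f‖ = ‖f‖ :=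
  (orthogonalFamily_powIsometry hV hF).linearIsometry.norm_map f

theorem wanderEmb_single (n : ℕ) (x : F) : wanderEmb hV hF (H2.single n x) = (V ^ n) x :=
  (orthogonalFamily_powIsometry hV hF).linearIsometry_apply_single x

theorem H2.ext_single {E G : Type*} [NormedAddCommGroup E] [InnerProductSpace ℂ E]
    [NormedAddCommGroup G] [InnerProductSpace ℂ G] {A B : H2 E →L[ℂ] G}
    (h : ∀ n x, A (H2.single n x) = B (H2.single n x)) : A = B :=
  ContinuousLinearMap.ext fun f => by
    have hA := A.hasSum (H2.hasSum_single f)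
    have hB := B.hasSum (H2.hasSum_single f)
    simp only [h] at hA
    exact hA.unique hB

/-- The range of `Vⁿ` for all `n` is orthogonal to the pure part. -/
theorem inner_wanderEmb_eq_zero (f : H2 F) {y : K} (hy : ∀ n, ∃ z, y = (V ^ n) z) :
    inner ℂ (wanderEmb hV hF f) y = 0 := by
  have h : innerSL ℂ y ∘L wanderEmb hV hF = 0 := H2.ext_single fun n x => by
    -- One power more than in `Vⁿx`, so that after cancelling `Vⁿ` a factor `V` remains next to `z`.
    obtain ⟨z, rfl⟩ := hy (n + 1)
    have h2 : inner ℂ ((V ^ (n + 1)) z) ((V ^ n) (x : K)) = 0 := by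
      rw [pow_succ, mul_apply_eq_comp, inner_map_map_of_norm (norm_pow_apply hV n),
        ← inner_conj_symm, hF x x.2, map_zero]
    rw [comp_apply, wanderEmb_single, innerSL_apply_apply, h2]
    rfl
  rw [← inner_conj_symm]
  exact (congrArg _ (congrArg (fun A : H2 F →L[ℂ] ℂ => A f) h)).trans (map_zero _)

end Wandering

theorem isClosed_range_sup {E F K : Type*} [NormedAddCommGroup E] [InnerProductSpace ℂ E]
    [CompleteSpace E] [NormedAddCommGroup F] [InnerProductSpace ℂ F] [CompleteSpace F]
    [NormedAddCommGroup K] [InnerProductSpace ℂ K] [CompleteSpace K] {a : E →L[ℂ] K}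
    {b : F →L[ℂ] K} (h : ∀ x y, ‖a x + b y‖ ^ 2 = ‖x‖ ^ 2 + ‖y‖ ^ 2) :
    IsClosed ((LinearMap.range a.toLinearMap ⊔ LinearMap.range b.toLinearMap : Submodule ℂ K) :
      Set K) := by
  let J : WithLp 2 (E × F) →L[ℂ] K :=
    (a.coprod b) ∘L (WithLp.prodContinuousLinearEquiv 2 ℂ E F).toContinuousLinearMap
  have hJ : ∀ x, J x = a x.fst + b x.snd := fun x => rfl
  have hJn : ∀ x, ‖J x‖ = ‖x‖ := fun x => by
    rw [← sq_eq_sq₀ (norm_nonneg _) (norm_nonneg _), hJ, h, WithLp.prod_norm_sq_eq_of_L2]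
  have hc : IsClosed (Set.range J) := (isometry_of_norm hJn).isClosedEmbedding.isClosed_range
  convert hc using 1
  ext k
  rw [SetLike.mem_coe, Submodule.mem_sup]
  constructor
  · rintro ⟨_, ⟨x, rfl⟩, _, ⟨y, rfl⟩, rfl⟩
    exact ⟨WithLp.toLp 2 (x, y), rfl⟩
  · rintro ⟨x, rfl⟩
    exact ⟨_, ⟨x.fst, rfl⟩, _, ⟨x.snd, rfl⟩, rfl⟩

/-! ### The tuple of a lift -/

theorem H2.mulLinear_single {F : Type*} [NormedAddCommGroup F] [InnerProductSpace ℂ F]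
    (A B : F →L[ℂ] F) (n : ℕ) (x : F) :
    H2.mulLinear A B (H2.single n x) = H2.single n (A x) + H2.single (n + 1) (B x) := by
  have h : H2.mulLinear A B (H2.single n x) =
      H2.map A (H2.single n x) + H2.shift (H2.map B (H2.single n x)) := rfl
  rw [h, H2.map_single, H2.map_single, H2.shift_single]

/-- An operator commuting with `V` is determined on `⊕ VⁿF` by its values on `F`; `h` makes it the
multiplication `M_{A + zB}`. -/
theorem apply_wanderEmb {K : Type u} [NormedAddCommGroup K] [InnerProductSpace ℂ K]
    [CompleteSpace K] {V S : K →L[ℂ] K} (hV : ∀ x, ‖V x‖ = ‖x‖) {F : Submodule ℂ K}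
    (hF : ∀ x ∈ F, ∀ y, inner ℂ x (V y) = 0) (hc : Commute S V) {A B : F →L[ℂ] F}
    (h : ∀ x : F, S x = A x + V (B x)) (f : H2 F) :
    S (wanderEmb hV hF f) = wanderEmb hV hF (H2.mulLinear A B f) := by
  have hE : S ∘L wanderEmb hV hF = wanderEmb hV hF ∘L H2.mulLinear A B :=
    H2.ext_single fun n x => by
      have h1 : S ((V ^ n) (x : K)) = (V ^ n) (S x) :=
        congrArg (fun A : K →L[ℂ] K => A x) (hc.pow_right n).eq
      rw [comp_apply, comp_apply, H2.mulLinear_single, map_add, wanderEmb_single,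
        wanderEmb_single, wanderEmb_single, h1, h, map_add, pow_succ, mul_apply_eq_comp]
  exact congrArg (fun A : H2 F →L[ℂ] K => A f) hE

section Tuple

variable {H : Type u} [NormedAddCommGroup H] [InnerProductSpace ℂ H] [CompleteSpace H]
  {T₁ T₂ : H →L[ℂ] H} {L : LiftTriple H}

namespace IsAndoLift

variable (hL : IsAndoLift T₁ T₂ L)
include hL

theorem norm_emb (x : H) : ‖L.emb x‖ = ‖x‖ := norm_of_isometry hL.isometry_emb x

theorem norm_V₁ (k : L.K) : ‖L.V₁ k‖ = ‖k‖ := norm_of_isometry hL.isometry_V₁ k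

theorem norm_V₂ (k : L.K) : ‖L.V₂ k‖ = ‖k‖ := norm_of_isometry hL.isometry_V₂ k

theorem norm_mul (k : L.K) : ‖(L.V₁ * L.V₂) k‖ = ‖k‖ :=
  (hL.norm_V₁ (L.V₂ k)).trans (hL.norm_V₂ k)

theorem adjoint_V₁_emb (x : H) : adjoint L.V₁ (L.emb x) = L.emb (adjoint T₁ x) :=
  congrArg (fun A : H →L[ℂ] L.K => A x) hL.intertwine₁

theorem adjoint_V₂_emb (x : H) : adjoint L.V₂ (L.emb x) = L.emb (adjoint T₂ x) :=
  congrArg (fun A : H →L[ℂ] L.K => A x) hL.intertwine₂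

theorem adjoint_mul_emb (x : H) :
    adjoint (L.V₁ * L.V₂) (L.emb x) = L.emb (adjoint (T₁ * T₂) x) := by
  rw [adjoint_mul_apply, adjoint_mul_apply, hL.adjoint_V₁_emb, hL.adjoint_V₂_emb]

theorem emb_sub_mem (x : H) :
    L.emb x - (L.V₁ * L.V₂) (L.emb (adjoint (T₁ * T₂) x)) ∈ wanderSpace L.V₁ L.V₂ := by
  rw [mem_wanderSpace, ← adjoint_mul_apply, map_sub, hL.adjoint_mul_emb,
    adjoint_apply_apply_of_norm hL.norm_mul, sub_self]

/-- The operator `h ↦ Π h - V Π T* h` into the wandering subspace. -/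
noncomputable def embSub : H →L[ℂ] wanderSpace L.V₁ L.V₂ :=
  (L.emb - (L.V₁ * L.V₂) ∘L L.emb ∘L adjoint (T₁ * T₂)).codRestrict _ hL.emb_sub_mem

theorem coe_embSub (x : H) :
    (hL.embSub x : L.K) = L.emb x - (L.V₁ * L.V₂) (L.emb (adjoint (T₁ * T₂) x)) := rfl

/-- As `V*Π = ΠT*` for `V = V₁V₂`, the vector is `(I - VV*)Πx`, with squared norm `‖x‖² - ‖T*x‖²`.
-/
theorem norm_embSub (hT : ‖adjoint (T₁ * T₂)‖ ≤ 1) (x : H) :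
    ‖hL.embSub x‖ = ‖defectMap (adjoint (T₁ * T₂)) x‖ := by
  rw [← sq_eq_sq₀ (norm_nonneg _) (norm_nonneg _), norm_defectMap_sq _ hT, ← hL.norm_emb,
    ← hL.norm_emb (adjoint (T₁ * T₂) x), ← hL.adjoint_mul_emb, ← norm_sub_map_sq hL.norm_mul,
    hL.adjoint_mul_emb]
  rfl

/-- The isometry `D_{T*} h ↦ Π h - V Π T* h`. -/
noncomputable def lam (hT : ‖adjoint (T₁ * T₂)‖ ≤ 1) :
    defectSpace (adjoint (T₁ * T₂)) →ₗᵢ[ℂ] wanderSpace L.V₁ L.V₂ where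
  toLinearMap := (hL.embSub.toLinearMap.extendOfNorm
    (defectMap (adjoint (T₁ * T₂))).toLinearMap).toLinearMap
  norm_map' := norm_extendOfNorm_apply (denseRange_defectMap (adjoint (T₁ * T₂)))
    (hL.norm_embSub hT)

theorem lam_defectMap (hT : ‖adjoint (T₁ * T₂)‖ ≤ 1) (x : H) :
    hL.lam hT (defectMap (adjoint (T₁ * T₂)) x) = hL.embSub x :=
  extendOfNorm_apply (denseRange_defectMap (adjoint (T₁ * T₂))) (hL.norm_embSub hT) x

/-- The tuple of a lift, on the wandering subspace. -/
noncomputable def tuple (hT : ‖adjoint (T₁ * T₂)‖ ≤ 1) : PreAndoTuple (adjoint (T₁ * T₂)) where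
  F := wanderSpace L.V₁ L.V₂
  Lam := hL.lam hT
  P := wanderP hL.norm_V₁ hL.norm_V₂ hL.comm
  U := wanderU hL.norm_V₁ hL.norm_V₂ hL.comm
  isProj := isStarProjection_wanderP hL.norm_V₁ hL.norm_V₂ hL.comm
  isUnitary := wanderU_mem_unitary hL.norm_V₁ hL.norm_V₂ hL.comm

/-- Let `e(x) = Πx - VΠT*x`. The first equation becomes `V₁*e(x) + V₂(I - V₁V₁*)e(T*x) = e(T₁*x)`.
Inserting `V₁*e(x) = ΠT₁*x - V₂ΠT*x` makes all unwanted terms cancel. The second equation is the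
mirror image, with `U*P = V₂*` and `U*Pᗮ = V₁(I - V₂V₂*)`. -/
theorem isTypeI_tuple (hcomm : T₁ * T₂ = T₂ * T₁) (hT : ‖adjoint (T₁ * T₂)‖ ≤ 1) :
    (hL.tuple hT).IsTypeI T₁ T₂ := by
  have hc₁ : ∀ x, adjoint T₁ (adjoint (T₁ * T₂) x) = adjoint (T₁ * T₂) (adjoint T₁ x) := fun x => by
    rw [adjoint_mul_apply, adjoint_mul_apply, adjoint_adjoint_apply_comm hcomm]
  have hc₂ : ∀ x, adjoint T₂ (adjoint (T₁ * T₂) x) = adjoint (T₁ * T₂) (adjoint T₂ x) := fun x => by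
    rw [adjoint_mul_apply, adjoint_mul_apply, adjoint_adjoint_apply_comm hcomm]
  have hA₁ : ∀ x, adjoint L.V₁ (hL.embSub x) =
      L.emb (adjoint T₁ x) - L.V₂ (L.emb (adjoint (T₁ * T₂) x)) := fun x => by
    rw [coe_embSub, map_sub, hL.adjoint_V₁_emb, mul_apply_eq_comp,
      adjoint_apply_apply_of_norm hL.norm_V₁]
  have hA₂ : ∀ x, adjoint L.V₂ (hL.embSub x) =
      L.emb (adjoint T₂ x) - L.V₁ (L.emb (adjoint (T₁ * T₂) x)) := fun x => by
    rw [coe_embSub, map_sub, hL.adjoint_V₂_emb, mul_apply_eq_comp, ← apply_comm hL.comm,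
      adjoint_apply_apply_of_norm hL.norm_V₂]
  constructor
  · refine ContinuousLinearMap.ext fun x => Subtype.ext ?_
    have h1 := wanderU₀_sub_wanderP₀ hL.norm_V₁ hL.norm_V₂ hL.comm (hL.embSub x).2
    have h2 := wanderP₀_wanderU₀ hL.norm_V₁ hL.norm_V₂ hL.comm
      (hL.embSub (adjoint (T₁ * T₂) x)).2
    have h3 := congrArg₂ (· + ·) h1 h2
    have h4 := hL.lam_defectMap hT
    have h5 : ((hL.embSub (adjoint T₁ x) : wanderSpace L.V₁ L.V₂) : L.K) =
        adjoint L.V₁ (hL.embSub x) + (L.V₂ (hL.embSub (adjoint (T₁ * T₂) x)) -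
          L.V₁ (L.V₂ (adjoint L.V₁ (hL.embSub (adjoint (T₁ * T₂) x))))) := by
      rw [hA₁, hA₁, coe_embSub, coe_embSub, hc₁]
      simp only [map_sub, mul_apply_eq_comp, apply_comm hL.comm]
      abel
    rw [← h4] at h5
    refine Eq.trans ?_ (h3.trans h5.symm)
    rw [← h4, ← h4]
    rfl
  · refine ContinuousLinearMap.ext fun x => Subtype.ext ?_
    have h1 := wanderU₀_wanderP₀ hL.norm_V₂ hL.comm (hL.embSub x)
    have h2 := wanderU₀_sub hL.norm_V₂ hL.comm (hL.embSub (adjoint (T₁ * T₂) x))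
    have h3 := congrArg₂ (· + ·) h1 h2
    have h4 := hL.lam_defectMap hT
    have h5 : ((hL.embSub (adjoint T₂ x) : wanderSpace L.V₁ L.V₂) : L.K) =
        adjoint L.V₂ (hL.embSub x) + (L.V₁ (hL.embSub (adjoint (T₁ * T₂) x)) -
          L.V₁ (L.V₂ (adjoint L.V₂ (hL.embSub (adjoint (T₁ * T₂) x))))) := by
      rw [hA₂, hA₂, coe_embSub, coe_embSub, hc₂]
      simp only [map_sub, mul_apply_eq_comp, apply_comm hL.comm]
      abel
    rw [← h4] at h5
    refine Eq.trans ?_ (h3.trans h5.symm)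
    rw [← h4, ← h4]
    have h6 : adjoint (hL.tuple hT).U = wanderW hL.norm_V₁ hL.norm_V₂ hL.comm :=
      adjoint_wanderU hL.norm_V₁ hL.norm_V₂ hL.comm
    rw [h6]
    rfl

end IsAndoLift

end Tuple

/-! ### The lift as a model of its tuple -/

section Wold

variable {H : Type u} [NormedAddCommGroup H] [InnerProductSpace ℂ H] [CompleteSpace H]
  {T₁ T₂ : H →L[ℂ] H}

/-- The part of the Wold decomposition of a lift that belongs to the wandering subspace. -/
structure PureData (hT : ‖adjoint (T₁ * T₂)‖ ≤ 1) (t : PreAndoTuple (adjoint (T₁ * T₂)))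
    (L : LiftTriple H) where
  inl : H2 t.F →L[ℂ] L.K
  norm_inl : ∀ f, ‖inl f‖ = ‖f‖
  V₁_inl : ∀ f, L.V₁ (inl f) = inl (t.M₁ f)
  V₂_inl : ∀ f, L.V₂ (inl f) = inl (t.M₂ f)
  emb_sub : ∀ x, L.emb x - L.V₁ (L.V₂ (L.emb (adjoint (T₁ * T₂) x))) =
    inl (H2.single 0 (t.Lam (defectMap (adjoint (T₁ * T₂)) x)))
  inner_eq_zero : ∀ f y, (∀ n, ∃ z, y = ((L.V₁ * L.V₂) ^ n) z) → Inner.inner ℂ (inl f) y = 0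
  exists_eq : ∀ y, adjoint L.V₂ (adjoint L.V₁ y) = 0 → ∃ f, y = inl f

namespace PureData

variable {hT : ‖adjoint (T₁ * T₂)‖ ≤ 1} {t : PreAndoTuple (adjoint (T₁ * T₂))}
  {L : LiftTriple H} (m : PureData hT t L)

/-- The residual part `Π h - ∑ Vⁿ Λ D_{T*} T*ⁿ h` of the embedding. -/
noncomputable def res : H →L[ℂ] L.K := L.emb - m.inl ∘L t.obs hT

theorem emb_eq (x : H) : L.emb x = m.inl (t.obs hT x) + m.res x := (add_sub_cancel _ _).symm

theorem V₁_V₂_inl (f : H2 t.F) : L.V₁ (L.V₂ (m.inl f)) = m.inl (H2.shift f) := by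
  rw [m.V₂_inl, m.V₁_inl, t.M₁_M₂]

/-- `Πx - VΠT*x` is a pure vector, and it equals the same expression formed with the pure parts
alone, so the residual parts must cancel. -/
theorem mul_res_adjoint (x : H) : (L.V₁ * L.V₂) (m.res (adjoint (T₁ * T₂) x)) = m.res x := by
  have h1 : m.res x = L.emb x - m.inl (t.obs hT x) := rfl
  have h2 : m.res (adjoint (T₁ * T₂) x) =
    L.emb (adjoint (T₁ * T₂) x) - m.inl (t.obs hT (adjoint (T₁ * T₂) x)) := rfl
  have h3 := m.emb_sub x
  rw [← t.obs_sub_shift hT x, map_sub, ← V₁_V₂_inl] at h3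
  have h4 : ∀ a b c d : L.K, a - b = c - d → b - d = a - c := fun a b c d h => by
    rw [sub_eq_sub_iff_add_eq_add] at h ⊢
    rw [add_comm, ← h]
  rw [h2, h1, map_sub, mul_apply_eq_comp, mul_apply_eq_comp]
  exact h4 _ _ _ _ h3

/-- Iterating `VΠ_uT* = Π_u` puts the residual vectors into `Ran Vⁿ` for every `n`. The pair `x`,
`T₁*x` is treated at once for use in `V₁_res_adjoint`. -/
theorem exists_res_eq (x : H) (n : ℕ) : ∃ y, m.res x = ((L.V₁ * L.V₂) ^ n) (m.res y) ∧
    ∃ z, m.res (adjoint T₁ x) = ((L.V₁ * L.V₂) ^ n) (m.res z) := by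
  have h : ∀ x, ∃ y, m.res x = ((L.V₁ * L.V₂) ^ n) (m.res y) := by
    induction n with
    | zero => exact fun x => ⟨x, rfl⟩
    | succ n ih =>
      intro x
      obtain ⟨y, hy⟩ := ih x
      refine ⟨adjoint (T₁ * T₂) y, ?_⟩
      rw [pow_succ, mul_apply_eq_comp, m.mul_res_adjoint, hy]
  obtain ⟨y, hy⟩ := h x
  exact ⟨y, hy, h _⟩

theorem inner_inl_res (f : H2 t.F) (x : H) : Inner.inner ℂ (m.inl f) (m.res x) = 0 :=
  m.inner_eq_zero f _ fun n => by
    obtain ⟨y, hy, -⟩ := m.exists_res_eq x n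
    exact ⟨_, hy⟩

variable (hL : IsAndoLift T₁ T₂ L)
include hL

/-- `Πx - V₁V₁*Πx` lies in `ker V₁* ⊆ ker V*`, hence is pure, and so is the difference of the two
sides. That difference also lies in every `Ran Vⁿ`, so it is orthogonal to itself. -/
theorem V₁_res_adjoint (x : H) : L.V₁ (m.res (adjoint T₁ x)) = m.res x := by
  have hV₁ : ∀ n k, L.V₁ (((L.V₁ * L.V₂) ^ n) k) = ((L.V₁ * L.V₂) ^ n) (L.V₁ k) := fun n k => by
    have hc : Commute L.V₁ ((L.V₁ * L.V₂) ^ n) :=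
      ((Commute.refl L.V₁).mul_right hL.comm).pow_right n
    exact congrArg (fun A : L.K →L[ℂ] L.K => A k) hc.eq
  obtain ⟨g, hg⟩ := m.exists_eq (L.emb x - L.V₁ (adjoint L.V₁ (L.emb x))) (by
    rw [map_sub, adjoint_apply_apply_of_norm hL.norm_V₁, sub_self, map_zero])
  have h1 : m.res x - L.V₁ (m.res (adjoint T₁ x)) =
      m.inl (g - t.obs hT x + t.M₁ (t.obs hT (adjoint T₁ x))) := by
    rw [map_add, map_sub, ← hg, ← m.V₁_inl, hL.adjoint_V₁_emb, m.emb_eq, m.emb_eq, map_add]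
    abel
  have h2 : Inner.inner ℂ (m.res x - L.V₁ (m.res (adjoint T₁ x)))
      (m.res x - L.V₁ (m.res (adjoint T₁ x))) = 0 := by
    nth_rewrite 1 [h1]
    refine m.inner_eq_zero _ _ fun n => ?_
    obtain ⟨y, hy, z, hz⟩ := m.exists_res_eq x n
    exact ⟨m.res y - L.V₁ (m.res z), by rw [map_sub, ← hy, ← hV₁, ← hz]⟩
  exact (sub_eq_zero.1 (inner_self_eq_zero.1 h2)).symm

/-- Pythagoras for `Πx`, whose pure part has squared norm `‖x‖² - ‖Q_{T*}x‖²`. -/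
theorem norm_res (hT' : ‖T₁ * T₂‖ ≤ 1) (x : H) : ‖m.res x‖ = ‖resMap (T₁ * T₂) x‖ := by
  have h := norm_sq_add_of_inner_eq_zero (m.inner_inl_res (t.obs hT x) x)
  have h2 : ‖t.obs hT x‖ = ‖obsOp (adjoint (T₁ * T₂)) hT x‖ := H2.norm_map t.Lam.norm_map _
  rw [← m.emb_eq, hL.norm_emb, m.norm_inl, h2, norm_obsOp_sq hT' hT, ← norm_resMap] at h
  rw [← sq_eq_sq₀ (norm_nonneg _) (norm_nonneg _)]
  linarith

/-- The embedding `W_Dⁿ Q_{T*} h ↦ Vⁿ (Π h)_u` of the residual space. -/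
noncomputable def inr : ResSpace (T₁ * T₂) →L[ℂ] L.K :=
  (Finsupp.lsum ℂ fun n : ℕ => (((L.V₁ * L.V₂) ^ n) ∘L m.res).toLinearMap).extendOfNorm
    (resGen (T₁ * T₂) 1)

theorem inr_pow_resMap (hT' : ‖T₁ * T₂‖ ≤ 1) (n : ℕ) (x : H) :
    m.inr ((resUnitary (T₁ * T₂) ^ n) (resMap (T₁ * T₂) x)) =
      ((L.V₁ * L.V₂) ^ n) (m.res x) := by
  have h := extendOfNorm_apply (denseRange_resGen hT')
    (norm_lsum_pow_eq hT' hL.norm_mul m.mul_res_adjoint (m.norm_res hL hT')) (Finsupp.single n x)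
  rw [resGen_single, Finsupp.lsum_single] at h
  exact h

theorem norm_inr (hT' : ‖T₁ * T₂‖ ≤ 1) (q : ResSpace (T₁ * T₂)) : ‖m.inr q‖ = ‖q‖ :=
  norm_extendOfNorm_apply (denseRange_resGen hT')
    (norm_lsum_pow_eq hT' hL.norm_mul m.mul_res_adjoint (m.norm_res hL hT')) q

theorem inr_resMap (hT' : ‖T₁ * T₂‖ ≤ 1) (x : H) : m.inr (resMap (T₁ * T₂) x) = m.res x :=
  m.inr_pow_resMap hL hT' 0 x

theorem mul_inr (hT' : ‖T₁ * T₂‖ ≤ 1) (q : ResSpace (T₁ * T₂)) :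
    L.V₁ (L.V₂ (m.inr q)) = m.inr (resUnitary (T₁ * T₂) q) := by
  have h : (L.V₁ * L.V₂) ∘L m.inr = m.inr ∘L resUnitary (T₁ * T₂) :=
    eq_of_forall_resUnitary_pow hT' fun n x => by
      have h2 : resUnitary (T₁ * T₂) ((resUnitary (T₁ * T₂) ^ n) (resMap (T₁ * T₂) x)) =
          (resUnitary (T₁ * T₂) ^ (n + 1)) (resMap (T₁ * T₂) x) := by
        rw [pow_succ' (resUnitary (T₁ * T₂))]
        rfl
      rw [comp_apply, comp_apply, h2, m.inr_pow_resMap hL hT', m.inr_pow_resMap hL hT',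
        pow_succ' (L.V₁ * L.V₂)]
      rfl
  exact congrArg (fun A : ResSpace (T₁ * T₂) →L[ℂ] L.K => A q) h

theorem inner_inl_inr (hT' : ‖T₁ * T₂‖ ≤ 1) (f : H2 t.F) (q : ResSpace (T₁ * T₂)) :
    Inner.inner ℂ (m.inl f) (m.inr q) = 0 := by
  have h : innerSL ℂ (m.inl f) ∘L m.inr = 0 := eq_of_forall_resUnitary_pow hT' fun n x => by
    rw [comp_apply, m.inr_pow_resMap hL hT', innerSL_apply_apply, m.inner_eq_zero]
    · rfl
    · intro k
      obtain ⟨y, hy, -⟩ := m.exists_res_eq x k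
      refine ⟨((L.V₁ * L.V₂) ^ n) (m.res y), ?_⟩
      rw [hy, ← mul_apply_eq_comp, ← mul_apply_eq_comp, ← pow_add, ← pow_add, add_comm]
  exact congrArg (fun A : ResSpace (T₁ * T₂) →L[ℂ] ℂ => A q) h

section

variable (hcomm : T₁ * T₂ = T₂ * T₁) (h₁ : ‖T₁‖ ≤ 1) (h₂ : ‖T₂‖ ≤ 1)
include hcomm h₁ h₂

theorem V₁_inr (q : ResSpace (T₁ * T₂)) :
    L.V₁ (m.inr q) = m.inr (canonicalUnitary (T₁ * T₂) T₁ q) := by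
  have hT' := norm_mul_le_one h₁ h₂
  have hV₁ : ∀ n k, L.V₁ (((L.V₁ * L.V₂) ^ n) k) = ((L.V₁ * L.V₂) ^ n) (L.V₁ k) := fun n k => by
    have hc : Commute L.V₁ ((L.V₁ * L.V₂) ^ n) :=
      ((Commute.refl L.V₁).mul_right hL.comm).pow_right n
    exact congrArg (fun A : L.K →L[ℂ] L.K => A k) hc.eq
  have h : L.V₁ ∘L m.inr ∘L adjoint (canonicalUnitary (T₁ * T₂) T₁) = m.inr :=
    eq_of_forall_resUnitary_pow hT' fun n x => by
      rw [comp_apply, comp_apply, adjoint_canonicalUnitary_left hcomm h₁ h₂,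
        m.inr_pow_resMap hL hT', m.inr_pow_resMap hL hT', hV₁, m.V₁_res_adjoint hL]
  -- Substitute `q = W_{♭1}*r` with `r = W_{♭1}q`, since `h` is stated with the adjoint.
  obtain ⟨r, hr⟩ : ∃ r, r = canonicalUnitary (T₁ * T₂) T₁ q := ⟨_, rfl⟩
  have h2 : adjoint (canonicalUnitary (T₁ * T₂) T₁) r = q := by
    rw [hr]
    exact adjoint_apply_apply_of_norm (norm_canonicalUnitary_left hcomm h₁ h₂) q
  rw [← hr, ← h2]
  exact congrArg (fun A : ResSpace (T₁ * T₂) →L[ℂ] L.K => A r) h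

/-- Cancel the isometry `V₁`: both sides become the image of `W_Dq = W_{♭1}W_{♭2}q`. -/
theorem V₂_inr (q : ResSpace (T₁ * T₂)) :
    L.V₂ (m.inr q) = m.inr (canonicalUnitary (T₁ * T₂) T₂ q) := by
  refine (isometry_of_norm hL.norm_V₁).injective ?_
  rw [m.mul_inr hL (norm_mul_le_one h₁ h₂), m.V₁_inr hL hcomm h₁ h₂]
  exact congrArg m.inr (canonicalUnitary_apply_apply hcomm h₁ h₂ q).symm

/-- A minimal lift is a model of its tuple. -/
noncomputable def modelData (hmin : L.IsMinimal) : ModelData hT t L where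
  inl := m.inl
  inr := m.inr
  inner_eq f q g r := by
    have hT' := norm_mul_le_one h₁ h₂
    have h1 : Inner.inner ℂ (m.inr q) (m.inl g) = 0 := by
      rw [← inner_conj_symm, m.inner_inl_inr hL hT', map_zero]
    rw [inner_add_left, inner_add_right, inner_add_right, m.inner_inl_inr hL hT', h1,
      inner_map_map_of_norm m.norm_inl, inner_map_map_of_norm (m.norm_inr hL hT'), add_zero,
      zero_add]
  exists_eq k := by
    have hT' := norm_mul_le_one h₁ h₂
    -- Minimality enters here: the sum of the pure and residual pieces is closed, invariant and
    -- contains `Ran Π`, so it is all of `K`.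
    have hN := hmin (LinearMap.range m.inl.toLinearMap ⊔ LinearMap.range m.inr.toLinearMap)
      (isClosed_range_sup fun f q => by
        rw [norm_sq_add_of_inner_eq_zero (m.inner_inl_inr hL hT' f q), m.norm_inl,
          m.norm_inr hL hT'])
      (fun x => by
        rw [m.emb_eq, ← m.inr_resMap hL hT']
        exact Submodule.add_mem_sup ⟨_, rfl⟩ ⟨_, rfl⟩)
      (fun k hk => by
        obtain ⟨_, ⟨f, rfl⟩, _, ⟨q, rfl⟩, rfl⟩ := Submodule.mem_sup.1 hk
        rw [map_add]
        exact Submodule.add_mem_sup ⟨_, (m.V₁_inl f).symm⟩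
          ⟨_, (m.V₁_inr hL hcomm h₁ h₂ q).symm⟩)
      (fun k hk => by
        obtain ⟨_, ⟨f, rfl⟩, _, ⟨q, rfl⟩, rfl⟩ := Submodule.mem_sup.1 hk
        rw [map_add]
        exact Submodule.add_mem_sup ⟨_, (m.V₂_inl f).symm⟩
          ⟨_, (m.V₂_inr hL hcomm h₁ h₂ q).symm⟩)
    have hk : k ∈ LinearMap.range m.inl.toLinearMap ⊔ LinearMap.range m.inr.toLinearMap := by
      rw [hN]
      trivial
    obtain ⟨_, ⟨f, rfl⟩, _, ⟨q, rfl⟩, hk⟩ := Submodule.mem_sup.1 hk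
    exact ⟨f, q, hk.symm⟩
  emb_apply x := by rw [m.inr_resMap hL (norm_mul_le_one h₁ h₂), ← m.emb_eq]
  V₁_inl := m.V₁_inl
  V₂_inl := m.V₂_inl
  V₁_inr := m.V₁_inr hL hcomm h₁ h₂
  V₂_inr := m.V₂_inr hL hcomm h₁ h₂

end

end PureData

namespace IsAndoLift

variable {L : LiftTriple H} (hL : IsAndoLift T₁ T₂ L)

/-- The pure part of the Wold decomposition of a lift. -/
noncomputable def pureData (hT : ‖adjoint (T₁ * T₂)‖ ≤ 1) : PureData hT (hL.tuple hT) L where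
  inl := wanderEmb hL.norm_mul fun _ hx y => inner_wanderSpace hx y
  norm_inl := norm_wanderEmb hL.norm_mul _
  V₁_inl := by
    have h := apply_wanderEmb hL.norm_mul (fun _ hx y => inner_wanderSpace hx y)
      ((Commute.refl L.V₁).mul_right hL.comm)
      (A := wanderW hL.norm_V₁ hL.norm_V₂ hL.comm *
        (1 - wanderP hL.norm_V₁ hL.norm_V₂ hL.comm))
      (B := wanderW hL.norm_V₁ hL.norm_V₂ hL.comm * wanderP hL.norm_V₁ hL.norm_V₂ hL.comm)
      -- `V₁x = V₁(I - V₂V₂*)x + V₁V₂V₂*x`, where the two coefficients are `U*Pᗮx` and `U*Px`.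
      (fun x => by
        have h1 := wanderU₀_sub hL.norm_V₂ hL.comm (x : L.K)
        have h2 := wanderU₀_wanderP₀ hL.norm_V₂ hL.comm (x : L.K)
        have h3 : L.V₁ x = L.V₁ x - L.V₁ (L.V₂ (adjoint L.V₂ (x : L.K))) +
          (L.V₁ * L.V₂) (adjoint L.V₂ (x : L.K)) := (sub_add_cancel _ _).symm
        rw [← h1, ← h2] at h3
        exact h3)
    rw [← adjoint_wanderU hL.norm_V₁ hL.norm_V₂ hL.comm] at h
    exact h
  V₂_inl := apply_wanderEmb hL.norm_mul (fun _ hx y => inner_wanderSpace hx y)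
      ((show Commute L.V₂ L.V₁ from hL.comm.symm).mul_right (Commute.refl L.V₂))
      (A := wanderP hL.norm_V₁ hL.norm_V₂ hL.comm * wanderU hL.norm_V₁ hL.norm_V₂ hL.comm)
      (B := (1 - wanderP hL.norm_V₁ hL.norm_V₂ hL.comm) *
        wanderU hL.norm_V₁ hL.norm_V₂ hL.comm)
      -- `V₂x = V₂(I - V₁V₁*)x + V₁V₂V₁*x`, where the two coefficients are `PUx` and `PᗮUx`.
      (fun x => by
        have h1 := wanderP₀_wanderU₀ hL.norm_V₁ hL.norm_V₂ hL.comm x.2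
        have h2 := wanderU₀_sub_wanderP₀ hL.norm_V₁ hL.norm_V₂ hL.comm x.2
        have h3 : L.V₂ x = L.V₂ x - L.V₁ (L.V₂ (adjoint L.V₁ (x : L.K))) +
          (L.V₁ * L.V₂) (adjoint L.V₁ (x : L.K)) := (sub_add_cancel _ _).symm
        rw [← h1, ← h2] at h3
        exact h3)
  emb_sub x := by
    have h := wanderEmb_single hL.norm_mul (F := wanderSpace L.V₁ L.V₂)
      (fun _ hx y => inner_wanderSpace hx y) 0 (hL.embSub x)
    rw [← hL.lam_defectMap hT] at h
    refine Eq.trans ?_ h.symm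
    rw [hL.lam_defectMap hT]
    rfl
  inner_eq_zero f y hy := inner_wanderEmb_eq_zero hL.norm_mul _ f hy
  exists_eq y hy := ⟨H2.single 0 (⟨y, mem_wanderSpace.2 hy⟩ : wanderSpace L.V₁ L.V₂),
    (wanderEmb_single hL.norm_mul (F := wanderSpace L.V₁ L.V₂)
      (fun _ hx y => inner_wanderSpace hx y) 0 ⟨y, mem_wanderSpace.2 hy⟩).symm⟩

end IsAndoLift

end Wold
/-! ### Fourier monomials in `L²(E)` -/

section Fourier

open MeasureTheory AddCircle

variable {E : Type*} [NormedAddCommGroup E] [InnerProductSpace ℂ E]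

theorem toSpanSingleton_compLp_fourierLp (x : E) (k : ℤ) :
    (ContinuousLinearMap.toSpanSingleton ℂ x).compLpL 2 haarAddCircle (fourierLp (T := 1) 2 k) =
      mono k x := by
  refine Lp.ext ?_
  filter_upwards [ContinuousLinearMap.coeFn_compLpL (p := 2) (μ := haarAddCircle)
      (ContinuousLinearMap.toSpanSingleton ℂ x) (fourierLp (T := 1) 2 k),
    coeFn_fourierLp (T := 1) 2 k,
    ContinuousMap.coeFn_toLp (E := E) (p := 2) (𝕜 := ℂ) haarAddCircle (monoFun k x)] with t h1 h2 h3
  refine h1.trans (Eq.trans ?_ h3.symm)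
  rw [h2]
  rfl

theorem toSpanSingleton_compLp_indicatorConstLp (x : E) {s : Set UnitAddCircle}
    (hs : MeasurableSet s) (hμs : (haarAddCircle : Measure UnitAddCircle) s ≠ ∞) :
    (ContinuousLinearMap.toSpanSingleton ℂ x).compLpL 2 haarAddCircle
      (indicatorConstLp 2 hs hμs (1 : ℂ)) = indicatorConstLp 2 hs hμs x := by
  refine Lp.ext ?_
  filter_upwards [ContinuousLinearMap.coeFn_compLpL (p := 2) (μ := haarAddCircle)
      (ContinuousLinearMap.toSpanSingleton ℂ x) (indicatorConstLp 2 hs hμs (1 : ℂ)),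
    indicatorConstLp_coeFn (p := 2) (hs := hs) (hμs := hμs) (c := (1 : ℂ)),
    indicatorConstLp_coeFn (p := 2) (hs := hs) (hμs := hμs) (c := x)] with t h1 h2 h3
  refine h1.trans (Eq.trans ?_ h3.symm)
  rw [h2]
  by_cases ht : t ∈ s <;> simp [ht]

/-- A closed subspace of `L²(E)` which contains all monomials is the whole space. -/
theorem eq_top_of_mono_mem {N : Submodule ℂ (L2 E)} (hN : IsClosed (N : Set (L2 E)))
    (h : ∀ k x, mono k x ∈ N) : N = ⊤ := by
  -- For fixed `x`, the scalar `g` with `g x ∈ N` form a closed subspace containing every `ζᵏ`,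
  -- hence all of scalar `L²`. Indicators times vectors, and so all of `L²(E)`, follow.
  have h1 : ∀ (x : E) (g : L2 ℂ),
      (ContinuousLinearMap.toSpanSingleton ℂ x).compLpL 2 haarAddCircle g ∈ N := fun x g => by
    let A := (ContinuousLinearMap.toSpanSingleton ℂ x).compLpL 2
      (haarAddCircle : Measure UnitAddCircle)
    have h2 : (Submodule.span ℂ (Set.range (fourierLp (T := 1) 2))).topologicalClosure ≤
        N.comap A.toLinearMap := by
      refine Submodule.topologicalClosure_minimal _ (Submodule.span_le.2 ?_)
        (hN.preimage A.continuous)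
      rintro _ ⟨k, rfl⟩
      have h3 := h k x
      rw [← toSpanSingleton_compLp_fourierLp] at h3
      exact h3
    rw [span_fourierLp_closure_eq_top (by simp)] at h2
    exact h2 trivial
  rw [Submodule.eq_top_iff']
  refine Lp.induction (by simp) _ (fun c s hs hμs => ?_) (fun f g hf hg _ h2 h3 => N.add_mem h2 h3) hN
  have h2 := h1 c (indicatorConstLp 2 hs hμs.ne (1 : ℂ))
  rw [toSpanSingleton_compLp_indicatorConstLp] at h2
  exact h2

theorem denseRange_lsum_mono :
    DenseRange (Finsupp.lsum ℂ fun k : ℤ => (mono (E := E) k).toLinearMap) := by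
  have h := eq_top_of_mono_mem
    (N := (LinearMap.range (Finsupp.lsum ℂ fun k : ℤ =>
      (mono (E := E) k).toLinearMap)).topologicalClosure)
    (Submodule.isClosed_topologicalClosure _)
    (fun k x => subset_closure ⟨Finsupp.single k x, Finsupp.lsum_single ..⟩)
  intro y
  have hy : y ∈ (LinearMap.range (Finsupp.lsum ℂ fun k : ℤ =>
      (mono (E := E) k).toLinearMap)).topologicalClosure := by
    rw [h]
    trivial
  exact hy

variable [CompleteSpace E]

theorem shiftedBoundary_single (k : ℤ) (n : ℕ) (x : E) :
    shiftedBoundary k (H2.single n x) = mono (k + n) x :=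
  ((mono_orthogonal (E := E)).comp (f := fun n : ℕ => k + (n : ℤ))
    (fun a b h => by simpa using h)).linearIsometry_apply_single (i := n) x

theorem shiftedBoundary_shift (k : ℤ) (f : H2 E) :
    shiftedBoundary k (H2.shift f) = shiftedBoundary (k + 1) f := by
  have h : (shiftedBoundary (E := E) k).toContinuousLinearMap ∘L H2.shift =
      (shiftedBoundary (k + 1)).toContinuousLinearMap := H2.ext_single fun n x => by
    have h1 : shiftedBoundary k (H2.shift (H2.single n x)) =
        shiftedBoundary (k + 1) (H2.single n x) := by
      have h2 : k + ((n + 1 : ℕ) : ℤ) = k + 1 + n := by push_cast; ring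
      rw [H2.shift_single, shiftedBoundary_single, shiftedBoundary_single, h2]
    exact h1
  exact congrArg (fun A : H2 E →L[ℂ] L2 E => A f) h

end Fourier

section Families

variable {ι : Type*} {X E F : Type*} [NormedAddCommGroup X] [InnerProductSpace ℂ X]
  [NormedAddCommGroup E] [InnerProductSpace ℂ E] [NormedAddCommGroup F] [InnerProductSpace ℂ F]

/-- The norm of a finite sum depends only on the Gram matrix of its terms. -/
theorem norm_lsum_eq_of_inner_eq {a : ι → X →ₗ[ℂ] E} {b : ι → X →ₗ[ℂ] F}
    (h : ∀ k l x y, inner ℂ (a k x) (a l y) = inner ℂ (b k x) (b l y)) (f : ι →₀ X) :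
    ‖Finsupp.lsum ℂ a f‖ = ‖Finsupp.lsum ℂ b f‖ := by
  have h1 : inner ℂ (Finsupp.lsum ℂ a f) (Finsupp.lsum ℂ a f) =
      inner ℂ (Finsupp.lsum ℂ b f) (Finsupp.lsum ℂ b f) := by
    simp only [Finsupp.lsum_apply, Finsupp.sum, sum_inner, inner_sum, h]
  rw [← sq_eq_sq₀ (norm_nonneg _) (norm_nonneg _), ← inner_self_eq_norm_sq (𝕜 := ℂ),
    ← inner_self_eq_norm_sq (𝕜 := ℂ), h1]

end Families

/-! ### Integer powers of a unitary -/

section ZPow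

variable {K : Type*} [NormedAddCommGroup K] [InnerProductSpace ℂ K] [CompleteSpace K]
  {W : K →L[ℂ] K}

theorem unitaryZPow_natCast (n : ℕ) : unitaryZPow W n = W ^ n := rfl

theorem unitaryZPow_add_one (hW : adjoint W * W = 1) (k : ℤ) :
    unitaryZPow W (k + 1) = unitaryZPow W k * W := by
  rcases k with n | n
  · exact pow_succ W n
  · have h : Int.negSucc n + 1 = -(n : ℤ) := by omega
    -- For `n = 0` the exponent belongs to the nonnegative branch of the definition, hence the case
    -- split.
    have h2 : unitaryZPow W (-(n : ℤ)) = adjoint W ^ n := by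
      rcases n with _ | n
      · rfl
      · rfl
    rw [h, h2]
    change _ = adjoint W ^ (n + 1) * W
    rw [pow_succ, mul_assoc, hW, mul_one]

theorem norm_unitaryZPow (hW : ∀ x, ‖W x‖ = ‖x‖) (hW' : ∀ x, ‖adjoint W x‖ = ‖x‖) (k : ℤ) (x : K) :
    ‖unitaryZPow W k x‖ = ‖x‖ := by
  rcases k with n | n
  · exact norm_pow_apply hW n x
  · exact norm_pow_apply hW' (n + 1) x

end ZPow

/-! ### The wandering part of a lift -/

section LiftDefect

variable {H K : Type*} [NormedAddCommGroup H] [InnerProductSpace ℂ H] [CompleteSpace H]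
  [NormedAddCommGroup K] [InnerProductSpace ℂ K] [CompleteSpace K] {T : H →L[ℂ] H}
  {V : K →L[ℂ] K} {J : H →L[ℂ] K} (hV : ∀ x, ‖V x‖ = ‖x‖) (hJ : ∀ x, ‖J x‖ = ‖x‖)
  (hVJ : ∀ x, adjoint V (J x) = J (adjoint T x))
include hV hJ hVJ

theorem adjoint_apply_lift (x : K) : adjoint J (V x) = T (adjoint J x) := by
  refine ext_inner_left ℂ fun h => ?_
  rw [adjoint_inner_right, ← adjoint_inner_left, hVJ, ← adjoint_inner_left, ← adjoint_inner_right]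

theorem adjoint_lift_sub (x : H) : adjoint J (V (J x) - J (T x)) = 0 := by
  rw [map_sub, adjoint_apply_lift hV hJ hVJ, adjoint_apply_apply_of_norm hJ,
    adjoint_apply_apply_of_norm hJ, sub_self]

/-- `J*V = TJ*` makes `VJx - JTx` orthogonal to `Ran J`, so its squared norm is `‖x‖² - ‖Tx‖²`. -/
theorem norm_lift_sub (hT : ‖T‖ ≤ 1) (x : H) : ‖V (J x) - J (T x)‖ = ‖defectMap T x‖ := by
  have h : inner ℂ (V (J x) - J (T x)) (J (T x)) = 0 := by
    rw [← adjoint_inner_left, adjoint_lift_sub hV hJ hVJ, inner_zero_left]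
  have h2 := norm_sq_add_of_inner_eq_zero h
  rw [sub_add_cancel, hV, hJ, hJ] at h2
  rw [← sq_eq_sq₀ (norm_nonneg _) (norm_nonneg _), norm_defectMap_sq _ hT]
  linarith

theorem adjoint_pow_lift_sub (x : H) (n : ℕ) : adjoint J ((V ^ n) (V (J x) - J (T x))) = 0 := by
  induction n with
  | zero => exact adjoint_lift_sub hV hJ hVJ x
  | succ n ih => rw [pow_succ', mul_apply_eq_comp, adjoint_apply_lift hV hJ hVJ, ih, map_zero]

/-- Every `Vⁿ(VJy - JTy)` is orthogonal to `Ran J`. This kills the term with `JTx` directly, and the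
term with `VJx` after one `V` is cancelled. -/
theorem inner_lift_sub (x y : H) (n : ℕ) :
    inner ℂ (V (J x) - J (T x)) ((V ^ (n + 1)) (V (J y) - J (T y))) = 0 := by
  rw [inner_sub_left, ← adjoint_inner_right J, adjoint_pow_lift_sub hV hJ hVJ, pow_succ',
    mul_apply_eq_comp, inner_map_map_of_norm hV, ← adjoint_inner_right,
    adjoint_pow_lift_sub hV hJ hVJ, inner_zero_right, inner_zero_right, sub_zero]

end LiftDefect

/-- The isometry `D_T h ↦ V J h - J T h`. -/
noncomputable def liftDefect {H K : Type*} [NormedAddCommGroup H] [InnerProductSpace ℂ H]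
    [CompleteSpace H] [NormedAddCommGroup K] [InnerProductSpace ℂ K] [CompleteSpace K]
    (T : H →L[ℂ] H) (V : K →L[ℂ] K) (J : H →L[ℂ] K) : defectSpace T →L[ℂ] K :=
  (V ∘L J - J ∘L T).toLinearMap.extendOfNorm (defectMap T).toLinearMap

section LiftDefect

variable {H K : Type*} [NormedAddCommGroup H] [InnerProductSpace ℂ H] [CompleteSpace H]
  [NormedAddCommGroup K] [InnerProductSpace ℂ K] [CompleteSpace K] {T : H →L[ℂ] H}
  {V : K →L[ℂ] K} {J : H →L[ℂ] K} (hT : ‖T‖ ≤ 1) (hV : ∀ x, ‖V x‖ = ‖x‖) (hJ : ∀ x, ‖J x‖ = ‖x‖)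
  (hVJ : ∀ x, adjoint V (J x) = J (adjoint T x))
include hT hV hJ hVJ

theorem liftDefect_defectMap (x : H) : liftDefect T V J (defectMap T x) = V (J x) - J (T x) :=
  extendOfNorm_apply (denseRange_defectMap T) (norm_lift_sub hV hJ hVJ hT) x

theorem norm_liftDefect (x : defectSpace T) : ‖liftDefect T V J x‖ = ‖x‖ :=
  norm_extendOfNorm_apply (denseRange_defectMap T) (norm_lift_sub hV hJ hVJ hT) x

theorem inner_liftDefect (x y : defectSpace T) (n : ℕ) :
    inner ℂ (liftDefect T V J x) ((V ^ (n + 1)) (liftDefect T V J y)) = 0 := by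
  refine (denseRange_defectMap T).induction
    (P := fun x => inner ℂ (liftDefect T V J x) ((V ^ (n + 1)) (liftDefect T V J y)) = 0) ?_
    (isClosed_eq (by fun_prop) (by fun_prop)) x
  rintro _ ⟨x, rfl⟩
  refine (denseRange_defectMap T).induction
    (P := fun y => inner ℂ (liftDefect T V J (defectMap T x))
      ((V ^ (n + 1)) (liftDefect T V J y)) = 0) ?_
    (isClosed_eq (by fun_prop) (by fun_prop)) y
  rintro _ ⟨y, rfl⟩
  rw [liftDefect_defectMap hT hV hJ hVJ, liftDefect_defectMap hT hV hJ hVJ,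
    inner_lift_sub hV hJ hVJ]

/-- Gram matrix of the translates of the wandering part. -/
theorem inner_translate {G : Type*} [NormedAddCommGroup G] [InnerProductSpace ℂ G]
    [CompleteSpace G] {R : ℤ → K →L[ℂ] G} (hR : ∀ k x, ‖R k x‖ = ‖x‖)
    (hRV : ∀ k x, R (k + 1) x = R k (V x)) (k l : ℤ) (x y : defectSpace T) :
    inner ℂ (R k (liftDefect T V J x)) (R l (liftDefect T V J y)) =
      inner ℂ (mono k x) (mono l y) := by
  have hpow : ∀ (m : ℕ) k x, R (k + m) x = R k ((V ^ m) x) := fun m => by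
    induction m with
    | zero => exact fun k x => by rw [Nat.cast_zero, add_zero]; rfl
    | succ m ih =>
      intro k x
      rw [Nat.cast_add, Nat.cast_one, ← add_assoc, hRV, ih, pow_succ, mul_apply_eq_comp]
  -- `R k` is an isometry and `R (k + m + 1) = R k Vᵐ⁺¹`, so only nonnegative powers of `V`, which
  -- need not be invertible, are involved.
  have key : ∀ (k : ℤ) (m : ℕ) (x y : defectSpace T), inner ℂ (R k (liftDefect T V J x))
      (R (k + (m + 1 : ℕ)) (liftDefect T V J y)) = 0 := fun k m x y => by
    rw [hpow, inner_map_map_of_norm (hR k), inner_liftDefect hT hV hJ hVJ]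
  rcases lt_trichotomy k l with h | rfl | h
  · obtain ⟨m, hm⟩ := Int.eq_ofNat_of_zero_le (sub_nonneg.2 (Int.add_one_le_iff.2 h))
    have hl : l = k + (m + 1 : ℕ) := by push_cast; linarith
    rw [mono_orthogonal h.ne, hl, key]
  · rw [inner_map_map_of_norm (hR k), inner_map_map_of_norm (norm_liftDefect hT hV hJ hVJ),
      LinearIsometry.inner_map_map]
  · obtain ⟨m, hm⟩ := Int.eq_ofNat_of_zero_le (sub_nonneg.2 (Int.add_one_le_iff.2 h))
    have hl : k = l + (m + 1 : ℕ) := by push_cast; linarith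
    rw [mono_orthogonal h.ne', hl, ← inner_conj_symm, key, map_zero]

end LiftDefect
/-! ### The wandering part of the lift `M_z ⊕ W` -/

section Dilation

variable {H E Q : Type*} [NormedAddCommGroup H] [InnerProductSpace ℂ H] [CompleteSpace H]
  [NormedAddCommGroup E] [InnerProductSpace ℂ E] [CompleteSpace E]
  [NormedAddCommGroup Q] [InnerProductSpace ℂ Q] [CompleteSpace Q]
  {T : H →L[ℂ] H} {O : H →L[ℂ] H2 E} {q : H →L[ℂ] Q} {W : Q →L[ℂ] Q}

theorem norm_blockCol (h : ∀ x, ‖O x‖ ^ 2 + ‖q x‖ ^ 2 = ‖x‖ ^ 2) (x : H) :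
    ‖blockCol O q x‖ = ‖x‖ := by
  rw [← sq_eq_sq₀ (norm_nonneg _) (norm_nonneg _), ← h, WithLp.prod_norm_sq_eq_of_L2]
  rfl

theorem adjoint_dilation_apply (hO : ∀ x, H2.backShift (O x) = O (adjoint T x))
    (hq : ∀ x, adjoint W (q x) = q (adjoint T x)) (x : H) :
    adjoint (blockDiag H2.shift W) (blockCol O q x) = blockCol O q (adjoint T x) := by
  rw [adjoint_blockDiag, H2.adjoint_shift, blockCol_apply, blockCol_apply, ← hO, ← hq]
  rfl

/-- The residual component `D_T h ↦ W q h - q T h` of the wandering part. -/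
noncomputable def resDefect (T : H →L[ℂ] H) (O : H →L[ℂ] H2 E) (q : H →L[ℂ] Q) (W : Q →L[ℂ] Q) :
    defectSpace T →L[ℂ] Q :=
  (WithLp.sndL 2 ℂ (H2 E) Q) ∘L liftDefect T (blockDiag H2.shift W) (blockCol O q)

variable (hT : ‖T‖ ≤ 1) (hn : ∀ x, ‖O x‖ ^ 2 + ‖q x‖ ^ 2 = ‖x‖ ^ 2) (hW : ∀ x, ‖W x‖ = ‖x‖)
  (hO : ∀ x, H2.backShift (O x) = O (adjoint T x))
  (hq : ∀ x, adjoint W (q x) = q (adjoint T x))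
include hT hn hW hO hq

theorem resDefect_defectMap (x : H) :
    resDefect T O q W (defectMap T x) = W (q x) - q (T x) :=
  congrArg WithLp.snd (liftDefect_defectMap hT (norm_blockDiag H2.norm_shift hW)
    (norm_blockCol hn) (adjoint_dilation_apply hO hq) x)

theorem liftDefect_fst {Θ : defectSpace T →L[ℂ] H2 E}
    (hΘ : ∀ x, Θ (defectMap T x) = H2.shift (O x) - O (T x)) (x : defectSpace T) :
    (liftDefect T (blockDiag H2.shift W) (blockCol O q) x).fst = Θ x := by
  have h : WithLp.fstL 2 ℂ (H2 E) Q ∘L liftDefect T (blockDiag H2.shift W) (blockCol O q) = Θ := by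
    refine ContinuousLinearMap.coeFn_injective ((denseRange_defectMap T).equalizer
      (ContinuousLinearMap.continuous _) (ContinuousLinearMap.continuous _) (funext fun x => ?_))
    have h1 := liftDefect_defectMap hT (norm_blockDiag H2.norm_shift hW)
      (norm_blockCol hn) (adjoint_dilation_apply hO hq) x
    exact (congrArg WithLp.fst h1).trans (hΘ x).symm
  exact congrArg (fun A : defectSpace T →L[ℂ] H2 E => A x) h

/-- The isometries `ζᵏ ⊕ Wᵏ` carry the wandering copy of `𝒟_T` to an orthogonal family with the Gram
matrix of the monomials `ζᵏx`. Splitting the norm into its two components gives the identity. -/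
theorem norm_sq_add_norm_sq_eq {Θ : defectSpace T →L[ℂ] H2 E}
    (hΘ : ∀ x, Θ (defectMap T x) = H2.shift (O x) - O (T x)) (hW' : ∀ x, ‖adjoint W x‖ = ‖x‖)
    (f : ℤ →₀ defectSpace T) :
    ‖Finsupp.lsum ℂ (fun k : ℤ => ((shiftedBoundary (E := E)
      k).toContinuousLinearMap ∘L Θ).toLinearMap) f‖ ^ 2 +
    ‖Finsupp.lsum ℂ (fun k : ℤ => (unitaryZPow W k ∘L resDefect T O q W).toLinearMap) f‖ ^ 2 =
    ‖Finsupp.lsum ℂ (fun k : ℤ => (mono (E := defectSpace T) k).toLinearMap) f‖ ^ 2 := by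
  let R : ℤ → WithLp 2 (H2 E × Q) →L[ℂ] WithLp 2 (L2 E × Q) := fun k =>
    blockDiag (shiftedBoundary k).toContinuousLinearMap (unitaryZPow W k)
  have hR : ∀ k x, ‖R k x‖ = ‖x‖ := fun k =>
    norm_blockDiag (shiftedBoundary k).norm_map (norm_unitaryZPow hW hW' k)
  have hRV : ∀ k x, R (k + 1) x = R k (blockDiag H2.shift W x) := fun k x => by
    have h1 := shiftedBoundary_shift k x.fst
    have h2 := congrArg (fun A : Q →L[ℂ] Q => A x.snd)
      (unitaryZPow_add_one ((norm_map_iff_adjoint_comp_self W).1 hW) k)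
    exact congrArg₂ (fun a b => WithLp.toLp 2 (a, b)) h1.symm h2
  let Y := liftDefect T (blockDiag H2.shift W) (blockCol O q)
  have h := norm_lsum_eq_of_inner_eq (a := fun k : ℤ => (R k ∘L Y).toLinearMap)
    (b := fun k : ℤ => (mono (E := defectSpace T) k).toLinearMap)
    (inner_translate hT (norm_blockDiag H2.norm_shift hW)
      (norm_blockCol hn) (adjoint_dilation_apply hO hq) hR hRV) f
  have h2 : Finsupp.lsum ℂ (fun k : ℤ => (R k ∘L Y).toLinearMap) f = WithLp.toLp 2
      (Finsupp.lsum ℂ (fun k : ℤ => ((shiftedBoundary (E := E)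
        k).toContinuousLinearMap ∘L Θ).toLinearMap) f,
      Finsupp.lsum ℂ (fun k : ℤ => (unitaryZPow W k ∘L resDefect T O q W).toLinearMap) f) := by
    clear h
    induction f using Finsupp.induction_linear with
    | zero => rw [map_zero, map_zero, map_zero]; rfl
    | add f g hf hg => rw [map_add, map_add, map_add, hf, hg]; rfl
    | single k x =>
      rw [Finsupp.lsum_single, Finsupp.lsum_single, Finsupp.lsum_single]
      have h3 := liftDefect_fst hT hn hW hO hq hΘ x
      exact congrArg (fun a => WithLp.toLp 2 (a, (unitaryZPow W k ∘L
        resDefect T O q W) x)) (congrArg (shiftedBoundary k) h3)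
  rw [← h, h2, WithLp.prod_norm_sq_eq_of_L2, WithLp.toLp_fst, WithLp.toLp_snd]

end Dilation

/-! ### The characteristic function as the pure component of the wandering part -/

section NagyFoias

variable {H : Type u} [NormedAddCommGroup H] [InnerProductSpace ℂ H] [CompleteSpace H]
  {T : H →L[ℂ] H}

theorem backShift_obsOp (hT' : ‖adjoint T‖ ≤ 1) (x : H) :
    H2.backShift (obsOp (adjoint T) hT' x) = obsOp (adjoint T) hT' (adjoint T x) :=
  H2.ext fun n => by
    rw [H2.backShift_apply, obsOp_apply, obsOp_apply, pow_succ]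
    rfl

/-- `T D_T = D_{T*}T` already takes values in `𝒟_{T*}`, so the projection in the definition acts as
the identity. -/
theorem charSeries_apply_zero (hT : ‖T‖ ≤ 1) (hT' : ‖adjoint T‖ ≤ 1) (x : H) :
    (charSeries T hT' (defectMap T x) 0 : H) = - defectOp (adjoint T) (T x) := by
  have h : ((defectSpace (adjoint T)).orthogonalProjectionOnto
      (-T (defectOp T x)) : H) = -T (defectOp T x) := by
    rw [← defectOp_adjoint_apply T hT, ← map_neg, ← map_neg]
    exact congrArg Subtype.val (Submodule.orthogonalProjectionOnto_mem_subspace_eq_self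
      (defectMap (adjoint T) (T (-x))))
  rw [defectOp_adjoint_apply T hT, ← h]
  simp [charSeries]
  rfl

theorem charSeries_apply_succ (hT' : ‖adjoint T‖ ≤ 1) (x : H) (n : ℕ) :
    charSeries T hT' (defectMap T x) (n + 1) =
      defectMap (adjoint T) ((adjoint T ^ n) (defectOp T (defectOp T x))) := by
  simp [charSeries]
  rfl

/-- Identifies `Θ_T` with the `H²` component of `VΠx - ΠTx`: the constant term is `-D_{T*}Tx`, and
the later ones use `D_T² = I - T*T`. -/
theorem charSeries_defectMap (hT : ‖T‖ ≤ 1) (hT' : ‖adjoint T‖ ≤ 1) (x : H) :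
    charSeries T hT' (defectMap T x) =
      H2.shift (obsOp (adjoint T) hT' x) - obsOp (adjoint T) hT' (T x) := by
  refine H2.ext fun n => ?_
  rw [lp.coeFn_sub, Pi.sub_apply]
  rcases n with _ | n
  · rw [H2.shift_zero, zero_sub, obsOp_apply]
    exact Subtype.ext (charSeries_apply_zero hT hT' x)
  · rw [H2.shift_succ, obsOp_apply, obsOp_apply, charSeries_apply_succ,
      defectOp_defectOp_apply T hT, map_sub, map_sub, pow_succ]
    rfl

/-- The residual component `D_T h ↦ W_D Q_{T*} h - Q_{T*} T h` of the wandering part of the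
minimal isometric lift. -/
noncomputable def charRes (T : H →L[ℂ] H) (hT' : ‖adjoint T‖ ≤ 1) : defectSpace T →L[ℂ] ResSpace T :=
  resDefect T (obsOp (adjoint T) hT') (resMap T) (resUnitary T)

variable (hT : ‖T‖ ≤ 1) (hT' : ‖adjoint T‖ ≤ 1)
include hT

theorem norm_sq_obsOp_add (x : H) :
    ‖obsOp (adjoint T) hT' x‖ ^ 2 + ‖resMap T x‖ ^ 2 = ‖x‖ ^ 2 := by
  rw [norm_obsOp_sq hT, norm_resMap, sub_add_cancel]

theorem adjoint_resUnitary_resMap (x : H) :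
    adjoint (resUnitary T) (resMap T x) = resMap T (adjoint T x) := by
  rw [adjoint_resUnitary, resUnitaryAdj_resMap hT]

theorem norm_adjoint_resUnitary (x : ResSpace T) : ‖adjoint (resUnitary T) x‖ = ‖x‖ := by
  rw [adjoint_resUnitary, norm_resUnitaryAdj hT]

theorem charRes_defectMap (x : H) : charRes T hT' (defectMap T x) =
    resUnitary T (resMap T x) - resMap T (T x) :=
  resDefect_defectMap hT (norm_sq_obsOp_add hT hT') (norm_resUnitary hT) (backShift_obsOp hT')
    (adjoint_resUnitary_resMap hT) x

theorem norm_sq_charSeries_add (f : ℤ →₀ defectSpace T) :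
    ‖Finsupp.lsum ℂ (fun k : ℤ => ((shiftedBoundary (E := defectSpace (adjoint T))
      k).toContinuousLinearMap ∘L charSeries T hT').toLinearMap) f‖ ^ 2 +
    ‖Finsupp.lsum ℂ (fun k : ℤ => (unitaryZPow (resUnitary T) k ∘L
      charRes T hT').toLinearMap) f‖ ^ 2 =
    ‖Finsupp.lsum ℂ (fun k : ℤ => (mono (E := defectSpace T) k).toLinearMap) f‖ ^ 2 :=
  norm_sq_add_norm_sq_eq hT (norm_sq_obsOp_add hT hT') (norm_resUnitary hT) (backShift_obsOp hT')
    (adjoint_resUnitary_resMap hT) (charSeries_defectMap hT hT') (norm_adjoint_resUnitary hT) f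

theorem norm_lsum_charSeries_le (f : ℤ →₀ defectSpace T) :
    ‖Finsupp.lsum ℂ (fun k : ℤ => ((shiftedBoundary (E := defectSpace (adjoint T))
      k).toContinuousLinearMap ∘L charSeries T hT').toLinearMap) f‖ ≤
    1 * ‖Finsupp.lsum ℂ (fun k : ℤ => (mono (E := defectSpace T) k).toLinearMap) f‖ := by
  rw [one_mul, ← sq_le_sq₀ (norm_nonneg _) (norm_nonneg _), ← norm_sq_charSeries_add hT hT']
  exact le_add_of_nonneg_right (sq_nonneg _)

theorem mulCharFun_lsum (f : ℤ →₀ defectSpace T) :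
    mulCharFun T hT' (Finsupp.lsum ℂ (fun k : ℤ => (mono (E := defectSpace T) k).toLinearMap) f) =
      Finsupp.lsum ℂ (fun k : ℤ => ((shiftedBoundary (E := defectSpace (adjoint T))
        k).toContinuousLinearMap ∘L charSeries T hT').toLinearMap) f :=
  LinearMap.extendOfNorm_eq denseRange_lsum_mono ⟨1, norm_lsum_charSeries_le hT hT'⟩ f

theorem norm_mulCharFun : ‖mulCharFun T hT'‖ ≤ 1 :=
  opNorm_le_bound _ zero_le_one fun y => by
    refine denseRange_lsum_mono.induction (P := fun y => ‖mulCharFun T hT' y‖ ≤ 1 * ‖y‖) ?_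
      (isClosed_le (mulCharFun T hT').continuous.norm (continuous_const.mul continuous_norm)) y
    rintro _ ⟨f, rfl⟩
    rw [mulCharFun_lsum hT]
    exact norm_lsum_charSeries_le hT hT' f

/-- Both sides have square `‖f‖² - ‖Θ_T f‖²`, where `f` now denotes the trigonometric polynomial. -/
theorem norm_deltaMap_lsum (f : ℤ →₀ defectSpace T) :
    ‖deltaMap T hT' (Finsupp.lsum ℂ (fun k : ℤ => (mono (E := defectSpace T) k).toLinearMap) f)‖ =
    ‖Finsupp.lsum ℂ (fun k : ℤ => (unitaryZPow (resUnitary T) k ∘L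
      charRes T hT').toLinearMap) f‖ := by
  rw [← sq_eq_sq₀ (norm_nonneg _) (norm_nonneg _)]
  have h := norm_defectOp_apply_sq (mulCharFun T hT') (norm_mulCharFun hT hT')
    (Finsupp.lsum ℂ (fun k : ℤ => (mono (E := defectSpace T) k).toLinearMap) f)
  rw [mulCharFun_lsum hT, ← norm_sq_charSeries_add hT hT', add_sub_cancel_left] at h
  exact h

end NagyFoias
/-! ### The canonical unitary of the Sz.-Nagy–Foias model -/

section CNU

variable {H Q : Type*} [NormedAddCommGroup H] [InnerProductSpace ℂ H] [CompleteSpace H]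
  [NormedAddCommGroup Q] [InnerProductSpace ℂ Q] [CompleteSpace Q]
  {T : H →L[ℂ] H} {q : H →L[ℂ] Q} {W : Q →L[ℂ] Q}

/-- `T` and `T*` shift the sequence in opposite directions, so its closed span reduces `T` to a
unitary. -/
theorem IsCNU.eq_zero_of_sequence (hT : IsCNU T) {y : ℤ → H} (h1 : ∀ k, T (y (k + 1)) = y k)
    (h2 : ∀ k, adjoint T (y k) = y (k + 1)) (k : ℤ) : y k = 0 := by
  let N := (Submodule.span ℂ (Set.range y)).topologicalClosure
  have hmem : ∀ k, y k ∈ N := fun k => subset_closure (Submodule.subset_span ⟨k, rfl⟩)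
  have hind : ∀ {M : Submodule ℂ H}, IsClosed (M : Set H) → (∀ k, y k ∈ M) → N ≤ M :=
    fun hM h => Submodule.topologicalClosure_minimal _ (Submodule.span_le.2 (by
      rintro _ ⟨k, rfl⟩
      exact h k)) hM
  have hNc : IsClosed (N : Set H) := Submodule.isClosed_topologicalClosure _
  have hT1 : ∀ k, T (y k) = y (k - 1) := fun k => by
    have h := h1 (k - 1)
    rwa [sub_add_cancel] at h
  have hN := hT N hNc
    (hind (M := N.comap T.toLinearMap) (hNc.preimage T.continuous) fun k => by
      have h := hmem (k - 1)
      rw [← hT1] at h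
      exact h)
    (hind (M := N.comap (adjoint T).toLinearMap) (hNc.preimage (adjoint T).continuous) fun k => by
      have h := hmem (k + 1)
      rw [← h2] at h
      exact h)
    (fun x hx => ⟨
      hind (M := LinearMap.eqLocus (adjoint T * T).toLinearMap LinearMap.id)
        (isClosed_eq (adjoint T * T).continuous continuous_id) (fun k => by
          have h : adjoint T (T (y k)) = y k := by rw [hT1, h2, sub_add_cancel]
          exact h) hx,
      hind (M := LinearMap.eqLocus (T * adjoint T).toLinearMap LinearMap.id)
        (isClosed_eq (T * adjoint T).continuous continuous_id) (fun k => by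
          have h : T (adjoint T (y k)) = y k := by rw [h2, h1]
          exact h) hx⟩)
  have h := hmem k
  rw [hN] at h
  exact h

/-- Put `y_k = q*(Wᵏ)*x`. Orthogonality to the generators says `T*y_k = y_{k+1}`, and `WqT* = q`
says `Ty_{k+1} = y_k`. So every `y_k` vanishes, and `x` is orthogonal to all `Wⁿqh`. -/
theorem IsCNU.eq_zero_of_inner_eq_zero (hT : IsCNU T) (hW : ∀ x, ‖W x‖ = ‖x‖)
    (hq : ∀ x, W (q (adjoint T x)) = q x)
    (hd : ∀ x, (∀ (n : ℕ) h, inner ℂ ((W ^ n) (q h)) x = 0) → x = 0) {x : Q}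
    (hx : ∀ k h, inner ℂ (unitaryZPow W k (W (q h) - q (T h))) x = 0) : x = 0 := by
  let y : ℤ → H := fun k => adjoint q (adjoint (unitaryZPow W k) x)
  have hy : ∀ k h, inner ℂ (unitaryZPow W k (q h)) x = inner ℂ h (y k) := fun k h => by
    rw [adjoint_inner_right, adjoint_inner_right]
  have hsucc : ∀ k z, unitaryZPow W (k + 1) z = unitaryZPow W k (W z) := fun k z =>
    congrArg (fun A : Q →L[ℂ] Q => A z)
      (unitaryZPow_add_one ((norm_map_iff_adjoint_comp_self W).1 hW) k)
  have h1 : ∀ k, T (y (k + 1)) = y k := fun k => ext_inner_left ℂ fun h => by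
    rw [← adjoint_inner_left, ← hy, hsucc, hq, hy]
  have h2 : ∀ k, adjoint T (y k) = y (k + 1) := fun k => ext_inner_left ℂ fun h => by
    have h3 := hx k h
    rw [map_sub, inner_sub_left, sub_eq_zero, ← hsucc, hy, hy] at h3
    rw [adjoint_inner_right, h3]
  refine hd x fun n h => ?_
  rw [← unitaryZPow_natCast, hy, hT.eq_zero_of_sequence h1 h2, inner_zero_right]

end CNU

theorem denseRange_of_inner_eq_zero {X Q : Type*} [AddCommGroup X] [Module ℂ X]
    [NormedAddCommGroup Q] [InnerProductSpace ℂ Q] [CompleteSpace Q] (e : X →ₗ[ℂ] Q)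
    (h : ∀ x, (∀ f, inner ℂ (e f) x = 0) → x = 0) : DenseRange e := by
  have h2 : (LinearMap.range e).topologicalClosure = ⊤ := by
    rw [Submodule.topologicalClosure_eq_top_iff, Submodule.eq_bot_iff]
    exact fun x hx => h x fun f => (Submodule.mem_orthogonal _ _).1 hx _ ⟨f, rfl⟩
  intro y
  have hy : y ∈ (LinearMap.range e).topologicalClosure := by
    rw [h2]
    trivial
  exact hy

section Omega

variable {H : Type u} [NormedAddCommGroup H] [InnerProductSpace ℂ H] [CompleteSpace H]
  {T : H →L[ℂ] H}

theorem eq_zero_of_inner_resUnitary_pow (hT : ‖T‖ ≤ 1) (x : ResSpace T)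
    (hx : ∀ (n : ℕ) h, inner ℂ ((resUnitary T ^ n) (resMap T h)) x = 0) : x = 0 := by
  have h : innerSL ℂ x = 0 := eq_of_forall_resUnitary_pow hT fun n h => by
    rw [innerSL_apply_apply, ← inner_conj_symm, hx, map_zero]
    rfl
  have h2 := congrArg (fun A : ResSpace T →L[ℂ] ℂ => A x) h
  exact inner_self_eq_zero.1 h2

theorem IsCNU.denseRange_lsum (hc : IsCNU T) (hT : ‖T‖ ≤ 1) :
    DenseRange (Finsupp.lsum ℂ fun n : ℤ => (unitaryZPow (resUnitary T) n ∘L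
      (resUnitary T ∘L resMap T - resMap T ∘L T)).toLinearMap) := by
  refine denseRange_of_inner_eq_zero _ fun x hx => ?_
  refine hc.eq_zero_of_inner_eq_zero (norm_resUnitary hT) (resUnitary_resMap_adjoint hT)
    (eq_zero_of_inner_resUnitary_pow hT) fun k h => ?_
  have h2 := hx (Finsupp.single k h)
  rw [Finsupp.lsum_single] at h2
  exact h2

theorem lsum_comp_mapRange {X Y Z : Type*} [AddCommGroup X] [Module ℂ X] [AddCommGroup Y]
    [Module ℂ Y] [AddCommGroup Z] [Module ℂ Z] (a : ℤ → Y →ₗ[ℂ] Z) (D : X →ₗ[ℂ] Y) (f : ℤ →₀ X) :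
    Finsupp.lsum ℂ (fun n => a n ∘ₗ D) f =
      Finsupp.lsum ℂ a (Finsupp.mapRange.linearMap D f) := by
  induction f using Finsupp.induction_linear with
  | zero => rw [map_zero, map_zero, map_zero]
  | add f g hf hg => rw [map_add, map_add, map_add, hf, hg]
  | single k x =>
    rw [Finsupp.lsum_single, Finsupp.mapRange.linearMap_apply, Finsupp.mapRange_single,
      Finsupp.lsum_single]
    rfl

theorem comp_lsum {X Y Z : Type*} [AddCommGroup X] [Module ℂ X] [AddCommGroup Y]
    [Module ℂ Y] [AddCommGroup Z] [Module ℂ Z] (a : ℤ → X →ₗ[ℂ] Y) (D : Y →ₗ[ℂ] Z) (f : ℤ →₀ X) :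
    Finsupp.lsum ℂ (fun n => D ∘ₗ a n) f = D (Finsupp.lsum ℂ a f) := by
  induction f using Finsupp.induction_linear with
  | zero => rw [map_zero, map_zero, map_zero]
  | add f g hf hg => rw [map_add, map_add, map_add, hf, hg]
  | single k x => rw [Finsupp.lsum_single, Finsupp.lsum_single]; rfl

/-- This is `norm_deltaMap_lsum` for the coefficients `D_T hₙ`. -/
theorem norm_lsum_deltaMap (hT : ‖T‖ ≤ 1) (hT' : ‖adjoint T‖ ≤ 1) (f : ℤ →₀ H) :
    ‖Finsupp.lsum ℂ (fun n : ℤ => (deltaMap T hT' ∘L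
      (mono (E := defectSpace T) n).toContinuousLinearMap ∘L defectMap T).toLinearMap) f‖ =
    ‖Finsupp.lsum ℂ (fun n : ℤ => (unitaryZPow (resUnitary T) n ∘L
      (resUnitary T ∘L resMap T - resMap T ∘L T)).toLinearMap) f‖ := by
  have h := norm_deltaMap_lsum hT hT' (Finsupp.mapRange.linearMap (defectMap T).toLinearMap f)
  have h1 := comp_lsum (fun k : ℤ => (mono (E := defectSpace T) k).toLinearMap)
    (deltaMap T hT').toLinearMap (Finsupp.mapRange.linearMap (defectMap T).toLinearMap f)
  rw [← lsum_comp_mapRange] at h1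
  have h2 : (fun n : ℤ => (unitaryZPow (resUnitary T) n ∘L
      (resUnitary T ∘L resMap T - resMap T ∘L T)).toLinearMap) = fun k : ℤ =>
      (unitaryZPow (resUnitary T) k ∘L charRes T hT').toLinearMap ∘ₗ
        (defectMap T).toLinearMap := by
    funext k
    refine LinearMap.ext fun x => ?_
    exact congrArg (unitaryZPow (resUnitary T) k) (charRes_defectMap hT hT' x).symm
  rw [h2, lsum_comp_mapRange, ← h]
  exact congrArg norm h1

theorem denseRange_lsum_comp_mono {X Y Z : Type*} [NormedAddCommGroup X] [InnerProductSpace ℂ X]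
    [NormedAddCommGroup Y] [InnerProductSpace ℂ Y] [NormedAddCommGroup Z] [NormedSpace ℂ Z]
    {D : X →L[ℂ] Y} {A : L2 Y →L[ℂ] Z} (hD : DenseRange D) (hA : DenseRange A) :
    DenseRange (Finsupp.lsum ℂ (fun n : ℤ =>
      (A ∘L (mono (E := Y) n).toContinuousLinearMap ∘L D).toLinearMap)) := by
  obtain ⟨N, hN⟩ : ∃ N : Submodule ℂ Z, N = (LinearMap.range (Finsupp.lsum ℂ (fun n : ℤ =>
      (A ∘L (mono (E := Y) n).toContinuousLinearMap ∘L D).toLinearMap))).topologicalClosure :=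
    ⟨_, rfl⟩
  have hNc : IsClosed (N : Set Z) := hN ▸ Submodule.isClosed_topologicalClosure _
  have h1 : ∀ (k : ℤ) (y : Y), A (mono k y) ∈ N := fun k y => by
    refine hD.induction (P := fun y => A (mono k y) ∈ N) ?_
      (hNc.preimage (A.continuous.comp (mono k).continuous)) y
    rintro _ ⟨y, rfl⟩
    rw [hN]
    exact subset_closure ⟨Finsupp.single k y, Finsupp.lsum_single ..⟩
  have h2 : N.comap A.toLinearMap = ⊤ := eq_top_of_mono_mem (hNc.preimage A.continuous) h1
  intro z
  have hz : z ∈ N := by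
    refine hA.induction (P := fun z => z ∈ N) ?_ hNc z
    rintro _ ⟨f, rfl⟩
    have hf : f ∈ N.comap A.toLinearMap := by
      rw [h2]
      trivial
    exact hf
  rw [hN] at hz
  exact hz

theorem denseRange_lsum_deltaMap (hT' : ‖adjoint T‖ ≤ 1) :
    DenseRange (Finsupp.lsum ℂ (fun n : ℤ => (deltaMap T hT' ∘L
      (mono (E := defectSpace T) n).toContinuousLinearMap ∘L defectMap T).toLinearMap)) :=
  denseRange_lsum_comp_mono (denseRange_defectMap T)
    (denseRange_codRestrict_topologicalClosure (mulDelta T hT') _)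

theorem norm_omegaNFD (hc : IsCNU T) (hT : ‖T‖ ≤ 1) (hT' : ‖adjoint T‖ ≤ 1) (x : ResSpace T) :
    ‖omegaNFD T hT' x‖ = ‖x‖ :=
  norm_extendOfNorm_apply (hc.denseRange_lsum hT) (norm_lsum_deltaMap hT hT') x

theorem surjective_omegaNFD (hc : IsCNU T) (hT : ‖T‖ ≤ 1) (hT' : ‖adjoint T‖ ≤ 1) :
    Function.Surjective (omegaNFD T hT') :=
  surjective_extendOfNorm (hc.denseRange_lsum hT) (denseRange_lsum_deltaMap hT')
    (norm_lsum_deltaMap hT hT')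

end Omega

/-- The operator `ω` is isometric and surjective. -/
def IsUnitaryMap {E Z : Type*} [NormedAddCommGroup E] [InnerProductSpace ℂ E]
    [NormedAddCommGroup Z] [InnerProductSpace ℂ Z] (ω : E →L[ℂ] Z) : Prop :=
  (∀ q, ‖ω q‖ = ‖q‖) ∧ Function.Surjective ω

theorem isUnitaryMap_omegaNFD {H : Type u} [NormedAddCommGroup H] [InnerProductSpace ℂ H]
    [CompleteSpace H] {T : H →L[ℂ] H} (hc : IsCNU T) (hT : ‖T‖ ≤ 1) (hT' : ‖adjoint T‖ ≤ 1) :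
    IsUnitaryMap (Z := deltaSpace T hT') (omegaNFD T hT') :=
  ⟨norm_omegaNFD hc hT hT', surjective_omegaNFD hc hT hT'⟩

/-! ### The Sz.-Nagy–Foias model as a transported Douglas model -/

section Model

variable {H : Type u} [NormedAddCommGroup H] [InnerProductSpace ℂ H] [CompleteSpace H]
  {T₁ T₂ : H →L[ℂ] H} (h₁ : ‖T₁‖ ≤ 1) (h₂ : ‖T₂‖ ≤ 1) (hc : IsCNU (T₁ * T₂))

/-- The model on `H²(ℱ) ⊕ Z` in which the residual part is transported by `ω : 𝒬_{T*} → Z`. -/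
noncomputable def transportedLift {Z : Type u} [NormedAddCommGroup Z] [InnerProductSpace ℂ Z]
    [CompleteSpace Z] (hT : ‖adjoint (T₁ * T₂)‖ ≤ 1) (t : PreAndoTuple (adjoint (T₁ * T₂)))
    (ω : ResSpace (T₁ * T₂) →L[ℂ] Z) : LiftTriple H where
  K := WithLp 2 (H2 t.F × Z)
  emb := blockCol (t.obs hT) (ω ∘L resMap (T₁ * T₂))
  V₁ := blockDiag t.M₁ (ω ∘L canonicalUnitary (T₁ * T₂) T₁ ∘L adjoint ω)
  V₂ := blockDiag t.M₂ (ω ∘L canonicalUnitary (T₁ * T₂) T₂ ∘L adjoint ω)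

/-- The decomposition of the space of a transported model. -/
noncomputable def transportedModelData {Z : Type u} [NormedAddCommGroup Z] [InnerProductSpace ℂ Z]
    [CompleteSpace Z] (hT : ‖adjoint (T₁ * T₂)‖ ≤ 1) (t : PreAndoTuple (adjoint (T₁ * T₂)))
    {ω : ResSpace (T₁ * T₂) →L[ℂ] Z} (hω : IsUnitaryMap ω) :
    ModelData hT t (transportedLift hT t ω) where
  inl := (WithLp.prodContinuousLinearEquiv 2 ℂ (H2 t.F) Z).symm.toContinuousLinearMap ∘L
    ContinuousLinearMap.inl ℂ (H2 t.F) Z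
  inr := (WithLp.prodContinuousLinearEquiv 2 ℂ (H2 t.F) Z).symm.toContinuousLinearMap ∘L
    ContinuousLinearMap.inr ℂ (H2 t.F) Z ∘L ω
  inner_eq f q g r := by
    have h := WithLp.prod_inner_apply (𝕜 := ℂ) (WithLp.toLp 2 (f, ω q)) (WithLp.toLp 2 (g, ω r))
    refine Eq.trans (congrArg₂ (Inner.inner ℂ) ?_ ?_)
      (h.trans (congrArg _ (inner_map_map_of_norm hω.1 q r)))
    · exact (toLp_eq_add f _).symm
    · exact (toLp_eq_add g _).symm
  exists_eq k := by
    obtain ⟨q, hq⟩ := hω.2 (WithLp.snd (α := H2 t.F) k)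
    refine ⟨WithLp.fst (α := H2 t.F) (β := Z) k, q, ?_⟩
    have h := toLp_eq_add (WithLp.fst (α := H2 t.F) (β := Z) k) (ω q)
    refine Eq.trans ?_ h
    rw [hq]
    rfl
  emb_apply x := toLp_eq_add _ _
  V₁_inl f := congrArg (fun q => WithLp.toLp 2 (t.M₁ f, q))
    (map_zero (ω ∘L canonicalUnitary (T₁ * T₂) T₁ ∘L adjoint ω))
  V₂_inl f := congrArg (fun q => WithLp.toLp 2 (t.M₂ f, q))
    (map_zero (ω ∘L canonicalUnitary (T₁ * T₂) T₂ ∘L adjoint ω))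
  V₁_inr q := congrArg₂ (fun f r => WithLp.toLp 2 (f, ω (canonicalUnitary (T₁ * T₂) T₁ r)))
    (map_zero t.M₁) (adjoint_apply_apply_of_norm hω.1 q)
  V₂_inr q := congrArg₂ (fun f r => WithLp.toLp 2 (f, ω (canonicalUnitary (T₁ * T₂) T₂ r)))
    (map_zero t.M₂) (adjoint_apply_apply_of_norm hω.1 q)

/-- The decomposition of the space of the Sz.-Nagy–Foias model. -/
noncomputable def nagyFoiasModelData (t : PreAndoTuple (adjoint (T₁ * T₂))) :
    ModelData (norm_adjoint_mul_le_one h₁ h₂) t (nagyFoiasLift T₁ T₂ h₁ h₂ t) := by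
  have h := @isUnitaryMap_omegaNFD H _ _ _ (T₁ * T₂) hc (norm_mul_le_one h₁ h₂)
    (norm_adjoint_mul_le_one h₁ h₂)
  -- By definition this is the transported model with `Z` the closure of `Ran Δ`; passing to a
  -- general `Z` hides the concrete `L²` space.
  have hE : nagyFoiasLift T₁ T₂ h₁ h₂ t =
      transportedLift (Z := deltaSpace (T₁ * T₂) (norm_adjoint_mul_le_one h₁ h₂))
        (norm_adjoint_mul_le_one h₁ h₂) t
        (omegaNFD (T₁ * T₂) (norm_adjoint_mul_le_one h₁ h₂)) := rfl
  rw [hE]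
  refine transportedModelData (Z := deltaSpace (T₁ * T₂) (norm_adjoint_mul_le_one h₁ h₂))
    (norm_adjoint_mul_le_one h₁ h₂) t
    (ω := omegaNFD (T₁ * T₂) (norm_adjoint_mul_le_one h₁ h₂)) ?_
  exact h

end Model
/-! ### Classes of minimal lifts -/

section Classes

variable {H : Type u} [NormedAddCommGroup H] [InnerProductSpace ℂ H] [CompleteSpace H]
  {T₁ T₂ : H →L[ℂ] H} (hcomm : T₁ * T₂ = T₂ * T₁) (h₁ : ‖T₁‖ ≤ 1) (h₂ : ‖T₂‖ ≤ 1)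

include hcomm in
-- The lift and the Douglas model of its wandering tuple are models of one and the same tuple, so
-- the identity coincidence makes them equivalent.
theorem exists_minimalTypeITuple (L : MinimalAndoLift T₁ T₂) : ∃ t : MinimalTypeITuple T₁ T₂,
    UnitarilyEquivalent (douglasLift T₁ T₂ h₁ h₂ t.1) L.1 := by
  have hT := norm_adjoint_mul_le_one h₁ h₂
  have m := (L.2.1.pureData hT).modelData L.2.1 hcomm h₁ h₂ L.2.2
  refine ⟨⟨L.2.1.tuple hT, L.2.1.isTypeI_tuple hcomm hT, m.isMinimal_tuple L.2.2⟩, ?_⟩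
  exact (douglasModelData h₁ h₂ _).unitarilyEquivalent_of_coincide m
    (PreAndoTuple.Coincide.equivalence.refl _)

/-- The Douglas model of a minimal tuple. -/
noncomputable def minimalDouglasLift (t : MinimalTypeITuple T₁ T₂) : MinimalAndoLift T₁ T₂ :=
  ⟨douglasLift T₁ T₂ h₁ h₂ t.1, isAndoLift_douglasLift hcomm h₁ h₂ t.2.1,
    (douglasModelData h₁ h₂ t.1).isMinimal_triple hcomm h₁ h₂ t.2.2⟩

include hcomm in
theorem unitarilyEquivalent_douglasLift_iff (t t' : PreAndoTuple (adjoint (T₁ * T₂))) :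
    UnitarilyEquivalent (douglasLift T₁ T₂ h₁ h₂ t) (douglasLift T₁ T₂ h₁ h₂ t') ↔
      t.Coincide t' :=
  ⟨(douglasModelData h₁ h₂ t).coincide_of_unitarilyEquivalent (douglasModelData h₁ h₂ t')
    hcomm h₁ h₂, (douglasModelData h₁ h₂ t).unitarilyEquivalent_of_coincide
    (douglasModelData h₁ h₂ t')⟩

theorem unitarilyEquivalent_douglasLift_nagyFoiasLift (hc : IsCNU (T₁ * T₂))
    (t : PreAndoTuple (adjoint (T₁ * T₂))) :
    UnitarilyEquivalent (douglasLift T₁ T₂ h₁ h₂ t) (nagyFoiasLift T₁ T₂ h₁ h₂ t) :=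
  (douglasModelData h₁ h₂ t).unitarilyEquivalent_of_coincide (nagyFoiasModelData h₁ h₂ hc t)
    (PreAndoTuple.Coincide.equivalence.refl t)

/-- The bijection from classes of minimal tuples onto classes of minimal lifts. -/
noncomputable def classEquiv :
    Quotient (tupleSetoid T₁ T₂) ≃ Quotient (liftSetoid T₁ T₂) :=
  Equiv.ofBijective
    (Quotient.map (minimalDouglasLift hcomm h₁ h₂) fun t t' h =>
      (unitarilyEquivalent_douglasLift_iff hcomm h₁ h₂ t.1 t'.1).2 h)
    ⟨by
      intro a b
      refine Quotient.inductionOn₂ a b fun t t' h => Quotient.sound ?_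
      exact (unitarilyEquivalent_douglasLift_iff hcomm h₁ h₂ t.1 t'.1).1 (Quotient.exact h), by
      intro a
      refine Quotient.inductionOn a fun L => ?_
      obtain ⟨t, ht⟩ := exists_minimalTypeITuple hcomm h₁ h₂ L
      exact ⟨⟦t⟧, Quotient.sound ht⟩⟩

theorem classEquiv_mk_eq_iff (t : MinimalTypeITuple T₁ T₂) (L : MinimalAndoLift T₁ T₂) :
    classEquiv hcomm h₁ h₂ ⟦t⟧ = ⟦L⟧ ↔
      UnitarilyEquivalent (douglasLift T₁ T₂ h₁ h₂ t.1) L.1 :=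
  ⟨fun h => Quotient.exact (s := liftSetoid T₁ T₂) (a := minimalDouglasLift hcomm h₁ h₂ t) h,
    fun h => Quotient.sound (s := liftSetoid T₁ T₂) (a := minimalDouglasLift hcomm h₁ h₂ t) h⟩

end Classes
end Ando

/-! ### Assembly of the three statements -/

theorem mainTheorem2 {H : Type*} [NormedAddCommGroup H] [InnerProductSpace ℂ H] [CompleteSpace H]
    (T₁ T₂ : H →L[ℂ] H) (hcomm : T₁ * T₂ = T₂ * T₁) (h₁ : ‖T₁‖ ≤ 1) (h₂ : ‖T₂‖ ≤ 1) :
    -- Douglas models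
    (∀ t : Ando.PreAndoTuple (ContinuousLinearMap.adjoint (T₁ * T₂)), t.IsTypeI T₁ T₂ →
      Ando.IsAndoLift T₁ T₂ (Ando.douglasLift T₁ T₂ h₁ h₂ t)) ∧
    (∀ t t' : Ando.PreAndoTuple (ContinuousLinearMap.adjoint (T₁ * T₂)),
      t.IsTypeI T₁ T₂ → t'.IsTypeI T₁ T₂ →
      (Ando.UnitarilyEquivalent (Ando.douglasLift T₁ T₂ h₁ h₂ t)
          (Ando.douglasLift T₁ T₂ h₁ h₂ t') ↔ t.Coincide t')) ∧
    -- Sz.-Nagy–Foias models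
    (Ando.IsCNU (T₁ * T₂) →
      (∀ t : Ando.PreAndoTuple (ContinuousLinearMap.adjoint (T₁ * T₂)), t.IsTypeI T₁ T₂ →
        Ando.IsAndoLift T₁ T₂ (Ando.nagyFoiasLift T₁ T₂ h₁ h₂ t) ∧
        Ando.UnitarilyEquivalent (Ando.douglasLift T₁ T₂ h₁ h₂ t)
          (Ando.nagyFoiasLift T₁ T₂ h₁ h₂ t)) ∧
      (∀ t t' : Ando.PreAndoTuple (ContinuousLinearMap.adjoint (T₁ * T₂)),
        t.IsTypeI T₁ T₂ → t'.IsTypeI T₁ T₂ →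
        (Ando.UnitarilyEquivalent (Ando.nagyFoiasLift T₁ T₂ h₁ h₂ t)
            (Ando.nagyFoiasLift T₁ T₂ h₁ h₂ t') ↔ t.Coincide t'))) ∧
    -- the bijection between classes
    (∃ Φ : Quotient (Ando.tupleSetoid T₁ T₂) ≃ Quotient (Ando.liftSetoid T₁ T₂),
      ∀ (t : Ando.MinimalTypeITuple T₁ T₂) (L : Ando.MinimalAndoLift T₁ T₂),
        (Φ ⟦t⟧ = ⟦L⟧ ↔ Ando.UnitarilyEquivalent (Ando.douglasLift T₁ T₂ h₁ h₂ t.1) L.1) ∧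
        (Ando.IsCNU (T₁ * T₂) →
          (Φ ⟦t⟧ = ⟦L⟧ ↔ Ando.UnitarilyEquivalent (Ando.nagyFoiasLift T₁ T₂ h₁ h₂ t.1) L.1))) := by
  open Ando in
  refine ⟨fun t ht => isAndoLift_douglasLift hcomm h₁ h₂ ht,
    fun t t' _ _ => unitarilyEquivalent_douglasLift_iff hcomm h₁ h₂ t t',
    fun hc => ⟨fun t ht => ?_, fun t t' _ _ => ?_⟩,
    classEquiv hcomm h₁ h₂, fun t L => ⟨classEquiv_mk_eq_iff hcomm h₁ h₂ t L, fun hc => ?_⟩⟩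
  · have h := unitarilyEquivalent_douglasLift_nagyFoiasLift h₁ h₂ hc t
    exact ⟨h.isAndoLift (isAndoLift_douglasLift hcomm h₁ h₂ ht), h⟩
  · exact ⟨(nagyFoiasModelData h₁ h₂ hc t).coincide_of_unitarilyEquivalent
      (nagyFoiasModelData h₁ h₂ hc t') hcomm h₁ h₂,
      (nagyFoiasModelData h₁ h₂ hc t).unitarilyEquivalent_of_coincide
        (nagyFoiasModelData h₁ h₂ hc t')⟩
  · have h := unitarilyEquivalent_douglasLift_nagyFoiasLift h₁ h₂ hc t.1
    rw [classEquiv_mk_eq_iff]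
    exact ⟨UnitarilyEquivalent.equivalence.trans (UnitarilyEquivalent.equivalence.symm h),
      UnitarilyEquivalent.equivalence.trans h⟩
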